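/- **Setting.** Let $f,g:\mathbb R^{d_x}\times\mathbb R^{d_y}\to\mathbb R$, $g^c:\mathbb R^{d_x}\times\mathbb R^{d_y}\to\mathbb R^{d_c}$, $\mathcal X\subseteq\mathbb R^{d_x}$, $\mathcal Y\subseteq\mathbb R^{d_y}$, $\mathcal Y(x)=\{y\in\mathcal Y: g^c(x,y)\le 0\}$, $v(x)=\min_{y\in\mathcal Y(x)}g(x,y)$, and for a penalty constant $\gamma$ $$L_g(\mu,y;x)=g(x,y)+\langle\mu,g^c(x,y)\rangle,\qquad L_F(\mu,y;x)=f(x,y)+\gamma(g(x,y)-v(x))+\langle\mu,g^c(x,y)\rangle .$$ Let $D_g(\mu)=\min_{y\in\mathcal Y}L_g(\mu,y;x)$, $D_F(\mu)=\min_{y\in\mathcal Y}L_F(\mu,y;x)$, and let $(\mu_g^*(x),y_g^*(x))$, $(\mu_F^*(x),y_F^*(x))$ be the solutions of $\max_{\mu\in\mathbb R^{d_c}_+}\min_{y\in\mathcal Y}L_g$ and $\max_{\mu\in\mathbb R^{d_c}_+}\min_{y\in\mathcal Y}L_F$, assumed to exist. **Assumptions.** (1) On $\mathcal X\times\mathcal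 Y$ the functions $f,g,g^c$ are differentiable; $f,\nabla f,\nabla g,g^c,\nabla g^c$ are Lipschitz in $(x,y)$ with constants $l_{f,0},l_{f,1},l_{g,1},l_{g^c,0},l_{g^c,1}$, and $g$ is $l_{g_x,0}$-Lipschitz in $x$. (2) For each $x\in\mathcal X$, $g(x,\cdot)$ is $\alpha_g$-strongly convex ($\alpha_g>0$) and each component of $g^c(x,\cdot)$ is convex on $\mathcal Y$. (3) $\mathcal X,\mathcal Y$ are nonempty, closed and convex, and $\mathcal Y(x)\neq\emptyset$ for $x\in\mathcal X$. (4) For each $x\in\mathcal X$ and $y\in\mathcal Y(x)$ the gradients in $y$ of the active components of $g^c(x,\cdot)$ are linearly independent. (5) There is $B_g$ with $\|\mu_g^*(x)\|<B_g$ for all $x\in\mathcal X$, and there are $\delta_g,C_{\delta_g}>0$ such that for all $x\in\mathcal X$ $$\langle-\nabla D_g(\mu)+\nabla D_g(\mu_g^*(x)),\mu-\mu_g^*(x)\rangle\ge C_{\delta_g}\|\mu-\mu_g^*(x)\|^2\quad\text{for all }\mu\in\mathbb R^{d_c}_+,\ \|\mu-\mu_g^*(x)\|<\delta_g. $$ **Algorithm.**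 $\mathsf{MaxMin}(T,T_y)$ for $L(\mu,y)$, with stepsizes $\eta_1,\eta_2$ and start $(y_0,\mu_0)\in\mathcal Y\times\mathbb R^{d_c}_+$, $\mu_{-1}=\mu_0$: for $t=0,\dots,T-1$ put $\mu_{t+1/2}=\mu_t+\frac{t-1}{t+2}(\mu_t-\mu_{t-1})$; obtain $y_{t+1}$ from $y_t$ by $T_y$ steps $y\leftarrow\mathrm{Proj}_{\mathcal Y}(y-\eta_1\nabla_yL(\mu_{t+1/2},y))$; put $\mu_{t+1}=\mathrm{Proj}_{\mathbb R^{d_c}_+}(\mu_{t+1/2}+\eta_2\nabla_\mu L(\mu_{t+1/2},y_{t+1}))$. The output is $(y_T,\mu_T)$. The outer algorithm BLOCC, started at $x_0\in\mathcal X$, calls at iteration $t$ the subroutine with counters $(T_g,T_y^g)$ and stepsizes $\eta_{g,1},\eta_{g,2}$ on $L_g(\cdot,\cdot;x_t)$, with output $(y_{g,t}^{T_g},\mu_{g,t}^{T_g})$, and with counters $(T_F,T_y^F)$ and stepsizes $\eta_{F,1},\eta_{F,2}$ on $L_F(\cdot,\cdot;x_t)$, with output $(y_{F,t}^{T_F},\mu_{F,t}^{T_F})$.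 The calls at iteration $0$ start at given points, later ones at the outputs of the preceding call for the same problem. Then $x_{t+1}=\mathrm{Proj}_{\mathcal X}(x_t-\eta g_{F,t})$, where (with $y_g,\mu_g,y_F,\mu_F$ denoting these outputs) $g_{F,t}=\nabla_xf(x_t,y_F)+\gamma\big(\nabla_xg(x_t,y_F)-\nabla_xg(x_t,y_g)-\langle\mu_g,\nabla_xg^c(x_t,y_g)\rangle\big)+\langle\mu_F,\nabla_xg^c(x_t,y_F)\rangle$. Below, $\|(y,\mu)-(y',\mu')\|^2=\|y-y'\|^2+\|\mu-\mu'\|^2$. **Theorem 3.** (i) *Inner convergence.* Fix $\gamma>l_{f,1}/\alpha_g$, and let $B_F$, $\delta_F,C_{\delta_F}>0$ be such that $\|\mu_F^*(x)\|<B_F$ on $\mathcal X$ and the curvature condition in (5) holds for $D_F$, $\mu_F^*(x)$, $C_{\delta_F}$, $\delta_F$, for all $x\in\mathcal X$. Let $\eta>0$. For all sufficiently small constant stepsizes $\eta_{g,1},\eta_{g,2},\eta_{F,1},\eta_{F,2}>0$ there are constants $A,A',C$ such that for all $0<\epsilon_g\le\frac{C_{\delta_g}}2\delta_g$ and $0<\epsilon_F\le\frac{C_{\delta_F}}2\delta_F$,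 with $$T_g=\lceil A\epsilon_g^{-1/2}\rceil,\quad T_F=\lceil A\epsilon_F^{-1/2}\rceil,\quad T_y^g=\lceil A'\max(1,\ln\epsilon_g^{-1})\rceil,\quad T_y^F=\lceil A'\max(1,\ln\epsilon_F^{-1})\rceil,$$ the iterates of BLOCC satisfy, for every $t\ge0$, $$\|(y_{g,t}^{T_g},\mu_{g,t}^{T_g})-(y_g^*(x_t),\mu_g^*(x_t))\|^2\le C\epsilon_g,\qquad\|(y_{F,t}^{T_F},\mu_{F,t}^{T_F})-(y_F^*(x_t),\mu_F^*(x_t))\|^2\le C\epsilon_F .$$ Moreover, for each of the two problems separately, the same rate holds for a single call of $\mathsf{MaxMin}$, uniformly over $x\in\mathcal X$ and over all admissible starting points at distance at most $R$ from the solution, with step-size thresholds and constants that may depend on $R$. (ii) *Overall complexity.* Let $\gamma_0\ge l_{f,1}/\alpha_g$, $B_F$, and $\delta_F,C_F>0$ be such that for all $\gamma>\gamma_0$ and $x\in\mathcal X$ one has $\|\mu_F^*(x)\|<B_F\gamma$ and the curvature condition for $D_F$ at $\mu_F^*(x)$ with constant $C_F/\gamma$ and radius $\delta_F$; let $f$ be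 bounded below on $\{(x,y):x\in\mathcal X,\,y\in\mathcal Y(x)\}$. Fix the initial points and $c_\gamma>0$. For all sufficiently small constants $c,c_{g,1},c_{g,2},c_{F,1},c_{F,2}>0$ there are constants $A,A',A'',C,\epsilon_0>0$ such that for all $0<\epsilon\le\epsilon_0$: with $\gamma=c_\gamma\epsilon^{-1/2}$ (and then $\gamma>\gamma_0$), stepsizes $\eta=c/\gamma$, $\eta_{g,i}=c_{g,i}$, $\eta_{F,1}=c_{F,1}/\gamma$, $\eta_{F,2}=c_{F,2}\gamma$, counters as in (i) for $\epsilon_g=\epsilon_F=\epsilon^2$, and $K=\lceil A''\epsilon^{-3/2}\rceil$ outer iterations, BLOCC reaches $$\frac1K\sum_{t=0}^{K-1}\Big\|\frac{x_{t+1}-x_t}{\eta}\Big\|^2\le\epsilon$$ with a total of at most $C\epsilon^{-5/2}\ln\epsilon^{-1}$ projected gradient steps (in $x$, $y$ and $\mu$ together), that is, $\tilde{\mathcal O}(\epsilon^{-2.5})$. -/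

import Mathlib

open scoped NNReal

noncomputable section

/-- Euclidean `n`-space. -/
abbrev Vec (n : ℕ) : Type := EuclideanSpace ℝ (Fin n)

/-- The nonnegative orthant of Euclidean `n`-space. -/
def orthant (n : ℕ) : Set (Vec n) := {u | ∀ i, 0 ≤ u i}

open Classical in
/-- Euclidean projection onto `S`: a nearest point of `S` (it exists and is unique when `S` is
nonempty, closed and convex). -/
def proj {n : ℕ} (S : Set (Vec n)) (u : Vec n) : Vec n :=
  if h : ∃ p ∈ S, ∀ q ∈ S, ‖u - p‖ ≤ ‖u - q‖ then h.choose else u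

/-- The data of a bilevel problem with coupled constraints
`min_{x ∈ X} f(x, y*(x))`, `y*(x) = argmin {g(x,y) : y ∈ Y, gc(x,y) ≤ 0}`. -/
structure BLOData (dx dy dc : ℕ) where
  f : Vec dx → Vec dy → ℝ
  g : Vec dx → Vec dy → ℝ
  gc : Vec dx → Vec dy → Vec dc
  X : Set (Vec dx)
  Y : Set (Vec dy)

namespace BLOData

variable {dx dy dc : ℕ} (P : BLOData dx dy dc)

/-- `Y(x)`, the lower-level feasible set. -/
def feas (x : Vec dx) : Set (Vec dy) := {y | y ∈ P.Y ∧ ∀ i, P.gc x y i ≤ 0}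

/-- The lower-level value function `v(x) = min_{y ∈ Y(x)} g(x,y)`. -/
def v (x : Vec dx) : ℝ := sInf (P.g x '' P.feas x)

/-- The Lagrangian `L_g(μ,y;x) = g(x,y) + ⟨μ, gc(x,y)⟩` of the lower-level problem. -/
def Lg (x : Vec dx) (μ : Vec dc) (y : Vec dy) : ℝ := P.g x y + inner ℝ μ (P.gc x y)

/-- The Lagrangian `L_F(μ,y;x) = f(x,y) + γ (g(x,y) - v(x)) + ⟨μ, gc(x,y)⟩` of the penalized
problem. -/
def LF (γ : ℝ) (x : Vec dx) (μ : Vec dc) (y : Vec dy) : ℝ :=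
  P.f x y + γ * (P.g x y - P.v x) + inner ℝ μ (P.gc x y)

/-- `X × Y` inside the Euclidean product space. -/
def dom : Set (WithLp 2 (Vec dx × Vec dy)) := {z | z.fst ∈ P.X ∧ z.snd ∈ P.Y}

/-- `f`, `g`, `gc` as functions of the joint variable `z = (x,y)`. -/
def fJ (z : WithLp 2 (Vec dx × Vec dy)) : ℝ := P.f z.fst z.snd
def gJ (z : WithLp 2 (Vec dx × Vec dy)) : ℝ := P.g z.fst z.snd
def gcJ (z : WithLp 2 (Vec dx × Vec dy)) : Vec dc := P.gc z.fst z.snd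

/-- Lipschitz continuity (and the differentiability it presupposes) on `X × Y`. -/
structure LipschitzAss (lf0 lf1 lg1 lgx0 lgc0 lgc1 : ℝ≥0) : Prop where
  diff_f : ∀ z ∈ P.dom, DifferentiableAt ℝ P.fJ z
  diff_g : ∀ z ∈ P.dom, DifferentiableAt ℝ P.gJ z
  diff_gc : ∀ z ∈ P.dom, DifferentiableAt ℝ P.gcJ z
  lip_f : LipschitzOnWith lf0 P.fJ P.dom
  lip_grad_f : LipschitzOnWith lf1 (gradient P.fJ) P.dom
  lip_grad_g : LipschitzOnWith lg1 (gradient P.gJ) P.dom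
  lip_gc : LipschitzOnWith lgc0 P.gcJ P.dom
  lip_grad_gc : LipschitzOnWith lgc1 (fderiv ℝ P.gcJ) P.dom
  lip_g_x : ∀ y ∈ P.Y, LipschitzOnWith lgx0 (fun x => P.g x y) P.X

/-- `g(x,·)` is `αg`-strongly convex and every component of `gc(x,·)` is convex on `Y`. -/
structure ConvexAss (αg : ℝ) : Prop where
  strong : ∀ x ∈ P.X, StrongConvexOn P.Y αg (P.g x)
  convex : ∀ x ∈ P.X, ∀ i, ConvexOn ℝ P.Y (fun y => P.gc x y i)

/-- `X` and `Y` are nonempty, closed, convex, and `Y(x)` is nonempty for every `x ∈ X`. -/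
structure DomainAss : Prop where
  X_nonempty : P.X.Nonempty
  X_closed : IsClosed P.X
  X_convex : Convex ℝ P.X
  Y_nonempty : P.Y.Nonempty
  Y_closed : IsClosed P.Y
  Y_convex : Convex ℝ P.Y
  feas_nonempty : ∀ x ∈ P.X, (P.feas x).Nonempty

/-- Linear independence constraint qualification in `y`: at each feasible point the gradients of
the active coupled constraints are linearly independent. -/
def LICQ : Prop :=
  ∀ x ∈ P.X, ∀ y ∈ P.feas x,
    LinearIndependent ℝ
      (fun i : {i : Fin dc // P.gc x y i = 0} => gradient (fun y' => P.gc x y' i.1) y)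

end BLOData

section MaxMin

variable {dc dy : ℕ}

/-- The dual function `D(μ) = min_{y ∈ Y} L(μ,y)`. -/
def dualFn (L : Vec dc → Vec dy → ℝ) (Y : Set (Vec dy)) (μ : Vec dc) : ℝ := sInf (L μ '' Y)

/-- `(μs, ys)` is a solution of `max_{μ ≥ 0} min_{y ∈ Y} L(μ,y)`: `μs` maximizes the dual function
over the orthant and `ys` attains the inner minimum at `μs`. -/
structure IsMaxMin (L : Vec dc → Vec dy → ℝ) (Y : Set (Vec dy)) (μs : Vec dc) (ys : Vec dy) :
    Prop where
  nonneg : μs ∈ orthant dc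
  max : ∀ μ ∈ orthant dc, dualFn L Y μ ≤ dualFn L Y μs
  mem : ys ∈ Y
  min : ∀ y ∈ Y, L μs ys ≤ L μs y

/-- Local restricted secant inequality, with constant `C` and radius `δ`, for the concave function
`D` on the orthant near `μs`. -/
def LocalRSI (D : Vec dc → ℝ) (μs : Vec dc) (C δ : ℝ) : Prop :=
  ∀ μ ∈ Metric.ball μs δ ∩ orthant dc,
    C * ‖μ - μs‖ ^ 2 ≤ inner ℝ (-gradient D μ + gradient D μs) (μ - μs)

/-- State of the accelerated max-min subroutine: `μ_{t-1}`, `μ_t`, `y_t`. -/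
structure MaxMinState (dc dy : ℕ) where
  μprev : Vec dc
  μ : Vec dc
  y : Vec dy

/-- One projected gradient step in `y` on `L(μ,·)` with stepsize `η₁`. -/
def pgdStep (L : Vec dc → Vec dy → ℝ) (Y : Set (Vec dy)) (η₁ : ℝ) (μ : Vec dc) (y : Vec dy) :
    Vec dy :=
  proj Y (y - η₁ • gradient (fun y' => L μ y') y)

/-- The momentum point `μ_{t+1/2} = μ_t + (t-1)/(t+2) (μ_t - μ_{t-1})`. -/
def momentum (t : ℕ) (s : MaxMinState dc dy) : Vec dc :=
  s.μ + (((t : ℝ) - 1) / ((t : ℝ) + 2)) • (s.μ - s.μprev)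

/-- Iteration `t` of the accelerated subroutine: momentum step, `Ty` projected gradient steps in
`y` started at `y_t`, one projected gradient ascent step in `μ`. -/
def maxMinStep (L : Vec dc → Vec dy → ℝ) (Y : Set (Vec dy)) (η₁ η₂ : ℝ) (Ty t : ℕ)
    (s : MaxMinState dc dy) : MaxMinState dc dy :=
  let μh := momentum t s
  let y' := (pgdStep L Y η₁ μh)^[Ty] s.y
  { μprev := s.μ
    μ := proj (orthant dc) (μh + η₂ • gradient (fun μ' => L μ' y') μh)
    y := y' }

/-- The state after `t` iterations, started at `(y₀, μ₀)` with `μ_{-1} = μ₀`. -/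
def maxMinIter (L : Vec dc → Vec dy → ℝ) (Y : Set (Vec dy)) (η₁ η₂ : ℝ) (Ty : ℕ)
    (y₀ : Vec dy) (μ₀ : Vec dc) : ℕ → MaxMinState dc dy
  | 0 => ⟨μ₀, μ₀, y₀⟩
  | t + 1 => maxMinStep L Y η₁ η₂ Ty t (maxMinIter L Y η₁ η₂ Ty y₀ μ₀ t)

/-- The output `(y_T, μ_T)` of the accelerated subroutine `MaxMin(T, Ty)`. -/
def maxMin (L : Vec dc → Vec dy → ℝ) (Y : Set (Vec dy)) (η₁ η₂ : ℝ) (T Ty : ℕ)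
    (y₀ : Vec dy) (μ₀ : Vec dc) : Vec dy × Vec dc :=
  ((maxMinIter L Y η₁ η₂ Ty y₀ μ₀ T).y, (maxMinIter L Y η₁ η₂ Ty y₀ μ₀ T).μ)

/-- Number of projected gradient steps performed by `MaxMin(T, Ty)`: each of the `T` iterations
makes `Ty` steps in `y` and one step in `μ`. -/
def maxMinCost (T Ty : ℕ) : ℕ := T * (Ty + 1)

/-- Squared Euclidean distance between the pairs `p = (y, μ)` and `(ys, μs)`. -/
def sqErr (p : Vec dy × Vec dc) (ys : Vec dy) (μs : Vec dc) : ℝ :=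
  ‖p.1 - ys‖ ^ 2 + ‖p.2 - μs‖ ^ 2

end MaxMin

/-- Iteration count of order `ε^{-1/2}`. -/
def outerCount (A ε : ℝ) : ℕ := ⌈A * ε ^ (-(1 / 2) : ℝ)⌉₊

/-- Iteration count of order `ln ε⁻¹` (and at least of order one). -/
def innerCount (A ε : ℝ) : ℕ := ⌈A * max 1 (Real.log ε⁻¹)⌉₊

/-- The accelerated subroutine solves, uniformly in `x ∈ X`, the family of problems
`max_{μ ≥ 0} min_{y ∈ Y} L x μ y` with solutions `(ys x, μs x)` to squared accuracy `O(ε)` in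
`O(ε^{-1/2})` iterations of `O(ln ε⁻¹)` inner steps each, for `0 < ε ≤ εmax`. The starting point is
at distance at most `R` from the solution; the stepsizes are any constants below thresholds that
do not depend on `ε`, `x` or the starting point. -/
def AccelMaxMinRate {dx dy dc : ℕ} (L : Vec dx → Vec dc → Vec dy → ℝ) (X : Set (Vec dx))
    (Y : Set (Vec dy)) (μs : Vec dx → Vec dc) (ys : Vec dx → Vec dy) (εmax : ℝ) : Prop :=
  ∀ R : ℝ, ∃ b₁ > 0, ∃ b₂ > 0, ∀ η₁ ∈ Set.Ioc 0 b₁, ∀ η₂ ∈ Set.Ioc 0 b₂,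
    ∃ A > 0, ∃ A' > 0, ∃ C > 0, ∀ ε ∈ Set.Ioc 0 εmax, ∀ x ∈ X,
      ∀ y₀ ∈ Y, ∀ μ₀ ∈ orthant dc, sqErr (y₀, μ₀) (ys x) (μs x) ≤ R ^ 2 →
        sqErr (maxMin (L x) Y η₁ η₂ (outerCount A ε) (innerCount A' ε) y₀ μ₀) (ys x) (μs x)
          ≤ C * ε

/-- Parameters of the outer algorithm: penalty constant, stepsizes, iteration counters. -/
structure BLOCCParams where
  γ : ℝ
  η : ℝ
  ηg1 : ℝ
  ηg2 : ℝ
  ηF1 : ℝ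
  ηF2 : ℝ
  Tg : ℕ
  Tyg : ℕ
  TF : ℕ
  TyF : ℕ

/-- State of the outer algorithm at the beginning of iteration `t`: `x_t` and the points at which
the two max-min subroutines are started. -/
structure BLOCCState (dx dy dc : ℕ) where
  x : Vec dx
  yg : Vec dy
  μg : Vec dc
  yF : Vec dy
  μF : Vec dc

namespace BLOData

variable {dx dy dc : ℕ} (P : BLOData dx dy dc)

/-- The initial points are admissible. -/
structure IsInit (s : BLOCCState dx dy dc) : Prop where
  x : s.x ∈ P.X
  yg : s.yg ∈ P.Y
  μg : s.μg ∈ orthant dc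
  yF : s.yF ∈ P.Y
  μF : s.μF ∈ orthant dc

/-- The output of the subroutine on `L_g(·,·;x_t)`. -/
def outG (p : BLOCCParams) (s : BLOCCState dx dy dc) : Vec dy × Vec dc :=
  maxMin (P.Lg s.x) P.Y p.ηg1 p.ηg2 p.Tg p.Tyg s.yg s.μg

/-- The output of the subroutine on `L_F(·,·;x_t)`. -/
def outF (p : BLOCCParams) (s : BLOCCState dx dy dc) : Vec dy × Vec dc :=
  maxMin (P.LF p.γ s.x) P.Y p.ηF1 p.ηF2 p.TF p.TyF s.yF s.μF

/-- `∇_x f(x,y)`, `∇_x g(x,y)`, `⟨μ, ∇_x gc(x,y)⟩`. -/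
def gradXf (x : Vec dx) (y : Vec dy) : Vec dx := gradient (fun x' => P.f x' y) x
def gradXg (x : Vec dx) (y : Vec dy) : Vec dx := gradient (fun x' => P.g x' y) x
def gradXgc (x : Vec dx) (μ : Vec dc) (y : Vec dy) : Vec dx :=
  gradient (fun x' => inner ℝ μ (P.gc x' y)) x

/-- The estimate of `∇v(x)` from an approximate solution `q = (y, μ)` of the `L_g` problem. -/
def estV (x : Vec dx) (q : Vec dy × Vec dc) : Vec dx := P.gradXg x q.1 + P.gradXgc x q.2 q.1

/-- The estimate of `∇F_γ(x)` from approximate solutions of the `L_g` and `L_F` problems. -/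
def estF (γ : ℝ) (x : Vec dx) (qg qF : Vec dy × Vec dc) : Vec dx :=
  P.gradXf x qF.1 + γ • (P.gradXg x qF.1 - P.estV x qg) + P.gradXgc x qF.2 qF.1

/-- One iteration of the outer algorithm; the next calls of the subroutines are started at the
current outputs. -/
def bloccStep (p : BLOCCParams) (s : BLOCCState dx dy dc) : BLOCCState dx dy dc :=
  { x := proj P.X (s.x - p.η • P.estF p.γ s.x (P.outG p s) (P.outF p s))
    yg := (P.outG p s).1
    μg := (P.outG p s).2
    yF := (P.outF p s).1
    μF := (P.outF p s).2 }

/-- The state at the beginning of outer iteration `t`. -/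
def blocc (p : BLOCCParams) (s₀ : BLOCCState dx dy dc) (t : ℕ) : BLOCCState dx dy dc :=
  (P.bloccStep p)^[t] s₀

/-- `(1/K) ∑_{t<K} ‖(x_{t+1} - x_t)/η‖²`, the averaged squared projected gradient. -/
def avgProjGrad (p : BLOCCParams) (s₀ : BLOCCState dx dy dc) (K : ℕ) : ℝ :=
  (1 / (K : ℝ)) * ∑ t ∈ Finset.range K,
    ‖(p.η)⁻¹ • ((P.blocc p s₀ (t + 1)).x - (P.blocc p s₀ t).x)‖ ^ 2

end BLOData

/-- Total number of projected gradient steps in `K` outer iterations: two calls of the subroutine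
and one step in `x` per outer iteration. -/
def bloccCost (p : BLOCCParams) (K : ℕ) : ℕ :=
  K * (maxMinCost p.Tg p.Tyg + maxMinCost p.TF p.TyF + 1)

end

/-!
Both Lagrangians have the form `L(μ, y) = h(y) + ⟨μ, c(y)⟩` with `h` strongly convex and `c`
componentwise convex, so on the orthant the dual function `D` is concave and smooth with
`∇D(μ) = c(ŷ(μ))`, where `ŷ(μ)` minimizes `L(μ, ·)` over `Y`. The subroutine is accelerated
projected ascent on `D` in which `ŷ` is replaced by the outcome of finitely many projected gradient
steps.

*The subroutine.* The momentum point `w` may leave the orthant, and then `L(w, ·)` need not be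
convex. Its projection `m` onto the orthant gives a convex `L(m, ·)`, and `‖w - m‖ ≤ ‖μ⁺ - w‖` for
the next iterate `μ⁺`. So the inner loop is an inexact gradient oracle for `D` whose error is a
multiple of `‖μ⁺ - w‖²`, absorbed by a small stepsize in `μ`, plus a term that is geometrically
small in the number of inner steps (`pgd_oracle`). The usual Lyapunov function of accelerated
methods then increases only by these small terms (`accelerated_step`, `accelInv_iter`), which gives
a dual gap of order `1/T²`. Concavity extends the local restricted secant inequality to a quadratic
growth bound at all small dual gaps (`sq_dist_le_of_dualGap`), and the gap controls the squared
error (`maxMin_sqErr_le`).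

*Rescaling.* Dividing `L_F` and its multiplier by `γ` yields the objective `f/γ + (g - v)`, whose
regularity constants are uniform in `γ`, and the algorithm with stepsizes `η₁/γ`, `η₂ γ` becomes
the one with stepsizes `η₁`, `η₂` (`maxMin_const_mul`). A multiplier bound of order `γ` and a
curvature constant of order `1/γ` turn into constants of order one; only the curvature radius
shrinks, like `1/γ ~ √ε`, and dual gaps of order `ε²` are below its square.

*The outer loop.* The multipliers of the rescaled penalized problem are Lipschitz in `x`: at small
scales by the restricted secant inequality, hence at all scales since `X` is convex
(`SaddleFamily.multiplier_lipschitz`). Together with the lower bound for `v` from weak duality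
(`PenaltySetting.v_lower`) this shows that the optimal value of the penalized problem, as a function
of `x`, has a quadratic upper bound with constant `O(γ)` (`PenaltySetting.value_upper`). If all
errors are at most one, the steps in `x` are bounded, so warm starts stay within a fixed radius of
the next solutions and the estimate for the subroutine applies at every iteration
(`PenaltySetting.outerInv_blocc`). For
`η = c/γ` with small `c`, each outer step decreases this value up to the subproblem errors,
and summing up gives an averaged squared projected gradient of order `γ/K + γ² ε²`
(`PenaltySetting.avgProjGrad_le`), which is of order `ε` for `γ ~ ε^{-1/2}` and `K ~ ε^{-3/2}`.
-/

/-! ### Euclidean projections and the nonnegative orthant -/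

section Projection

variable {n : ℕ} {S : Set (Vec n)}

theorem exists_nearest (hc : IsClosed S) (hne : S.Nonempty) (u : Vec n) :
    ∃ p ∈ S, ∀ q ∈ S, ‖u - p‖ ≤ ‖u - q‖ := by
  obtain ⟨p, hp, hd⟩ := hc.exists_infDist_eq_dist hne u
  refine ⟨p, hp, fun q hq => ?_⟩
  rw [← dist_eq_norm, ← dist_eq_norm, ← hd]
  exact Metric.infDist_le_dist_of_mem hq

theorem proj_spec (hc : IsClosed S) (hne : S.Nonempty) (u : Vec n) :
    proj S u ∈ S ∧ ∀ q ∈ S, ‖u - proj S u‖ ≤ ‖u - q‖ := by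
  have h := exists_nearest hc hne u
  rw [proj, dif_pos h]
  exact h.choose_spec

theorem proj_mem (hc : IsClosed S) (hne : S.Nonempty) (u : Vec n) : proj S u ∈ S :=
  (proj_spec hc hne u).1

/-- The variational inequality for points of `S` nearest to `u`. -/
theorem inner_nonpos_of_nearest (hS : Convex ℝ S) {u p : Vec n} (hp : p ∈ S)
    (hmin : ∀ q ∈ S, ‖u - p‖ ≤ ‖u - q‖) {q : Vec n} (hq : q ∈ S) :
    inner ℝ (u - p) (q - p) ≤ 0 := by
  refine (norm_eq_iInf_iff_real_inner_le_zero hS hp).1 ?_ q hq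
  have : Nonempty S := ⟨⟨p, hp⟩⟩
  refine le_antisymm (le_ciInf fun q => hmin q q.2) ?_
  exact ciInf_le ⟨0, by rintro _ ⟨q, rfl⟩; exact norm_nonneg _⟩ (⟨p, hp⟩ : S)

theorem proj_inner_nonpos (hc : IsClosed S) (hS : Convex ℝ S) (hne : S.Nonempty) (u : Vec n)
    {q : Vec n} (hq : q ∈ S) : inner ℝ (u - proj S u) (q - proj S u) ≤ 0 :=
  inner_nonpos_of_nearest hS (proj_mem hc hne u) (proj_spec hc hne u).2 hq

/-- Projecting onto `S` does not increase the distance to points of `S`. -/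
theorem norm_proj_sub_le (hc : IsClosed S) (hS : Convex ℝ S) (u : Vec n) {q : Vec n} (hq : q ∈ S) :
    ‖proj S u - q‖ ≤ ‖u - q‖ := by
  have h := proj_inner_nonpos hc hS ⟨q, hq⟩ u hq
  set p := proj S u
  have h1 : u - q = (u - p) - (q - p) := by abel
  have h2 := norm_sub_sq_real (u - p) (q - p)
  rw [← h1] at h2
  rw [norm_sub_rev p q]
  refine (sq_le_sq₀ (norm_nonneg _) (norm_nonneg _)).1 ?_
  nlinarith [sq_nonneg ‖u - p‖]

theorem proj_eq_of_nearest (hc : IsClosed S) (hS : Convex ℝ S) {u p : Vec n} (hp : p ∈ S)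
    (hmin : ∀ q ∈ S, ‖u - p‖ ≤ ‖u - q‖) : proj S u = p := by
  have h1 := inner_nonpos_of_nearest hS hp hmin (proj_mem hc ⟨p, hp⟩ u)
  have h2 := proj_inner_nonpos hc hS ⟨p, hp⟩ u hp
  set q := proj S u
  have h3 : ‖q - p‖ ^ 2 ≤ 0 := by
    rw [← real_inner_self_eq_norm_sq]
    have : inner ℝ (q - p) (q - p) = inner ℝ (u - p) (q - p) + inner ℝ (u - q) (p - q) := by
      rw [← neg_sub q p, inner_neg_right, ← sub_eq_add_neg, ← inner_sub_left]
      congr 1; abel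
    linarith
  have h4 : ‖q - p‖ = 0 := by
    have := sq_nonneg ‖q - p‖
    exact pow_eq_zero_iff (two_ne_zero) |>.1 (le_antisymm h3 this)
  exact sub_eq_zero.1 (norm_eq_zero.1 h4)

theorem isClosed_orthant : IsClosed (orthant n) := by
  have : orthant n = ⋂ i, {u : Vec n | 0 ≤ u i} := by ext; simp [orthant]
  rw [this]
  exact isClosed_iInter fun i => isClosed_le continuous_const (by fun_prop)

theorem zero_mem_orthant : (0 : Vec n) ∈ orthant n := fun i => by simp

theorem add_mem_orthant {u w : Vec n} (hu : u ∈ orthant n) (hw : w ∈ orthant n) :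
    u + w ∈ orthant n := fun i => by
  simpa using add_nonneg (hu i) (hw i)

theorem smul_mem_orthant {a : ℝ} (ha : 0 ≤ a) {u : Vec n} (hu : u ∈ orthant n) :
    a • u ∈ orthant n := fun i => by
  simpa using mul_nonneg ha (hu i)

theorem convex_orthant : Convex ℝ (orthant n) := fun _ hu _ hw _ _ ha hb _ =>
  add_mem_orthant (smul_mem_orthant ha hu) (smul_mem_orthant hb hw)

theorem orthant_nonempty : (orthant n).Nonempty := ⟨0, zero_mem_orthant⟩

theorem proj_orthant_mem (u : Vec n) : proj (orthant n) u ∈ orthant n :=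
  proj_mem isClosed_orthant orthant_nonempty u

theorem proj_orthant_smul {a : ℝ} (ha : 0 < a) (u : Vec n) :
    proj (orthant n) (a • u) = a • proj (orthant n) u := by
  have hs := proj_spec isClosed_orthant orthant_nonempty u
  refine proj_eq_of_nearest isClosed_orthant convex_orthant
    (smul_mem_orthant ha.le hs.1) fun q hq => ?_
  have h := hs.2 (a⁻¹ • q) (smul_mem_orthant (inv_nonneg.2 ha.le) hq)
  rw [← smul_sub, norm_smul]
  have h2 : a • u - q = a • (u - a⁻¹ • q) := by
    rw [smul_sub, smul_smul, mul_inv_cancel₀ ha.ne', one_smul]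
  rw [h2, norm_smul]
  exact mul_le_mul_of_nonneg_left h (norm_nonneg _)

theorem inner_nonneg_of_orthant {u w : Vec n} (hu : u ∈ orthant n) (hw : ∀ i, 0 ≤ w i) :
    0 ≤ inner ℝ u w := by
  rw [PiLp.inner_apply]
  refine Finset.sum_nonneg fun i _ => ?_
  simpa [mul_comm] using mul_nonneg (hu i) (hw i)

theorem inner_nonpos_of_orthant {u w : Vec n} (hu : u ∈ orthant n) (hw : ∀ i, w i ≤ 0) :
    inner ℝ u w ≤ 0 := by
  have := inner_nonneg_of_orthant (w := -w) hu (fun i => by simpa using hw i)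
  rw [inner_neg_right] at this
  linarith

end Projection

/-! ### First-order estimates on convex sets -/

section FirstOrder

theorem gradient_inner {E : Type*} [NormedAddCommGroup E] [InnerProductSpace ℝ E]
    [CompleteSpace E] (φ : E → ℝ) (x d : E) : inner ℝ (gradient φ x) d = fderiv ℝ φ x d :=
  InnerProductSpace.toDual_symm_apply

theorem norm_gradient_sub {E : Type*} [NormedAddCommGroup E] [InnerProductSpace ℝ E]
    [CompleteSpace E] (φ : E → ℝ) (x y : E) :
    ‖gradient φ x - gradient φ y‖ = ‖fderiv ℝ φ x - fderiv ℝ φ y‖ := by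
  rw [gradient, gradient, ← map_sub, LinearIsometryEquiv.norm_map]

/-- A bound on one-sided difference quotients bounds the derivative. -/
theorem deriv_le_of_le_quadratic {φ : ℝ → ℝ} {φ' A B : ℝ} (h : HasDerivAt φ φ' 0)
    (hle : ∀ t ∈ Set.Ioc (0 : ℝ) 1, φ t ≤ φ 0 + t * (A + B * t)) : φ' ≤ A := by
  have h1 : Filter.Tendsto (slope φ 0) (nhdsWithin 0 (Set.Ioi 0)) (nhds φ') :=
    (hasDerivAt_iff_tendsto_slope.1 h).mono_left
      (nhdsWithin_mono _ fun x hx => (ne_of_gt hx : x ≠ 0))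
  have h2 : Filter.Tendsto (fun t : ℝ => A + B * t) (nhdsWithin 0 (Set.Ioi 0)) (nhds A) := by
    have : Filter.Tendsto (fun t : ℝ => A + B * t) (nhds 0) (nhds (A + B * 0)) := by
      apply Continuous.tendsto; fun_prop
    rw [mul_zero, add_zero] at this
    exact this.mono_left nhdsWithin_le_nhds
  refine le_of_tendsto_of_tendsto h1 h2 ?_
  filter_upwards [Ioc_mem_nhdsGT (zero_lt_one' ℝ)] with t ht
  rw [slope_def_field, sub_zero, div_le_iff₀ ht.1]
  linarith [hle t ht]

variable {E : Type*} [NormedAddCommGroup E] [NormedSpace ℝ E]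

theorem hasDerivAt_line {G : Type*} [NormedAddCommGroup G] [NormedSpace ℝ G] {φ : E → G} {y d : E}
    {t : ℝ} (h : DifferentiableAt ℝ φ (y + t • d)) :
    HasDerivAt (fun s : ℝ => φ (y + s • d)) (fderiv ℝ φ (y + t • d) d) t := by
  have h1 : HasDerivAt (fun s : ℝ => y + s • d) d t := by
    simpa using ((hasDerivAt_id t).smul_const d).const_add y
  exact h.hasFDerivAt.comp_hasDerivAt t h1

theorem Convex.line_mem {S : Set E} (hS : Convex ℝ S) {y z : E} (hy : y ∈ S) (hz : z ∈ S) {t : ℝ}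
    (h0 : 0 ≤ t) (h1 : t ≤ 1) : y + t • (z - y) ∈ S :=
  hS.add_smul_sub_mem hy hz ⟨h0, h1⟩

theorem fderiv_le_of_le_line {φ : E → ℝ} {y z : E} (h : DifferentiableAt ℝ φ y) {A B : ℝ}
    (hle : ∀ t ∈ Set.Ioc (0 : ℝ) 1, φ (y + t • (z - y)) ≤ φ y + t * (A + B * t)) :
    fderiv ℝ φ y (z - y) ≤ A := by
  have h' : DifferentiableAt ℝ φ (y + (0 : ℝ) • (z - y)) := by simpa using h
  have h1 := hasDerivAt_line h'
  have h2 := deriv_le_of_le_quadratic (A := A) (B := B) h1 (by simpa using hle)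
  simpa using h2

/-- A function that is Lipschitz on a convex set `S` has derivatives bounded in the directions of
`S`; in other directions nothing is claimed, since `S` may have empty interior. -/
theorem norm_fderiv_sub_le_of_lipschitz {n : ℕ} {φ : E → Vec n} {S : Set E} (hS : Convex ℝ S)
    {l : ℝ} (hl : ∀ y ∈ S, ∀ z ∈ S, ‖φ z - φ y‖ ≤ l * ‖z - y‖) {y z : E} (hy : y ∈ S) (hz : z ∈ S)
    (h : DifferentiableAt ℝ φ y) : ‖fderiv ℝ φ y (z - y)‖ ≤ l * ‖z - y‖ := by
  set q := fderiv ℝ φ y (z - y) with hq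
  have h1 : fderiv ℝ (fun u => inner ℝ q (φ u)) y (z - y) = inner ℝ q q := by
    rw [fderiv_inner_apply ℝ (by fun_prop) h]; simp [hq]
  have h2 : fderiv ℝ (fun u => inner ℝ q (φ u)) y (z - y) ≤ ‖q‖ * (l * ‖z - y‖) := by
    refine fderiv_le_of_le_line (B := 0) ((differentiableAt_const q).inner ℝ h) fun t ht => ?_
    have h3 := hl y hy _ (hS.line_mem hy hz ht.1.le ht.2)
    rw [add_sub_cancel_left, norm_smul, Real.norm_of_nonneg ht.1.le] at h3
    have h4 : inner ℝ q (φ (y + t • (z - y)) - φ y) ≤ ‖q‖ * (l * (t * ‖z - y‖)) :=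
      (real_inner_le_norm _ _).trans (mul_le_mul_of_nonneg_left h3 (norm_nonneg _))
    rw [inner_sub_right] at h4
    linarith
  rw [h1, real_inner_self_eq_norm_sq] at h2
  rcases (norm_nonneg q).eq_or_lt with h0 | h0
  · rw [← h0]
    exact (norm_nonneg _).trans (hl y hy z hz)
  · nlinarith

/-- Real-valued form of `norm_fderiv_sub_le_of_lipschitz`. -/
theorem abs_fderiv_sub_le_of_lipschitz {φ : E → ℝ} {S : Set E} (hS : Convex ℝ S)
    {l : ℝ} (hl : ∀ y ∈ S, ∀ z ∈ S, |φ z - φ y| ≤ l * ‖z - y‖) {y z : E} (hy : y ∈ S) (hz : z ∈ S)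
    (h : DifferentiableAt ℝ φ y) : |fderiv ℝ φ y (z - y)| ≤ l * ‖z - y‖ := by
  have key : ∀ t ∈ Set.Ioc (0 : ℝ) 1, |φ (y + t • (z - y)) - φ y| ≤ t * (l * ‖z - y‖) := by
    intro t ht
    have h3 := hl y hy _ (hS.line_mem hy hz ht.1.le ht.2)
    rw [add_sub_cancel_left, norm_smul, Real.norm_of_nonneg ht.1.le] at h3
    linarith
  rw [abs_le']
  constructor
  · refine fderiv_le_of_le_line (B := 0) h fun t ht => ?_
    linarith [(abs_le.1 (key t ht)).2]
  · have : fderiv ℝ (fun u => -φ u) y (z - y) ≤ l * ‖z - y‖ := by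
      refine fderiv_le_of_le_line (B := 0) h.fun_neg fun t ht => ?_
      linarith [(abs_le.1 (key t ht)).1]
    simpa [fderiv_fun_neg] using this

theorem fderiv_le_of_strongConvexOn {φ : E → ℝ} {S : Set E} {m : ℝ} (hφ : StrongConvexOn S m φ)
    {y z : E} (hy : y ∈ S) (hz : z ∈ S) (h : DifferentiableAt ℝ φ y) :
    φ y + fderiv ℝ φ y (z - y) + m / 2 * ‖z - y‖ ^ 2 ≤ φ z := by
  have : fderiv ℝ φ y (z - y) ≤ φ z - φ y - m / 2 * ‖z - y‖ ^ 2 := by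
    refine fderiv_le_of_le_line (B := m / 2 * ‖z - y‖ ^ 2) h fun t ht => ?_
    have h1 := hφ.2 hy hz (sub_nonneg.2 ht.2) ht.1.le (by ring)
    have h2 : (1 - t) • y + t • z = y + t • (z - y) := by
      rw [sub_smul, one_smul, smul_sub]; abel
    rw [h2, norm_sub_rev y z] at h1
    simp only [smul_eq_mul] at h1
    linarith
  linarith

theorem fderiv_le_of_convexOn {φ : E → ℝ} {S : Set E} (hφ : ConvexOn ℝ S φ)
    {y z : E} (hy : y ∈ S) (hz : z ∈ S) (h : DifferentiableAt ℝ φ y) :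
    φ y + fderiv ℝ φ y (z - y) ≤ φ z := by
  have : fderiv ℝ φ y (z - y) ≤ φ z - φ y := by
    refine fderiv_le_of_le_line (B := 0) h fun t ht => ?_
    have h1 := hφ.2 hy hz (sub_nonneg.2 ht.2) ht.1.le (by ring)
    have h2 : (1 - t) • y + t • z = y + t • (z - y) := by
      rw [sub_smul, one_smul, smul_sub]; abel
    rw [h2] at h1
    simp only [smul_eq_mul] at h1
    linarith
  linarith

theorem norm_sub_sub_fderiv_le {G : Type*} [NormedAddCommGroup G] [NormedSpace ℝ G]
    {φ : E → G} {S : Set E} (hS : Convex ℝ S) {l : ℝ} (hl0 : 0 ≤ l)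
    (hd : ∀ y ∈ S, DifferentiableAt ℝ φ y)
    (hl : ∀ y ∈ S, ∀ z ∈ S, ‖fderiv ℝ φ z - fderiv ℝ φ y‖ ≤ l * ‖z - y‖)
    {y z : E} (hy : y ∈ S) (hz : z ∈ S) :
    ‖φ z - φ y - fderiv ℝ φ y (z - y)‖ ≤ l * ‖z - y‖ ^ 2 := by
  have hsub : segment ℝ y z ⊆ S := hS.segment_subset hy hz
  have h := (convex_segment (𝕜 := ℝ) y z).norm_image_sub_le_of_norm_fderiv_le'
    (f := φ) (φ := fderiv ℝ φ y) (C := l * ‖z - y‖) (x := y) (y := z)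
    (fun x hx => hd x (hsub hx)) (fun x hx => ?_) (left_mem_segment ℝ y z) (right_mem_segment ℝ y z)
  · calc _ ≤ l * ‖z - y‖ * ‖z - y‖ := h
      _ = _ := by ring
  · refine (hl y hy x (hsub hx)).trans (mul_le_mul_of_nonneg_left ?_ hl0)
    rw [segment_eq_image'] at hx
    obtain ⟨t, ht, rfl⟩ := hx
    rw [add_sub_cancel_left, norm_smul, Real.norm_of_nonneg ht.1]
    exact mul_le_of_le_one_left (norm_nonneg _) ht.2

/-- A function with `l`-Lipschitz derivative is `l`-weakly convex. The factor `1/2` matters: it is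
what makes `f + γ g` strongly convex for every `γ > l / α`. -/
theorem le_of_lipschitz_fderiv {φ : E → ℝ} {S : Set E} (hS : Convex ℝ S) {l : ℝ}
    (hd : ∀ y ∈ S, DifferentiableAt ℝ φ y)
    (hl : ∀ y ∈ S, ∀ z ∈ S, ‖fderiv ℝ φ z - fderiv ℝ φ y‖ ≤ l * ‖z - y‖)
    {y z : E} (hy : y ∈ S) (hz : z ∈ S) :
    φ y + fderiv ℝ φ y (z - y) - l / 2 * ‖z - y‖ ^ 2 ≤ φ z := by
  set d := z - y with hdef
  have hmem : ∀ t ∈ Set.Icc (0 : ℝ) 1, y + t • d ∈ S := fun t ht => hS.line_mem hy hz ht.1 ht.2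
  let ψ : ℝ → ℝ := fun s => φ (y + s • d) - s * fderiv ℝ φ y d + l / 2 * s ^ 2 * ‖d‖ ^ 2
  have hψ : ∀ t ∈ Set.Icc (0 : ℝ) 1, HasDerivAt ψ
      (fderiv ℝ φ (y + t • d) d - fderiv ℝ φ y d + l * t * ‖d‖ ^ 2) t := by
    intro t ht
    have h1 := hasDerivAt_line (hd _ (hmem t ht))
    have h2 : HasDerivAt (fun s : ℝ => s * fderiv ℝ φ y d) (fderiv ℝ φ y d) t := by
      simpa using (hasDerivAt_id t).mul_const (fderiv ℝ φ y d)
    have h3 : HasDerivAt (fun s : ℝ => l / 2 * s ^ 2 * ‖d‖ ^ 2) (l * t * ‖d‖ ^ 2) t := by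
      have := (((hasDerivAt_pow 2 t).const_mul (l / 2)).mul_const (‖d‖ ^ 2))
      refine this.congr_deriv ?_
      simp only [Nat.cast_ofNat, Nat.add_one_sub_one, pow_one]
      ring
    exact (h1.sub h2).add h3
  have hmono : MonotoneOn ψ (Set.Icc 0 1) := by
    refine monotoneOn_of_deriv_nonneg (convex_Icc 0 1)
      (fun t ht => (hψ t ht).continuousAt.continuousWithinAt)
      (fun t ht => (hψ t (interior_subset ht)).differentiableAt.differentiableWithinAt)
      fun t ht => ?_
    have ht' := interior_subset ht
    rw [(hψ t ht').deriv]
    have h1 := hl y hy _ (hmem t ht')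
    rw [add_sub_cancel_left, norm_smul, Real.norm_of_nonneg ht'.1] at h1
    have h2 := (fderiv ℝ φ (y + t • d) - fderiv ℝ φ y).le_opNorm d
    have h3 := (abs_le.1 (h2.trans (mul_le_mul_of_nonneg_right h1 (norm_nonneg d)))).1
    rw [sub_apply] at h3
    nlinarith
  have h := hmono (Set.left_mem_Icc.2 zero_le_one) (Set.right_mem_Icc.2 zero_le_one) zero_le_one
  simp only [ψ, zero_smul, add_zero, one_smul, hdef, add_sub_cancel] at h
  simp only [hdef]
  linarith

end FirstOrder

/-! ### Smooth convex-concave problems with a linear dual variable -/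

section Saddle

variable {dy dc : ℕ}

/-- The function `L(μ, y) = h(y) + ⟨μ, c(y)⟩`. -/
noncomputable def saddleFn (h : Vec dy → ℝ) (c : Vec dy → Vec dc) (μ : Vec dc) (y : Vec dy) : ℝ :=
  h y + inner ℝ μ (c y)

/-- First-order regularity of `L(μ, y) = h(y) + ⟨μ, c(y)⟩` over `Y`: `h` is `α`-strongly convex with
quadratic upper bound `l1`, the components of `c` are convex, `c` is `l0`-Lipschitz on `Y` with a
first-order remainder controlled by `l2`. All derivatives are only tested in directions `z - y`
with `y, z ∈ Y`, as `Y` may have empty interior. -/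
structure SmoothSaddle (h : Vec dy → ℝ) (c : Vec dy → Vec dc) (Y : Set (Vec dy))
    (α l1 l0 l2 : ℝ) : Prop where
  α_pos : 0 < α
  l1_nonneg : 0 ≤ l1
  l0_nonneg : 0 ≤ l0
  l2_nonneg : 0 ≤ l2
  closed : IsClosed Y
  conv : Convex ℝ Y
  nonempty : Y.Nonempty
  diff_h : ∀ y ∈ Y, DifferentiableAt ℝ h y
  diff_c : ∀ y ∈ Y, DifferentiableAt ℝ c y
  strong : ∀ y ∈ Y, ∀ z ∈ Y, h y + fderiv ℝ h y (z - y) + α / 2 * ‖z - y‖ ^ 2 ≤ h z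
  smooth : ∀ y ∈ Y, ∀ z ∈ Y, h z ≤ h y + fderiv ℝ h y (z - y) + l1 * ‖z - y‖ ^ 2
  c_convex : ∀ y ∈ Y, ∀ z ∈ Y, ∀ i, c y i + fderiv ℝ c y (z - y) i ≤ c z i
  c_lip : ∀ y ∈ Y, ∀ z ∈ Y, ‖c z - c y‖ ≤ l0 * ‖z - y‖
  c_smooth : ∀ y ∈ Y, ∀ z ∈ Y, ‖c z - c y - fderiv ℝ c y (z - y)‖ ≤ l2 * ‖z - y‖ ^ 2

/-- `ys` minimizes `L` over `Y`. -/
def IsArgmin (L : Vec dy → ℝ) (Y : Set (Vec dy)) (ys : Vec dy) : Prop :=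
  ys ∈ Y ∧ ∀ y ∈ Y, L ys ≤ L y

namespace SmoothSaddle

variable {h : Vec dy → ℝ} {c : Vec dy → Vec dc} {Y : Set (Vec dy)} {α l1 l0 l2 : ℝ}

theorem differentiableAt (S : SmoothSaddle h c Y α l1 l0 l2) (μ : Vec dc) {y : Vec dy}
    (hy : y ∈ Y) : DifferentiableAt ℝ (saddleFn h c μ) y :=
  (S.diff_h y hy).add ((differentiableAt_const μ).inner ℝ (S.diff_c y hy))

theorem fderiv_saddleFn (S : SmoothSaddle h c Y α l1 l0 l2) (μ : Vec dc) {y : Vec dy}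
    (hy : y ∈ Y) (d : Vec dy) :
    fderiv ℝ (saddleFn h c μ) y d = fderiv ℝ h y d + inner ℝ μ (fderiv ℝ c y d) := by
  have h2 := (differentiableAt_const μ).inner ℝ (S.diff_c y hy)
  have h3 : saddleFn h c μ = fun y => h y + inner ℝ μ (c y) := rfl
  rw [h3, fderiv_fun_add (S.diff_h y hy) h2, add_apply,
    fderiv_inner_apply ℝ (differentiableAt_const μ) (S.diff_c y hy)]
  simp

theorem c_tangent (S : SmoothSaddle h c Y α l1 l0 l2) {y z : Vec dy} (hy : y ∈ Y) (hz : z ∈ Y) :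
    ‖fderiv ℝ c y (z - y)‖ ≤ l0 * ‖z - y‖ :=
  norm_fderiv_sub_le_of_lipschitz S.conv S.c_lip hy hz (S.diff_c y hy)

theorem saddleFn_strong (S : SmoothSaddle h c Y α l1 l0 l2) {m : Vec dc} (hm : m ∈ orthant dc)
    {y z : Vec dy} (hy : y ∈ Y) (hz : z ∈ Y) :
    saddleFn h c m y + fderiv ℝ (saddleFn h c m) y (z - y) + α / 2 * ‖z - y‖ ^ 2
      ≤ saddleFn h c m z := by
  rw [S.fderiv_saddleFn m hy]
  have h1 := S.strong y hy z hz
  have h2 : 0 ≤ inner ℝ m (c z - c y - fderiv ℝ c y (z - y)) :=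
    inner_nonneg_of_orthant hm fun i => by
      have := S.c_convex y hy z hz i
      simp only [PiLp.sub_apply]
      linarith
  rw [inner_sub_right, inner_sub_right] at h2
  simp only [saddleFn]
  linarith

theorem saddleFn_smooth (S : SmoothSaddle h c Y α l1 l0 l2) (w : Vec dc)
    {y z : Vec dy} (hy : y ∈ Y) (hz : z ∈ Y) :
    saddleFn h c w z ≤ saddleFn h c w y + fderiv ℝ (saddleFn h c w) y (z - y)
      + (l1 + ‖w‖ * l2) * ‖z - y‖ ^ 2 := by
  rw [S.fderiv_saddleFn w hy]
  have h1 := S.smooth y hy z hz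
  have h2 : inner ℝ w (c z - c y - fderiv ℝ c y (z - y)) ≤ ‖w‖ * (l2 * ‖z - y‖ ^ 2) :=
    (real_inner_le_norm _ _).trans
      (mul_le_mul_of_nonneg_left (S.c_smooth y hy z hz) (norm_nonneg _))
  rw [inner_sub_right, inner_sub_right] at h2
  simp only [saddleFn]
  linarith

theorem inner_c_sub_le (S : SmoothSaddle h c Y α l1 l0 l2) {p : Vec dc} {d : ℝ} (hp : ‖p‖ ≤ d)
    {y z : Vec dy} (hy : y ∈ Y) (hz : z ∈ Y) :
    inner ℝ p (c z - c y) ≤ d * (l0 * ‖z - y‖) :=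
  (real_inner_le_norm _ _).trans (mul_le_mul hp (S.c_lip y hy z hz) (norm_nonneg _)
    ((norm_nonneg _).trans hp))

theorem saddleFn_sub (h : Vec dy → ℝ) (c : Vec dy → Vec dc) (w m : Vec dc) (y : Vec dy) :
    saddleFn h c w y = saddleFn h c m y + inner ℝ (w - m) (c y) := by
  simp only [saddleFn, inner_sub_left]; ring

theorem exists_argmin (S : SmoothSaddle h c Y α l1 l0 l2) {m : Vec dc} (hm : m ∈ orthant dc) :
    ∃ ys, IsArgmin (saddleFn h c m) Y ys := by
  obtain ⟨y₀, hy₀⟩ := S.nonempty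
  have hcont : ContinuousOn (saddleFn h c m) Y := fun y hy =>
    (S.differentiableAt m hy).continuousAt.continuousWithinAt
  set q := fderiv ℝ (saddleFn h c m) y₀
  have hev : ∀ᶠ y in Filter.cocompact (Vec dy) ⊓ Filter.principal Y,
      saddleFn h c m y₀ ≤ saddleFn h c m y := by
    have h1 : ∀ᶠ y in Filter.cocompact (Vec dy), 2 * ‖q‖ / α ≤ ‖y - y₀‖ := by
      have h2 : Filter.Tendsto (fun y : Vec dy => ‖y - y₀‖) (Filter.cocompact (Vec dy))
          Filter.atTop := by
        simpa [dist_eq_norm] using tendsto_dist_right_cocompact_atTop y₀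
      exact h2.eventually_ge_atTop _
    filter_upwards [h1.filter_mono inf_le_left, Filter.mem_inf_of_right
      (Filter.mem_principal_self Y)] with y h1 hy
    have h3 := S.saddleFn_strong hm hy₀ hy
    have h4 := (abs_le.1 (q.le_opNorm (y - y₀))).1
    rw [div_le_iff₀ S.α_pos] at h1
    nlinarith [norm_nonneg (y - y₀)]
  obtain ⟨ys, hys, hmin⟩ := hcont.exists_isMinOn' S.closed hy₀ hev
  exact ⟨ys, hys, fun y hy => hmin hy⟩

theorem argmin_growth (S : SmoothSaddle h c Y α l1 l0 l2) {m : Vec dc} (hm : m ∈ orthant dc)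
    {ys : Vec dy} (hs : IsArgmin (saddleFn h c m) Y ys) {y : Vec dy} (hy : y ∈ Y) :
    saddleFn h c m ys + α / 2 * ‖y - ys‖ ^ 2 ≤ saddleFn h c m y := by
  have h1 := S.saddleFn_strong hm hs.1 hy
  have h2 : fderiv ℝ (fun u => -saddleFn h c m u) ys (y - ys) ≤ 0 := by
    refine fderiv_le_of_le_line (B := 0) (S.differentiableAt m hs.1).fun_neg fun t ht => ?_
    have := hs.2 _ (S.conv.line_mem hs.1 hy ht.1.le ht.2)
    linarith
  rw [fderiv_fun_neg, neg_apply] at h2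
  linarith

theorem argmin_dist_le (S : SmoothSaddle h c Y α l1 l0 l2) {m₁ m₂ : Vec dc}
    (hm₁ : m₁ ∈ orthant dc) (hm₂ : m₂ ∈ orthant dc) {y₁ y₂ : Vec dy}
    (h₁ : IsArgmin (saddleFn h c m₁) Y y₁) (h₂ : IsArgmin (saddleFn h c m₂) Y y₂) :
    α * ‖y₁ - y₂‖ ≤ l0 * ‖m₁ - m₂‖ := by
  have e1 := S.argmin_growth hm₁ h₁ h₂.1
  have e2 := S.argmin_growth hm₂ h₂ h₁.1
  have e3 := saddleFn_sub h c m₁ m₂ y₁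
  have e4 := saddleFn_sub h c m₁ m₂ y₂
  have e5 := S.inner_c_sub_le (le_refl ‖m₁ - m₂‖) h₁.1 h₂.1
  rw [inner_sub_right] at e5
  rw [norm_sub_rev y₂ y₁] at e1 e5
  rcases (norm_nonneg (y₁ - y₂)).eq_or_lt with h0 | h0
  · rw [← h0, mul_zero]
    exact mul_nonneg S.l0_nonneg (norm_nonneg _)
  · refine le_of_mul_le_mul_right ?_ h0
    nlinarith

end SmoothSaddle

end Saddle

/-! ### Projected gradient steps for a perturbed multiplier -/

section PGD

variable {dy dc : ℕ} {h : Vec dy → ℝ} {c : Vec dy → Vec dc} {Y : Set (Vec dy)} {α l1 l0 l2 : ℝ}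

theorem pgdStep_mem (S : SmoothSaddle h c Y α l1 l0 l2) (L : Vec dc → Vec dy → ℝ) (η : ℝ)
    (w : Vec dc) (y : Vec dy) : pgdStep L Y η w y ∈ Y :=
  proj_mem S.closed S.nonempty _

theorem pgd_iterate_mem (S : SmoothSaddle h c Y α l1 l0 l2) (L : Vec dc → Vec dy → ℝ) (η : ℝ)
    (w : Vec dc) {y : Vec dy} (hy : y ∈ Y) (k : ℕ) : (pgdStep L Y η w)^[k] y ∈ Y := by
  cases k with
  | zero => exact hy
  | succ k =>
    rw [Function.iterate_succ_apply']
    exact pgdStep_mem S L η w _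

theorem pgdStep_vi (S : SmoothSaddle h c Y α l1 l0 l2) (L : Vec dc → Vec dy → ℝ) (η : ℝ)
    (w : Vec dc) (y : Vec dy) {z : Vec dy} (hz : z ∈ Y) :
    inner ℝ (y - pgdStep L Y η w y) (z - pgdStep L Y η w y)
      ≤ η * fderiv ℝ (L w) y (z - pgdStep L Y η w y) := by
  have h1 := proj_inner_nonpos S.closed S.conv S.nonempty (y - η • gradient (fun y' => L w y') y) hz
  change inner ℝ (y - η • gradient (fun y' => L w y') y - pgdStep L Y η w y)
    (z - pgdStep L Y η w y) ≤ 0 at h1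
  rw [sub_right_comm, inner_sub_left, real_inner_smul_left, gradient_inner] at h1
  linarith

/-- A projected gradient step decreases `L(w, ·)`, also for `w` outside the orthant. -/
theorem pgdStep_descent (S : SmoothSaddle h c Y α l1 l0 l2) {η : ℝ} (hη : 0 < η) {w : Vec dc}
    (hηw : η * (l1 + ‖w‖ * l2) ≤ 1) {y : Vec dy} (hy : y ∈ Y) :
    saddleFn h c w (pgdStep (saddleFn h c) Y η w y) ≤ saddleFn h c w y := by
  have hy' := pgdStep_mem S (saddleFn h c) η w y
  have h1 := pgdStep_vi S (saddleFn h c) η w y hy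
  have h2 := S.saddleFn_smooth w hy hy'
  set y' := pgdStep (saddleFn h c) Y η w y
  rw [real_inner_self_eq_norm_sq, ← neg_sub y' y, map_neg, norm_neg] at h1
  have h3 : η * (saddleFn h c w y' - saddleFn h c w y) ≤ 0 := by
    nlinarith [sq_nonneg ‖y' - y‖]
  by_contra hcon
  push Not at hcon
  nlinarith

/-- One projected gradient step on `L(w, ·)`, compared with the minimizer of `L(m, ·)` for a
nonnegative multiplier `m` with `‖w - m‖ ≤ d`. As `L(w, ·)` itself may be nonconvex, convexity is
taken from `L(m, ·)`, and the perturbation costs `O(d²)`. -/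
theorem pgdStep_perturbed (S : SmoothSaddle h c Y α l1 l0 l2) {η : ℝ} (hη : 0 < η)
    (hηα : η * α ≤ 1) {w m : Vec dc} (hm : m ∈ orthant dc) (hηm : η * (l1 + ‖m‖ * l2) ≤ 1 / 4)
    {d : ℝ} (hd : ‖w - m‖ ≤ d) {z : Vec dy} (hz : z ∈ Y) {y : Vec dy} (hy : y ∈ Y) :
    ‖pgdStep (saddleFn h c) Y η w y - z‖ ^ 2
        + 2 * η * (saddleFn h c m (pgdStep (saddleFn h c) Y η w y) - saddleFn h c m z)
      ≤ (1 - η * α / 2) * ‖y - z‖ ^ 2 + 4 * η * (d ^ 2 * l0 ^ 2 / α) := by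
  have hα := S.α_pos
  have hy' := pgdStep_mem S (saddleFn h c) η w y
  have h1 := pgdStep_vi S (saddleFn h c) η w y hz
  set y' := pgdStep (saddleFn h c) Y η w y
  have h2 := S.saddleFn_strong hm hy hz
  have h3 := S.saddleFn_smooth m hy hy'
  have h4 : fderiv ℝ (saddleFn h c w) y (z - y')
      = fderiv ℝ (saddleFn h c m) y (z - y) - fderiv ℝ (saddleFn h c m) y (y' - y)
        + (inner ℝ (w - m) (fderiv ℝ c y (z - y)) - inner ℝ (w - m) (fderiv ℝ c y (y' - y))) := by
    have e : z - y' = (z - y) - (y' - y) := by abel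
    rw [e, map_sub]
    simp only [S.fderiv_saddleFn _ hy, inner_sub_left]
    ring
  have hd0 : 0 ≤ d := (norm_nonneg _).trans hd
  have h5 : inner ℝ (w - m) (fderiv ℝ c y (z - y)) ≤ d * (l0 * ‖z - y‖) :=
    (real_inner_le_norm _ _).trans (mul_le_mul hd (S.c_tangent hy hz) (norm_nonneg _) hd0)
  have h6 : -inner ℝ (w - m) (fderiv ℝ c y (y' - y)) ≤ d * (l0 * ‖y' - y‖) := by
    rw [← inner_neg_left]
    refine (real_inner_le_norm _ _).trans (mul_le_mul ?_ (S.c_tangent hy hy') (norm_nonneg _) hd0)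
    rwa [norm_neg]
  have h7 : ‖y - z‖ ^ 2 = ‖y' - y‖ ^ 2 + ‖y' - z‖ ^ 2 - 2 * inner ℝ (y - y') (z - y') := by
    have := norm_sub_sq_real (y - y') (z - y')
    rw [sub_sub_sub_cancel_right, norm_sub_rev y y', norm_sub_rev z y'] at this
    linarith
  rw [norm_sub_rev z y] at h2 h5
  set r := ‖y - z‖
  set s := ‖y' - y‖
  -- Young's inequality for the two perturbation terms
  have h8 : 2 * (d * (l0 * r)) ≤ α / 2 * r ^ 2 + 2 * (d ^ 2 * l0 ^ 2 / α) := by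
    have : 0 ≤ α / 2 * (r - 2 * (d * l0) / α) ^ 2 := by positivity
    have e : α / 2 * (r - 2 * (d * l0) / α) ^ 2
      = α / 2 * r ^ 2 + 2 * (d ^ 2 * l0 ^ 2 / α) - 2 * (d * (l0 * r)) := by field_simp; ring
    linarith
  have h9 : 2 * η * (d * (l0 * s)) ≤ 1 / 2 * s ^ 2 + 2 * η * (d ^ 2 * l0 ^ 2 / α) := by
    have e1 : 2 * η * (d * (l0 * s)) ≤ 1 / 2 * s ^ 2 + 2 * (η * (d * l0)) ^ 2 := by
      nlinarith [sq_nonneg (s - 2 * (η * (d * l0)))]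
    have e2 : (η * (d * l0)) ^ 2 = (η * α) * (η * (d ^ 2 * l0 ^ 2 / α)) := by field_simp
    have e3 : (η * α) * (η * (d ^ 2 * l0 ^ 2 / α)) ≤ 1 * (η * (d ^ 2 * l0 ^ 2 / α)) :=
      mul_le_mul_of_nonneg_right hηα (by positivity)
    linarith
  have h10 : η * (l1 + ‖m‖ * l2) * s ^ 2 ≤ 1 / 4 * s ^ 2 :=
    mul_le_mul_of_nonneg_right hηm (sq_nonneg _)
  have h11 : fderiv ℝ (saddleFn h c w) y (z - y')
      ≤ saddleFn h c m z - saddleFn h c m y' - α / 2 * r ^ 2 + (l1 + ‖m‖ * l2) * s ^ 2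
        + d * (l0 * r) + d * (l0 * s) := by linarith
  have h12 := mul_le_mul_of_nonneg_left h11 (by positivity : 0 ≤ 2 * η)
  have h13 := mul_le_mul_of_nonneg_left h8 hη.le
  nlinarith

variable {η : ℝ} {w m : Vec dc} {d : ℝ}

theorem pgd_dist_le (S : SmoothSaddle h c Y α l1 l0 l2) (hη : 0 < η)
    (hηα : η * α ≤ 1) (hm : m ∈ orthant dc) (hηm : η * (l1 + ‖m‖ * l2) ≤ 1 / 4)
    (hd : ‖w - m‖ ≤ d) {z : Vec dy} (hz : IsArgmin (saddleFn h c m) Y z) {y : Vec dy}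
    (hy : y ∈ Y) (k : ℕ) :
    ‖(pgdStep (saddleFn h c) Y η w)^[k] y - z‖ ^ 2
      ≤ (1 - η * α / 2) ^ k * ‖y - z‖ ^ 2 + 8 * (d ^ 2 * l0 ^ 2 / α ^ 2) := by
  have hα := S.α_pos
  have hρ : 0 ≤ 1 - η * α / 2 := by linarith
  induction k with
  | zero =>
    have : 0 ≤ 8 * (d ^ 2 * l0 ^ 2 / α ^ 2) := by positivity
    simpa using this
  | succ k ih =>
    rw [Function.iterate_succ_apply']
    have hk := pgd_iterate_mem S (saddleFn h c) η w hy k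
    have h1 := pgdStep_perturbed S hη hηα hm hηm hd hz.1 hk
    have h2 := hz.2 _ (pgdStep_mem S (saddleFn h c) η w ((pgdStep (saddleFn h c) Y η w)^[k] y))
    have h3 := mul_le_mul_of_nonneg_left ih hρ
    have h4 : 4 * η * (d ^ 2 * l0 ^ 2 / α) = η * α / 2 * (8 * (d ^ 2 * l0 ^ 2 / α ^ 2)) := by
      field_simp; ring
    have h5 := mul_nonneg (mul_nonneg zero_le_two hη.le) (sub_nonneg.2 h2)
    rw [pow_succ' (1 - η * α / 2) k]
    linarith

/-- The optimality gap of `L(m, ·)` after `K` projected gradient steps on `L(w, ·)`. If all gaps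
were large, the distances would become negative, so some iterate has a small gap; descent of
`L(w, ·)` transfers this to the last iterate. -/
theorem pgd_gap_le (S : SmoothSaddle h c Y α l1 l0 l2) (hη : 0 < η)
    (hηα : η * α ≤ 1) (hm : m ∈ orthant dc) (hηm : η * (l1 + ‖m‖ * l2) ≤ 1 / 4)
    (hηw : η * (l1 + ‖w‖ * l2) ≤ 1)
    (hd : ‖w - m‖ ≤ d) {z : Vec dy} (hz : IsArgmin (saddleFn h c m) Y z) {y : Vec dy}
    (hy : y ∈ Y) {K : ℕ} (hK : 1 ≤ K) :
    saddleFn h c m ((pgdStep (saddleFn h c) Y η w)^[K] y) - saddleFn h c m z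
      ≤ 11 * (d ^ 2 * l0 ^ 2 / α) + 2 * ((1 - η * α / 2) ^ K * ‖y - z‖ ^ 2 / η) := by
  have hα := S.α_pos
  have hρ : 0 ≤ 1 - η * α / 2 := by linarith
  have hd0 : 0 ≤ d := (norm_nonneg _).trans hd
  set X := d ^ 2 * l0 ^ 2 / α with hX
  have hX0 : 0 ≤ X := by positivity
  set it : ℕ → Vec dy := fun k => (pgdStep (saddleFn h c) Y η w)^[k] y with hit
  have hmem : ∀ k, it k ∈ Y := fun k => pgd_iterate_mem S (saddleFn h c) η w hy k
  have hsucc : ∀ k, it (k + 1) = pgdStep (saddleFn h c) Y η w (it k) := fun k =>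
    Function.iterate_succ_apply' _ _ _
  set Φ : ℕ → ℝ := fun k => saddleFn h c m (it k) - saddleFn h c m z with hΦ
  set s := (1 - η * α / 2) ^ K * ‖y - z‖ ^ 2 / (2 * η) with hs
  have hs0 : 0 ≤ s := by positivity
  have hstep : ∀ k, ‖it (k + 1) - z‖ ^ 2 + 2 * η * Φ (k + 1)
      ≤ (1 - η * α / 2) * ‖it k - z‖ ^ 2 + 4 * η * X := by
    intro k
    simp only [hΦ, hsucc]
    exact pgdStep_perturbed S hη hηα hm hηm hd hz.1 (hmem k)
  obtain ⟨k, hkK, hk⟩ : ∃ k ≤ K, Φ k ≤ 2 * X + s := by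
    by_contra hcon
    push Not at hcon
    have hdec : ∀ k ≤ K, ‖it k - z‖ ^ 2 ≤ (1 - η * α / 2) ^ k * ‖y - z‖ ^ 2 := by
      intro k hk
      induction k with
      | zero => simp [hit]
      | succ k ih =>
        have h1 := hstep k
        have h2 := hcon (k + 1) hk
        have h3 := mul_le_mul_of_nonneg_left (ih (by omega)) hρ
        have h4 := mul_le_mul_of_nonneg_left (show 2 * X ≤ Φ (k + 1) by linarith) hη.le
        rw [pow_succ' (1 - η * α / 2) k, mul_assoc]
        linarith
    obtain ⟨j, rfl⟩ : ∃ j, K = j + 1 := ⟨K - 1, by omega⟩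
    have h1 := hstep j
    have h2 := mul_lt_mul_of_pos_left (hcon (j + 1) le_rfl) hη
    have h3 := mul_le_mul_of_nonneg_left (hdec j (by omega)) hρ
    have h4 : 2 * η * s = (1 - η * α / 2) ^ (j + 1) * ‖y - z‖ ^ 2 := by
      rw [hs]; field_simp
    rw [pow_succ' (1 - η * α / 2) j, mul_assoc] at h4
    nlinarith [sq_nonneg ‖it (j + 1) - z‖]
  have hanti : Antitone fun k => saddleFn h c w (it k) := by
    refine antitone_nat_of_succ_le fun k => ?_
    rw [hsucc]
    exact pgdStep_descent S hη hηw (hmem k)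
  have h1 : saddleFn h c w (it K) ≤ saddleFn h c w (it k) := hanti hkK
  rw [SmoothSaddle.saddleFn_sub h c w m, SmoothSaddle.saddleFn_sub h c w m] at h1
  have h2 := S.inner_c_sub_le hd (hmem K) (hmem k)
  rw [inner_sub_right] at h2
  have h3 : ‖it k - it K‖ ≤ ‖it k - z‖ + ‖it K - z‖ := by
    rw [norm_sub_rev (it K) z]; exact norm_sub_le_norm_sub_add_norm_sub _ _ _
  have young : ∀ j, d * (l0 * ‖it j - z‖) ≤ Φ j / 2 + X := by
    intro j
    have g := S.argmin_growth hm hz (hmem j)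
    have e : 0 ≤ α / 4 * (‖it j - z‖ - 2 * (d * l0) / α) ^ 2 := by positivity
    have e' : α / 4 * (‖it j - z‖ - 2 * (d * l0) / α) ^ 2
      = α / 4 * ‖it j - z‖ ^ 2 + X - d * (l0 * ‖it j - z‖) := by rw [hX]; field_simp; ring
    simp only [hΦ]
    linarith
  have h4 := mul_le_mul_of_nonneg_left h3 (mul_nonneg hd0 S.l0_nonneg)
  have h5 : 2 * ((1 - η * α / 2) ^ K * ‖y - z‖ ^ 2 / η) = 4 * s := by
    rw [hs]; field_simp; ring
  rw [h5]
  have yk := young k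
  have yK := young K
  simp only [hΦ] at hk yk yK
  change saddleFn h c m (it K) - saddleFn h c m z ≤ _
  linarith

/-- The inner loop as an inexact gradient oracle for the dual function. The error in the value is
bounded by a multiple of `‖μ - w‖²`, with a constant free of all stepsizes, plus a term that decays
geometrically in `K`. When `w` leaves the orthant, `‖μ - w‖` is at least its distance from the
orthant, and this pays for the nonconvexity of `L(w, ·)`. -/
theorem pgd_oracle (S : SmoothSaddle h c Y α l1 l0 l2) (hη : 0 < η)
    (hηα : η * α ≤ 1) (hηw : η * (l1 + ‖w‖ * l2) ≤ 1 / 4)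
    {μ : Vec dc} (hμ : μ ∈ orthant dc) {z : Vec dy}
    (hz : IsArgmin (saddleFn h c (proj (orthant dc) w)) Y z) {y : Vec dy}
    (hy : y ∈ Y) {K : ℕ} (hK : 1 ≤ K) {y' : Vec dy} (hy' : y' ∈ Y) :
    saddleFn h c μ ((pgdStep (saddleFn h c) Y η w)^[K] y) - saddleFn h c μ y'
      ≤ 26 * (l0 ^ 2 / α) * ‖μ - w‖ ^ 2 + 4 * ((1 - η * α / 2) ^ K * ‖y - z‖ ^ 2 / η) := by
  have hα := S.α_pos
  set m := proj (orthant dc) w with hm_def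
  have hm : m ∈ orthant dc := proj_orthant_mem w
  set d := ‖μ - w‖ with hd_def
  have hd : ‖w - m‖ ≤ d := by
    rw [hd_def, norm_sub_rev μ w]
    exact (proj_spec isClosed_orthant orthant_nonempty w).2 μ hμ
  have hmw : ‖m‖ ≤ ‖w‖ := by
    simpa using norm_proj_sub_le isClosed_orthant convex_orthant w (zero_mem_orthant (n := dc))
  have hηm : η * (l1 + ‖m‖ * l2) ≤ 1 / 4 :=
    (mul_le_mul_of_nonneg_left (add_le_add_right
      (mul_le_mul_of_nonneg_right hmw S.l2_nonneg) _) hη.le).trans hηw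
  have h1 := pgd_gap_le S hη hηα hm hηm (hηw.trans (by norm_num)) hd hz hy hK
  have hyK := pgd_iterate_mem S (saddleFn h c) η w hy K
  set yK := (pgdStep (saddleFn h c) Y η w)^[K] y
  have h2 := S.argmin_growth hm hz hy'
  have h3 := S.argmin_growth hm hz hyK
  have h4 : ‖μ - m‖ ≤ 2 * d := by
    have := norm_sub_le_norm_sub_add_norm_sub μ w m
    linarith
  have h5 := S.inner_c_sub_le h4 hy' hyK
  have h6 : ‖yK - y'‖ ≤ ‖yK - z‖ + ‖y' - z‖ := by
    rw [norm_sub_rev y' z]; exact norm_sub_le_norm_sub_add_norm_sub _ _ _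
  have hd0 : 0 ≤ d := norm_nonneg _
  have h7 := mul_le_mul_of_nonneg_left h6 (mul_nonneg (mul_nonneg zero_le_two hd0) S.l0_nonneg)
  have young : ∀ r : ℝ, 2 * d * l0 * r ≤ α / 2 * r ^ 2 + 2 * (d ^ 2 * l0 ^ 2 / α) := by
    intro r
    have e : 0 ≤ α / 2 * (r - 2 * (d * l0) / α) ^ 2 := by positivity
    have e' : α / 2 * (r - 2 * (d * l0) / α) ^ 2
      = α / 2 * r ^ 2 + 2 * (d ^ 2 * l0 ^ 2 / α) - 2 * d * l0 * r := by field_simp; ring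
    linarith
  have y1 := young ‖yK - z‖
  have y2 := young ‖y' - z‖
  rw [inner_sub_right] at h5
  rw [SmoothSaddle.saddleFn_sub h c μ m yK, SmoothSaddle.saddleFn_sub h c μ m y']
  have e : 26 * (l0 ^ 2 / α) * d ^ 2 = 26 * (d ^ 2 * l0 ^ 2 / α) := by ring
  rw [e]
  linarith

end PGD

/-! ### The dual function and its maximizers -/

section Dual

variable {dy dc : ℕ} {h : Vec dy → ℝ} {c : Vec dy → Vec dc} {Y : Set (Vec dy)} {α l1 l0 l2 : ℝ}

theorem dualFn_eq {L : Vec dc → Vec dy → ℝ} {μ : Vec dc} {ys : Vec dy}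
    (hs : IsArgmin (L μ) Y ys) : dualFn L Y μ = L μ ys :=
  IsLeast.csInf_eq ⟨⟨ys, hs.1, rfl⟩, by rintro _ ⟨y, hy, rfl⟩; exact hs.2 y hy⟩

theorem saddleFn_lower {a : ℝ} (ha : 0 < a) {m : Vec dc} {ys : Vec dy}
    (hgrow : ∀ y ∈ Y, saddleFn h c m ys + a / 2 * ‖y - ys‖ ^ 2 ≤ saddleFn h c m y)
    (hlip : ∀ y ∈ Y, ‖c y - c ys‖ ≤ l0 * ‖y - ys‖) (μ : Vec dc) {y : Vec dy} (hy : y ∈ Y) :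
    saddleFn h c m ys + inner ℝ (c ys) (μ - m) - l0 ^ 2 / (2 * a) * ‖μ - m‖ ^ 2
      ≤ saddleFn h c μ y := by
  have h1 := hgrow y hy
  have h2 : -inner ℝ (μ - m) (c y - c ys) ≤ ‖μ - m‖ * (l0 * ‖y - ys‖) := by
    rw [← inner_neg_left]
    refine (real_inner_le_norm _ _).trans ?_
    rw [norm_neg]
    exact mul_le_mul_of_nonneg_left (hlip y hy) (norm_nonneg _)
  rw [SmoothSaddle.saddleFn_sub h c μ m y, real_inner_comm]
  rw [inner_sub_right] at h2
  have e : 0 ≤ a / 2 * (‖y - ys‖ - ‖μ - m‖ * l0 / a) ^ 2 := by positivity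
  have e' : a / 2 * (‖y - ys‖ - ‖μ - m‖ * l0 / a) ^ 2
    = a / 2 * ‖y - ys‖ ^ 2 + l0 ^ 2 / (2 * a) * ‖μ - m‖ ^ 2 - ‖μ - m‖ * (l0 * ‖y - ys‖) := by
    field_simp; ring
  linarith

/-- The dual function is differentiable wherever the minimization over `Y` is strongly convex, with
gradient `c` at the minimizer. This includes the boundary of the orthant: the lower bound holds for
all multipliers, nonnegative or not. -/
theorem hasGradientAt_dualFn {a : ℝ} (ha : 0 < a) {m : Vec dc} {ys : Vec dy} (hys : ys ∈ Y)
    (hgrow : ∀ y ∈ Y, saddleFn h c m ys + a / 2 * ‖y - ys‖ ^ 2 ≤ saddleFn h c m y)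
    (hlip : ∀ y ∈ Y, ‖c y - c ys‖ ≤ l0 * ‖y - ys‖) :
    HasGradientAt (dualFn (saddleFn h c) Y) (c ys) m := by
  set D := dualFn (saddleFn h c) Y with hD
  have hDm : D m = saddleFn h c m ys := dualFn_eq ⟨hys, fun y hy => by
    have := hgrow y hy
    have : 0 ≤ a / 2 * ‖y - ys‖ ^ 2 := by positivity
    linarith⟩
  have hlow := fun μ => fun y hy => saddleFn_lower ha hgrow hlip μ (y := y) hy
  have hup : ∀ μ, D μ ≤ saddleFn h c m ys + inner ℝ (c ys) (μ - m) := by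
    intro μ
    have h1 : D μ ≤ saddleFn h c μ ys :=
      csInf_le ⟨_, by rintro _ ⟨y, hy, rfl⟩; exact hlow μ y hy⟩ ⟨ys, hys, rfl⟩
    rwa [SmoothSaddle.saddleFn_sub h c μ m ys, real_inner_comm] at h1
  have hlow' : ∀ μ, saddleFn h c m ys + inner ℝ (c ys) (μ - m)
      - l0 ^ 2 / (2 * a) * ‖μ - m‖ ^ 2 ≤ D μ := fun μ =>
    le_csInf ⟨_, ys, hys, rfl⟩ (by rintro _ ⟨y, hy, rfl⟩; exact hlow μ y hy)
  have hO : HasFDerivAt (fun μ => D μ - D m - inner ℝ (c ys) (μ - m)) (0 : Vec dc →L[ℝ] ℝ) m := by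
    refine Asymptotics.IsBigO.hasFDerivAt (n := 2) ?_ (by norm_num)
    refine Asymptotics.IsBigO.of_bound (l0 ^ 2 / (2 * a)) (Filter.Eventually.of_forall fun μ => ?_)
    have h1 := hup μ
    have h2 := hlow' μ
    rw [Real.norm_eq_abs, Real.norm_of_nonneg (by positivity), abs_le]
    rw [hDm]
    have : 0 ≤ l0 ^ 2 / (2 * a) * ‖μ - m‖ ^ 2 := by positivity
    constructor <;> linarith
  rw [hasGradientAt_iff_hasFDerivAt]
  have hlin : HasFDerivAt (fun μ : Vec dc => D m + inner ℝ (c ys) (μ - m))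
      (InnerProductSpace.toDual ℝ (Vec dc) (c ys)) m := by
    refine (((InnerProductSpace.toDual ℝ (Vec dc) (c ys)).hasFDerivAt (x := m)).const_add
      (D m - inner ℝ (c ys) m)).congr_of_eventuallyEq (Filter.Eventually.of_forall fun μ => ?_)
    simp only [InnerProductSpace.toDual_apply_apply, inner_sub_right]
    ring
  have hsum := hO.add hlin
  rw [zero_add] at hsum
  refine hsum.congr_of_eventuallyEq (Filter.Eventually.of_forall fun μ => ?_)
  simp only [Pi.add_apply]
  ring

/-- A primal-dual solution, with the first-order optimality condition of `μs` in the orthant. -/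
structure SaddleSol (h : Vec dy → ℝ) (c : Vec dy → Vec dc) (Y : Set (Vec dy)) (μs : Vec dc)
    (ys : Vec dy) : Prop where
  nonneg : μs ∈ orthant dc
  argmin : IsArgmin (saddleFn h c μs) Y ys
  opt : ∀ u ∈ orthant dc, inner ℝ (c ys) (u - μs) ≤ 0

theorem inner_nonpos_of_isMaxMin {a : ℝ} (ha : 0 < a) {μs : Vec dc} {ys : Vec dy}
    (hs : IsMaxMin (saddleFn h c) Y μs ys)
    (hgrow : ∀ y ∈ Y, saddleFn h c μs ys + a / 2 * ‖y - ys‖ ^ 2 ≤ saddleFn h c μs y)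
    (hlip : ∀ y ∈ Y, ‖c y - c ys‖ ≤ l0 * ‖y - ys‖) {u : Vec dc} (hu : u ∈ orthant dc) :
    inner ℝ (c ys) (u - μs) ≤ 0 := by
  have h1 := (hasGradientAt_dualFn ha hs.mem hgrow hlip)
  rw [hasGradientAt_iff_hasFDerivAt] at h1
  have h2 := fderiv_le_of_le_line (φ := dualFn (saddleFn h c) Y) (y := μs) (z := u) (A := 0)
    (B := 0) h1.differentiableAt fun t ht => by
      have := hs.max _ (convex_orthant.line_mem hs.nonneg hu ht.1.le ht.2)
      linarith
  rwa [h1.fderiv, InnerProductSpace.toDual_apply_apply] at h2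

namespace SaddleSol

variable {μs : Vec dc} {ys : Vec dy}

theorem c_nonpos (hs : SaddleSol h c Y μs ys) (i : Fin dc) : c ys i ≤ 0 := by
  have h1 := hs.opt (μs + EuclideanSpace.single i 1) (add_mem_orthant hs.nonneg fun j => by
    by_cases hj : j = i <;> simp [hj])
  rw [add_sub_cancel_left, EuclideanSpace.inner_single_right] at h1
  simpa using h1

theorem inner_c_eq_zero (hs : SaddleSol h c Y μs ys) : inner ℝ μs (c ys) = 0 := by
  have h1 := hs.opt 0 zero_mem_orthant
  have h2 := hs.opt ((2 : ℝ) • μs) (smul_mem_orthant (by norm_num) hs.nonneg)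
  rw [two_smul, add_sub_cancel_left, real_inner_comm] at h2
  rw [zero_sub, inner_neg_right, real_inner_comm] at h1
  linarith

end SaddleSol

/-- Restricted secant inequality for the dual function, written through minimizers over `Y`. -/
def ArgminRSI (h : Vec dy → ℝ) (c : Vec dy → Vec dc) (Y : Set (Vec dy)) (μs : Vec dc)
    (ys : Vec dy) (C δ : ℝ) : Prop :=
  ∀ μ ∈ orthant dc, ‖μ - μs‖ < δ → ∀ y, IsArgmin (saddleFn h c μ) Y y →
    C * ‖μ - μs‖ ^ 2 ≤ inner ℝ (c ys - c y) (μ - μs)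

/-- The dual gap `D(μs) - D(μ)`. -/
noncomputable def dualGap (h : Vec dy → ℝ) (c : Vec dy → Vec dc) (Y : Set (Vec dy))
    (μs μ : Vec dc) : ℝ :=
  dualFn (saddleFn h c) Y μs - dualFn (saddleFn h c) Y μ

theorem dualGap_nonneg (S : SmoothSaddle h c Y α l1 l0 l2) {μs : Vec dc} {ys : Vec dy}
    (hs : SaddleSol h c Y μs ys) {μ : Vec dc} (hμ : μ ∈ orthant dc) :
    0 ≤ dualGap h c Y μs μ := by
  obtain ⟨y, hy⟩ := S.exists_argmin hμ
  rw [dualGap, dualFn_eq hs.argmin, dualFn_eq hy]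
  have h1 := hy.2 ys hs.argmin.1
  rw [SmoothSaddle.saddleFn_sub h c μ μs ys, real_inner_comm] at h1
  linarith [hs.opt μ hμ]

theorem inner_argmin_mono {μ₁ μ₂ : Vec dc} {y₁ y₂ : Vec dy}
    (h₁ : IsArgmin (saddleFn h c μ₁) Y y₁) (h₂ : IsArgmin (saddleFn h c μ₂) Y y₂) :
    0 ≤ inner ℝ (c y₂ - c y₁) (μ₁ - μ₂) := by
  have e1 := h₁.2 y₂ h₂.1
  have e2 := h₂.2 y₁ h₁.1
  rw [SmoothSaddle.saddleFn_sub h c μ₁ μ₂ y₁, SmoothSaddle.saddleFn_sub h c μ₁ μ₂ y₂] at e1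
  rw [real_inner_comm, inner_sub_right]
  linarith

/-- Growth of the dual gap: scaling towards `μs` into the region of the restricted secant
inequality and using concavity of the dual function. -/
theorem dualGap_growth (S : SmoothSaddle h c Y α l1 l0 l2) {μs : Vec dc} {ys : Vec dy}
    (hs : SaddleSol h c Y μs ys) {C δ : ℝ} (hR : ArgminRSI h c Y μs ys C δ) {μ : Vec dc}
    (hμ : μ ∈ orthant dc) {s : ℝ} (hs0 : 0 < s) (hs1 : s ≤ 1) (hsδ : s * ‖μ - μs‖ < δ) :
    C * s * (1 - s) * ‖μ - μs‖ ^ 2 ≤ dualGap h c Y μs μ := by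
  have hm : μs + s • (μ - μs) ∈ orthant dc := convex_orthant.line_mem hs.nonneg hμ hs0.le hs1
  set m := μs + s • (μ - μs) with hm_def
  obtain ⟨y, hy⟩ := S.exists_argmin hm
  have hmμ : m - μs = s • (μ - μs) := by rw [hm_def]; abel
  have h1 := hR m hm (by rwa [hmμ, norm_smul, Real.norm_of_nonneg hs0.le]) y hy
  rw [hmμ, norm_smul, Real.norm_of_nonneg hs0.le, inner_smul_right, inner_sub_left] at h1
  have h2 := hs.opt μ hμ
  obtain ⟨y', hy'⟩ := S.exists_argmin hμ
  have h3 := hy'.2 y hy.1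
  rw [SmoothSaddle.saddleFn_sub h c μ m y] at h3
  have h4 : μ - m = (1 - s) • (μ - μs) := by rw [hm_def, sub_smul, one_smul]; abel
  rw [h4, real_inner_smul_left, real_inner_comm] at h3
  have h5 := dualGap_nonneg S hs hm
  rw [dualGap, dualFn_eq hs.argmin, dualFn_eq hy] at h5
  rw [dualGap, dualFn_eq hs.argmin, dualFn_eq hy']
  have h6 : C * s * ‖μ - μs‖ ^ 2 ≤ -inner ℝ (c y) (μ - μs) := by
    refine le_of_mul_le_mul_left ?_ hs0
    nlinarith
  nlinarith [mul_le_mul_of_nonneg_left h6 (sub_nonneg.2 hs1)]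

theorem sq_dist_le_of_dualGap (S : SmoothSaddle h c Y α l1 l0 l2) {μs : Vec dc} {ys : Vec dy}
    (hs : SaddleSol h c Y μs ys) {C δ : ℝ} (hC : 0 < C) (hδ : 0 < δ)
    (hR : ArgminRSI h c Y μs ys C δ) {μ : Vec dc}
    (hμ : μ ∈ orthant dc) (hgap : dualGap h c Y μs μ < C * δ ^ 2 / 4) :
    ‖μ - μs‖ ^ 2 ≤ 4 * dualGap h c Y μs μ / C := by
  rcases lt_or_ge ‖μ - μs‖ (2 * δ) with hlt | hge
  · have h1 := dualGap_growth S hs hR hμ (s := 1 / 2) (by norm_num) (by norm_num) (by linarith)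
    rw [le_div_iff₀ hC]
    linarith
  · exfalso
    have hpos : 0 < ‖μ - μs‖ := by linarith
    have hs4 : δ / (2 * ‖μ - μs‖) ≤ 1 / 4 := by
      rw [div_le_iff₀ (by positivity)]; linarith
    have h1 := dualGap_growth S hs hR hμ (s := δ / (2 * ‖μ - μs‖)) (by positivity) (by linarith)
      (by
        have : δ / (2 * ‖μ - μs‖) * ‖μ - μs‖ = δ / 2 := by field_simp
        linarith)
    have h2 : C * (δ / (2 * ‖μ - μs‖)) * (1 - δ / (2 * ‖μ - μs‖)) * ‖μ - μs‖ ^ 2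
        = C * δ / 2 * ((1 - δ / (2 * ‖μ - μs‖)) * ‖μ - μs‖) := by field_simp
    have h3 : 3 / 4 * (2 * δ) ≤ (1 - δ / (2 * ‖μ - μs‖)) * ‖μ - μs‖ :=
      mul_le_mul (by linarith) hge (by positivity) (by linarith)
    have h4 := mul_le_mul_of_nonneg_left h3 (by positivity : 0 ≤ C * δ / 2)
    nlinarith [mul_pos hC (pow_pos hδ 2)]

end Dual

/-! ### Accelerated dual ascent with an inexact oracle -/

section Accelerated

variable {dy dc : ℕ} {h : Vec dy → ℝ} {c : Vec dy → Vec dc} {Y : Set (Vec dy)} {α l1 l0 l2 : ℝ}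

theorem gradient_saddleFn_left (h : Vec dy → ℝ) (c : Vec dy → Vec dc) (y : Vec dy) (w : Vec dc) :
    gradient (fun μ => saddleFn h c μ y) w = c y := by
  refine HasGradientAt.gradient ?_
  rw [hasGradientAt_iff_hasFDerivAt]
  have := ((InnerProductSpace.toDual ℝ (Vec dc) (c y)).hasFDerivAt (x := w)).const_add (h y)
  refine this.congr_of_eventuallyEq (Filter.Eventually.of_forall fun μ => ?_)
  simp [saddleFn, real_inner_comm]

/-- One accelerated step with extrapolation weight `θ`, where `z` and `z'` are the auxiliary points
before and after the step. -/
theorem accelerated_step (S : SmoothSaddle h c Y α l1 l0 l2) {μs : Vec dc} {ys : Vec dy}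
    (hs : SaddleSol h c Y μs ys) {η θ e : ℝ} (hη : 0 < η) (hηl : η * (52 * l0 ^ 2) ≤ α)
    (hθ0 : 0 ≤ θ) (hθ1 : θ ≤ 1) {μ μ' z z' w : Vec dc} {y : Vec dy} (hμ : μ ∈ orthant dc)
    (hy : y ∈ Y) (hμ' : μ' = proj (orthant dc) (w + η • c y))
    (hw : w = (1 - θ) • μ + θ • z) (hz' : μ' = (1 - θ) • μ + θ • z')
    (horacle : ∀ y' ∈ Y, saddleFn h c μ' y - saddleFn h c μ' y'
      ≤ 26 * (l0 ^ 2 / α) * ‖μ' - w‖ ^ 2 + e) :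
    2 * η * (dualGap h c Y μs μ' - (1 - θ) * dualGap h c Y μs μ - e)
      ≤ θ ^ 2 * (‖z - μs‖ ^ 2 - ‖z' - μs‖ ^ 2) := by
  have hα := S.α_pos
  have hμ'mem : μ' ∈ orthant dc := hμ' ▸ proj_orthant_mem _
  set u := (1 - θ) • μ + θ • μs with hu_def
  have hu : u ∈ orthant dc := convex_orthant hμ hs.nonneg (by linarith) hθ0 (by ring)
  have hvi := proj_inner_nonpos isClosed_orthant convex_orthant orthant_nonempty (w + η • c y) hu
  rw [← hμ', add_sub_right_comm, inner_add_left, real_inner_smul_left] at hvi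
  obtain ⟨yu, hyu⟩ := S.exists_argmin hu
  obtain ⟨y1, hy1⟩ := S.exists_argmin hμ
  obtain ⟨y2, hy2⟩ := S.exists_argmin hμ'mem
  have h1 := hyu.2 y hy
  have h2 := horacle y2 hy2.1
  have hconc : (1 - θ) * saddleFn h c μ y1 + θ * saddleFn h c μs ys ≤ saddleFn h c u yu := by
    have e1 := mul_le_mul_of_nonneg_left (hy1.2 yu hyu.1) (sub_nonneg.2 hθ1)
    have e2 := mul_le_mul_of_nonneg_left (hs.argmin.2 yu hyu.1) hθ0
    have e3 : saddleFn h c u yu = (1 - θ) * saddleFn h c μ yu + θ * saddleFn h c μs yu := by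
      simp only [saddleFn, hu_def, inner_add_left, real_inner_smul_left]; ring
    linarith
  rw [SmoothSaddle.saddleFn_sub h c u μ' y, real_inner_comm] at h1
  have h3 : η * (26 * (l0 ^ 2 / α) * ‖μ' - w‖ ^ 2) ≤ 1 / 2 * ‖μ' - w‖ ^ 2 := by
    have e1 : η * (26 * (l0 ^ 2 / α)) ≤ 1 / 2 := by
      have : η * (26 * (l0 ^ 2 / α)) = η * (52 * l0 ^ 2) / α / 2 := by field_simp; ring
      have h5 : η * (52 * l0 ^ 2) / α ≤ 1 := (div_le_one hα).2 hηl
      linarith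
    calc _ = η * (26 * (l0 ^ 2 / α)) * ‖μ' - w‖ ^ 2 := by ring
      _ ≤ _ := mul_le_mul_of_nonneg_right e1 (sq_nonneg _)
  have h4 : ‖u - w‖ ^ 2 = ‖u - μ'‖ ^ 2 + ‖μ' - w‖ ^ 2 - 2 * inner ℝ (w - μ') (u - μ') := by
    have := norm_sub_sq_real (u - μ') (w - μ')
    rw [sub_sub_sub_cancel_right, norm_sub_rev w μ', real_inner_comm] at this
    linarith
  have h5 : ‖u - w‖ ^ 2 = θ ^ 2 * ‖z - μs‖ ^ 2 := by
    have : u - w = θ • (μs - z) := by rw [hw, hu_def, smul_sub]; abel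
    rw [this, norm_smul, mul_pow, norm_sub_rev, Real.norm_eq_abs, sq_abs]
  have h6 : ‖u - μ'‖ ^ 2 = θ ^ 2 * ‖z' - μs‖ ^ 2 := by
    have : u - μ' = θ • (μs - z') := by rw [hz', hu_def, smul_sub]; abel
    rw [this, norm_smul, mul_pow, norm_sub_rev, Real.norm_eq_abs, sq_abs]
  simp only [dualGap, dualFn_eq hs.argmin, dualFn_eq hy1, dualFn_eq hy2]
  have h7 : saddleFn h c μs ys - saddleFn h c μ' y2 - (1 - θ) * (saddleFn h c μs ys
      - saddleFn h c μ y1) - e ≤ inner ℝ (c y) (u - μ') + 26 * (l0 ^ 2 / α) * ‖μ' - w‖ ^ 2 := by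
    linarith
  have h8 := mul_le_mul_of_nonneg_left h7 hη.le
  linarith

/-- The auxiliary point `z_t = μ_{t-1} + (t+1)/2 (μ_t - μ_{t-1})` of the accelerated method. -/
noncomputable def auxPoint (t : ℕ) (s : MaxMinState dc dy) : Vec dc :=
  s.μprev + (((t : ℝ) + 1) / 2) • (s.μ - s.μprev)

theorem momentum_eq (t : ℕ) (s : MaxMinState dc dy) :
    momentum t s = (1 - 2 / ((t : ℝ) + 2)) • s.μ + (2 / ((t : ℝ) + 2)) • auxPoint t s := by
  have : (t : ℝ) + 2 ≠ 0 := by positivity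
  ext i
  simp only [momentum, auxPoint, PiLp.add_apply, PiLp.smul_apply, PiLp.sub_apply, smul_eq_mul]
  field_simp
  ring

theorem mu_succ_eq (L : Vec dc → Vec dy → ℝ) (Y : Set (Vec dy)) (η₁ η₂ : ℝ) (K t : ℕ)
    (s : MaxMinState dc dy) :
    (maxMinStep L Y η₁ η₂ K t s).μ = (1 - 2 / ((t : ℝ) + 2)) • s.μ
      + (2 / ((t : ℝ) + 2)) • auxPoint (t + 1) (maxMinStep L Y η₁ η₂ K t s) := by
  have : (t : ℝ) + 2 ≠ 0 := by positivity
  have hp : (maxMinStep L Y η₁ η₂ K t s).μprev = s.μ := rfl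
  ext i
  simp only [auxPoint, hp, PiLp.add_apply, PiLp.smul_apply, PiLp.sub_apply, smul_eq_mul]
  push_cast
  field_simp
  ring

theorem norm_convexComb_sub_le {θ M : ℝ} (hθ0 : 0 ≤ θ) (hθ1 : θ ≤ 1) {a b p : Vec dc}
    (ha : ‖a - p‖ ≤ M) (hb : ‖b - p‖ ≤ M) : ‖(1 - θ) • a + θ • b - p‖ ≤ M := by
  have h := (convex_closedBall p M) (x := a) (y := b) (by simpa [dist_eq_norm] using ha)
    (by simpa [dist_eq_norm] using hb) (sub_nonneg.2 hθ1) hθ0 (by ring)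
  simpa [dist_eq_norm] using h

/-- The distance of the inner iterates from `z` stays below any bound that dominates the initial
distance and the effect of the perturbation of the multiplier. -/
theorem pgd_dist_bound (S : SmoothSaddle h c Y α l1 l0 l2) {η : ℝ} (hη : 0 < η)
    (hηα : η * α ≤ 1) {w m : Vec dc} (hm : m ∈ orthant dc) (hηm : η * (l1 + ‖m‖ * l2) ≤ 1 / 4)
    {d : ℝ} (hd : ‖w - m‖ ≤ d) {z : Vec dy} (hz : IsArgmin (saddleFn h c m) Y z) {r : ℝ}
    (hr : 8 * (d ^ 2 * l0 ^ 2 / α ^ 2) ≤ r ^ 2) (hr0 : 0 ≤ r) {y : Vec dy}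
    (hy : y ∈ Y) (hyr : ‖y - z‖ ≤ r) (k : ℕ) :
    ‖(pgdStep (saddleFn h c) Y η w)^[k] y - z‖ ≤ r := by
  have hα := S.α_pos
  induction k with
  | zero => exact hyr
  | succ k ih =>
    rw [Function.iterate_succ_apply']
    have hk := pgd_iterate_mem S (saddleFn h c) η w hy k
    have h1 := pgdStep_perturbed S hη hηα hm hηm hd hz.1 hk
    have h2 := hz.2 _ (pgdStep_mem S (saddleFn h c) η w ((pgdStep (saddleFn h c) Y η w)^[k] y))
    have h3 : ‖(pgdStep (saddleFn h c) Y η w)^[k] y - z‖ ^ 2 ≤ r ^ 2 :=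
      pow_le_pow_left₀ (norm_nonneg _) ih 2
    have h4 : 4 * η * (d ^ 2 * l0 ^ 2 / α) = η * α / 2 * (8 * (d ^ 2 * l0 ^ 2 / α ^ 2)) := by
      field_simp; ring
    have h5 := mul_nonneg (mul_nonneg zero_le_two hη.le) (sub_nonneg.2 h2)
    have h6 := mul_le_mul_of_nonneg_left h3 (show 0 ≤ 1 - η * α / 2 by linarith)
    have h7 := mul_le_mul_of_nonneg_left hr (show 0 ≤ η * α / 2 by positivity)
    refine (sq_le_sq₀ (norm_nonneg _) hr0).1 ?_
    linarith

/-- Admissible stepsizes for multipliers bounded by `B` and starting points at distance at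
most `R`. -/
structure StepsizeOK (α l1 l0 l2 B R η₁ η₂ : ℝ) : Prop where
  η₁_pos : 0 < η₁
  η₂_pos : 0 < η₂
  strong : η₁ * α ≤ 1
  smooth : η₁ * (l1 + (B + (R + 1)) * l2) ≤ 1 / 4
  dual : η₂ * (52 * l0 ^ 2) ≤ α

/-- What holds after `t` of `T` iterations of the accelerated method: all points stay bounded, and
the Lyapunov function has grown by at most `t / T`. -/
structure AccelInv (h : Vec dy → ℝ) (c : Vec dy → Vec dc) (Y : Set (Vec dy)) (α l0 R η₂ : ℝ)
    (μs : Vec dc) (ys : Vec dy) (T t : ℕ) (s : MaxMinState dc dy) : Prop where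
  μ_mem : s.μ ∈ orthant dc
  y_mem : s.y ∈ Y
  μ_bdd : ‖s.μ - μs‖ ≤ R + 1
  y_bdd : ‖s.y - ys‖ ≤ R + 3 * (R + 1) * l0 / α
  lyapunov : 2 * η₂ * ((t : ℝ) * (t + 2) / 4 * dualGap h c Y μs s.μ) + ‖auxPoint t s - μs‖ ^ 2
    ≤ R ^ 2 + t / T

/-- Bound for the distance of warm starts of the inner loop from the current minimizer. -/
noncomputable def warmRadius (α l0 R : ℝ) : ℝ := R + 4 * (R + 1) * l0 / α

theorem AccelInv.aux_bdd {S : SmoothSaddle h c Y α l1 l0 l2} {R η₂ : ℝ} (hR : 0 ≤ R)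
    (hη₂ : 0 < η₂) {μs : Vec dc} {ys : Vec dy} (hs : SaddleSol h c Y μs ys) {T t : ℕ} (htT : t ≤ T)
    {s : MaxMinState dc dy} (I : AccelInv h c Y α l0 R η₂ μs ys T t s) :
    ‖auxPoint t s - μs‖ ≤ R + 1 := by
  have h1 := I.lyapunov
  have h2 : (t : ℝ) / T ≤ 1 := div_le_one_of_le₀ (by exact_mod_cast htT) (by positivity)
  have h3 := dualGap_nonneg S hs I.μ_mem
  have h4 : 0 ≤ 2 * η₂ * ((t : ℝ) * (t + 2) / 4 * dualGap h c Y μs s.μ) := by positivity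
  refine (sq_le_sq₀ (norm_nonneg _) (by linarith)).1 ?_
  nlinarith

theorem lyapunov_succ {η g g' a a' e R : ℝ} {t T : ℕ} (hη : 0 < η) (hg' : 0 ≤ g')
    (hstep : 2 * η * (g' - (1 - 2 / ((t : ℝ) + 2)) * g - e) ≤ (2 / ((t : ℝ) + 2)) ^ 2 * (a - a'))
    (herr : 2 * η * (((t : ℝ) + 2) ^ 2 / 4 * e) ≤ 1 / T)
    (hprev : 2 * η * ((t : ℝ) * (t + 2) / 4 * g) + a ≤ R ^ 2 + t / T) :
    2 * η * (((t + 1 : ℕ) : ℝ) * ((t + 1 : ℕ) + 2) / 4 * g') + a'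
      ≤ R ^ 2 + ((t + 1 : ℕ) : ℝ) / T := by
  have ht2 : (0 : ℝ) < (t : ℝ) + 2 := by positivity
  have h1 := mul_le_mul_of_nonneg_left hstep (show 0 ≤ ((t : ℝ) + 2) ^ 2 / 4 by positivity)
  have h2 : ((t : ℝ) + 2) ^ 2 / 4 * ((2 / ((t : ℝ) + 2)) ^ 2 * (a - a')) = a - a' := by
    field_simp; ring
  have h3 : ((t : ℝ) + 2) ^ 2 / 4 * (2 * η * (g' - (1 - 2 / ((t : ℝ) + 2)) * g - e))
      = 2 * η * (((t : ℝ) + 2) ^ 2 / 4 * g') - 2 * η * ((t : ℝ) * (t + 2) / 4 * g)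
        - 2 * η * (((t : ℝ) + 2) ^ 2 / 4 * e) := by
    field_simp; ring
  rw [h2, h3] at h1
  have h4 : 2 * η * (((t + 1 : ℕ) : ℝ) * ((t + 1 : ℕ) + 2) / 4 * g')
      ≤ 2 * η * (((t : ℝ) + 2) ^ 2 / 4 * g') := by
    refine mul_le_mul_of_nonneg_left (mul_le_mul_of_nonneg_right ?_ hg') (by positivity)
    push_cast
    linarith
  have h6 : ((t + 1 : ℕ) : ℝ) / T = t / T + 1 / T := by push_cast; rw [add_div]
  linarith

theorem accelInv_succ (S : SmoothSaddle h c Y α l1 l0 l2) {B R η₁ η₂ : ℝ} (hR : 0 ≤ R)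
    (hη : StepsizeOK α l1 l0 l2 B R η₁ η₂) {μs : Vec dc} {ys : Vec dy}
    (hs : SaddleSol h c Y μs ys) (hB : ‖μs‖ ≤ B) {T K t : ℕ} (hK : 1 ≤ K)
    (hprec : 16 * (T : ℝ) ^ 3 * ((1 - η₁ * α / 2) ^ K * warmRadius α l0 R ^ 2 * η₂) ≤ η₁)
    (ht : t < T) {s : MaxMinState dc dy} (I : AccelInv h c Y α l0 R η₂ μs ys T t s) :
    AccelInv h c Y α l0 R η₂ μs ys T (t + 1) (maxMinStep (saddleFn h c) Y η₁ η₂ K t s) := by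
  have hα := S.α_pos
  have hl0 := S.l0_nonneg
  have hη₁ := hη.η₁_pos
  have hη₂ := hη.η₂_pos
  have hρ : 0 ≤ 1 - η₁ * α / 2 := by linarith [hη.strong]
  set M := R + 1 with hM
  have hM0 : 0 ≤ M := by linarith
  set θ : ℝ := 2 / ((t : ℝ) + 2) with hθ
  have ht2 : (0 : ℝ) < (t : ℝ) + 2 := by positivity
  have hθ0 : 0 < θ := by positivity
  have hθ1 : θ ≤ 1 := by
    rw [hθ, div_le_one ht2]
    linarith [Nat.cast_nonneg (α := ℝ) t]
  set w := momentum t s with hw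
  have hwM : ‖w - μs‖ ≤ M := by
    rw [hw, momentum_eq]
    exact norm_convexComb_sub_le hθ0.le hθ1 I.μ_bdd (I.aux_bdd (S := S) hR hη₂ hs ht.le)
  have hwB : ‖w‖ ≤ B + M := by
    have := norm_add_le (w - μs) μs
    rw [sub_add_cancel] at this
    linarith
  have hηw : η₁ * (l1 + ‖w‖ * l2) ≤ 1 / 4 :=
    (mul_le_mul_of_nonneg_left (add_le_add_right
      (mul_le_mul_of_nonneg_right hwB S.l2_nonneg) _) hη₁.le).trans hη.smooth
  have hημ : η₁ * (l1 + ‖μs‖ * l2) ≤ 1 / 4 :=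
    (mul_le_mul_of_nonneg_left (add_le_add_right
      (mul_le_mul_of_nonneg_right (by linarith) S.l2_nonneg) _) hη₁.le).trans hη.smooth
  set s' := maxMinStep (saddleFn h c) Y η₁ η₂ K t s with hs'
  have hy' : s'.y = (pgdStep (saddleFn h c) Y η₁ w)^[K] s.y := rfl
  have hy'mem : s'.y ∈ Y := pgd_iterate_mem S _ η₁ w I.y_mem K
  have hμ' : s'.μ = proj (orthant dc) (w + η₂ • c s'.y) := by
    rw [← gradient_saddleFn_left h c s'.y w]; rfl
  have hμ'mem : s'.μ ∈ orthant dc := hμ' ▸ proj_orthant_mem _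
  -- distance of the warm start from the minimizer for the projected momentum point
  obtain ⟨z, hz⟩ := S.exists_argmin (proj_orthant_mem w)
  have hzs : ‖z - ys‖ ≤ M * l0 / α := by
    have h1 := S.argmin_dist_le (proj_orthant_mem w) hs.nonneg hz hs.argmin
    have h2 := norm_proj_sub_le isClosed_orthant convex_orthant w hs.nonneg
    rw [le_div_iff₀ hα, mul_comm, mul_comm M]
    exact h1.trans (mul_le_mul_of_nonneg_left (h2.trans hwM) hl0)
  have hwarm : ‖s.y - z‖ ≤ warmRadius α l0 R := by
    have h1 := norm_sub_le_norm_sub_add_norm_sub s.y ys z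
    rw [norm_sub_rev ys z] at h1
    have h2 : warmRadius α l0 R = (R + 3 * M * l0 / α) + M * l0 / α := by
      rw [warmRadius]; field_simp; ring
    linarith [I.y_bdd]
  set e := 4 * ((1 - η₁ * α / 2) ^ K * warmRadius α l0 R ^ 2 / η₁) with he
  have horacle : ∀ y' ∈ Y, saddleFn h c s'.μ s'.y - saddleFn h c s'.μ y'
      ≤ 26 * (l0 ^ 2 / α) * ‖s'.μ - w‖ ^ 2 + e := by
    intro y' hy'Y
    have h1 := pgd_oracle S hη₁ hη.strong hηw hμ'mem hz I.y_mem hK hy'Y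
    have h2 : (1 - η₁ * α / 2) ^ K * ‖s.y - z‖ ^ 2 / η₁
        ≤ (1 - η₁ * α / 2) ^ K * warmRadius α l0 R ^ 2 / η₁ := by
      gcongr
    rw [hy']
    linarith
  have hstep := accelerated_step S hs hη₂ hη.dual hθ0.le hθ1 I.μ_mem hy'mem hμ'
    (momentum_eq t s) (mu_succ_eq (saddleFn h c) Y η₁ η₂ K t s) horacle
  have hgap := dualGap_nonneg S hs I.μ_mem
  have hgap' := dualGap_nonneg S hs hμ'mem
  -- the oracle errors sum up to at most one
  have hT : (0 : ℝ) < T := by exact_mod_cast (Nat.zero_le t).trans_lt ht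
  have herr : 2 * η₂ * (((t : ℝ) + 2) ^ 2 / 4 * e) ≤ 1 / T := by
    have h1 : (t : ℝ) + 2 ≤ 2 * T := by
      have : (t : ℝ) + 1 ≤ T := by exact_mod_cast ht
      have : (1 : ℝ) ≤ T := by exact_mod_cast (by omega : 1 ≤ T)
      linarith
    have h2 : ((t : ℝ) + 2) ^ 2 ≤ (2 * T) ^ 2 := pow_le_pow_left₀ ht2.le h1 2
    have he0 : 0 ≤ e := by positivity
    have h3 : 2 * η₂ * (((t : ℝ) + 2) ^ 2 / 4 * e) ≤ 2 * η₂ * ((2 * T) ^ 2 / 4 * e) := by gcongr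
    refine h3.trans ?_
    rw [le_div_iff₀ hT]
    have h4 : 2 * η₂ * ((2 * (T : ℝ)) ^ 2 / 4 * e) * T = 1 / 2 * ((16 * (T : ℝ) ^ 3
      * ((1 - η₁ * α / 2) ^ K * warmRadius α l0 R ^ 2 * η₂)) / η₁) := by
      rw [he]; field_simp; ring
    rw [h4]
    have h5 := (div_le_one hη₁).2 hprec
    linarith
  have hlyap : 2 * η₂ * (((t + 1 : ℕ) : ℝ) * ((t + 1 : ℕ) + 2) / 4 * dualGap h c Y μs s'.μ)
      + ‖auxPoint (t + 1) s' - μs‖ ^ 2 ≤ R ^ 2 + ((t + 1 : ℕ) : ℝ) / T :=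
    lyapunov_succ hη₂ hgap' hstep herr I.lyapunov
  have haux : ‖auxPoint (t + 1) s' - μs‖ ≤ M := by
    have h2 : ((t + 1 : ℕ) : ℝ) / T ≤ 1 :=
      div_le_one_of_le₀ (by exact_mod_cast ht) (by positivity)
    have h4 : 0 ≤ 2 * η₂ * (((t + 1 : ℕ) : ℝ) * ((t + 1 : ℕ) + 2) / 4
      * dualGap h c Y μs s'.μ) := by positivity
    refine (sq_le_sq₀ (norm_nonneg _) hM0).1 ?_
    have h5 : M ^ 2 = R ^ 2 + 2 * R + 1 := by rw [hM]; ring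
    linarith
  refine ⟨hμ'mem, hy'mem, ?_, ?_, hlyap⟩
  · rw [mu_succ_eq (saddleFn h c) Y η₁ η₂ K t s]
    exact norm_convexComb_sub_le hθ0.le hθ1 I.μ_bdd haux
  · rw [hy']
    refine pgd_dist_bound S hη₁ hη.strong hs.nonneg hημ hwM hs.argmin ?_ (by positivity)
      I.y_mem I.y_bdd K
    have h1 : (3 * M * l0 / α) ^ 2 ≤ (R + 3 * M * l0 / α) ^ 2 :=
      pow_le_pow_left₀ (by positivity) (by linarith) 2
    have h2 : (3 * M * l0 / α) ^ 2 = 9 * (M ^ 2 * l0 ^ 2 / α ^ 2) := by field_simp; ring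
    have h3 : 0 ≤ M ^ 2 * l0 ^ 2 / α ^ 2 := by positivity
    linarith

theorem accelInv_iter (S : SmoothSaddle h c Y α l1 l0 l2) {B R η₁ η₂ : ℝ} (hR : 0 ≤ R)
    (hη : StepsizeOK α l1 l0 l2 B R η₁ η₂) {μs : Vec dc} {ys : Vec dy}
    (hs : SaddleSol h c Y μs ys) (hB : ‖μs‖ ≤ B) {T K : ℕ} (hK : 1 ≤ K)
    (hprec : 16 * (T : ℝ) ^ 3 * ((1 - η₁ * α / 2) ^ K * warmRadius α l0 R ^ 2 * η₂) ≤ η₁)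
    {y₀ : Vec dy} {μ₀ : Vec dc} (hy₀ : y₀ ∈ Y) (hμ₀ : μ₀ ∈ orthant dc)
    (hstart : sqErr (y₀, μ₀) ys μs ≤ R ^ 2) {t : ℕ} (ht : t ≤ T) :
    AccelInv h c Y α l0 R η₂ μs ys T t (maxMinIter (saddleFn h c) Y η₁ η₂ K y₀ μ₀ t) := by
  induction t with
  | zero =>
    have hα := S.α_pos
    have hl0 := S.l0_nonneg
    simp only [sqErr] at hstart
    have h1 : ‖y₀ - ys‖ ≤ R :=
      (sq_le_sq₀ (norm_nonneg _) hR).1 (by linarith [sq_nonneg ‖μ₀ - μs‖])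
    have h2 : ‖μ₀ - μs‖ ≤ R :=
      (sq_le_sq₀ (norm_nonneg _) hR).1 (by linarith [sq_nonneg ‖y₀ - ys‖])
    refine ⟨hμ₀, hy₀, ?_, ?_, ?_⟩
    · simp only [maxMinIter]; linarith
    · simp only [maxMinIter]
      have : 0 ≤ 3 * (R + 1) * l0 / α := by positivity
      linarith
    · simp only [maxMinIter, auxPoint, sub_self, smul_zero, add_zero]
      push_cast
      simp only [zero_mul, zero_div, mul_zero, zero_add, add_zero]
      linarith [sq_nonneg ‖y₀ - ys‖]
  | succ t ih => exact accelInv_succ S hR hη hs hB hK hprec ht (ih (by omega))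

/-- The constant of the `O(1/T²)` bound on the squared error. -/
noncomputable def accelConst (α l0 R C η₁ η₂ : ℝ) : ℝ :=
  32 * (R + 1) ^ 2 / (C * η₂) * (1 + 72 * (l0 ^ 2 / α ^ 2)) + η₁ / η₂

/-- Convergence of the accelerated max-min method under a local restricted secant inequality. -/
theorem maxMin_sqErr_le (S : SmoothSaddle h c Y α l1 l0 l2) {B R η₁ η₂ : ℝ} (hR : 0 ≤ R)
    (hη : StepsizeOK α l1 l0 l2 B R η₁ η₂) {μs : Vec dc} {ys : Vec dy}
    (hs : SaddleSol h c Y μs ys) (hB : ‖μs‖ ≤ B) {C δ : ℝ} (hC : 0 < C) (hδ : 0 < δ)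
    (hRSI : ArgminRSI h c Y μs ys C δ) {T K : ℕ} (hT : 4 ≤ T) (hK : 1 ≤ K)
    (hprec : 16 * (T : ℝ) ^ 3 * ((1 - η₁ * α / 2) ^ K * warmRadius α l0 R ^ 2 * η₂) ≤ η₁)
    (hball : 32 * (R + 1) ^ 2 / η₂ * (1 / (T : ℝ) ^ 2) < C * δ ^ 2)
    {y₀ : Vec dy} {μ₀ : Vec dc} (hy₀ : y₀ ∈ Y) (hμ₀ : μ₀ ∈ orthant dc)
    (hstart : sqErr (y₀, μ₀) ys μs ≤ R ^ 2) :
    sqErr (maxMin (saddleFn h c) Y η₁ η₂ T K y₀ μ₀) ys μs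
      ≤ accelConst α l0 R C η₁ η₂ * (1 / (T : ℝ) ^ 2) := by
  have hα := S.α_pos
  have hl0 := S.l0_nonneg
  have hη₁ := hη.η₁_pos
  have hη₂ := hη.η₂_pos
  have hρ : 0 ≤ 1 - η₁ * α / 2 := by linarith [hη.strong]
  have hT0 : (4 : ℝ) ≤ T := by exact_mod_cast hT
  have hTpos : (0 : ℝ) < T := by linarith
  set M := R + 1 with hM
  set it := maxMinIter (saddleFn h c) Y η₁ η₂ K y₀ μ₀ with hit
  have inv : ∀ t ≤ T, AccelInv h c Y α l0 R η₂ μs ys T t (it t) := fun t ht =>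
    accelInv_iter S hR hη hs hB hK hprec hy₀ hμ₀ hstart ht
  set Z := 32 * M ^ 2 / (C * η₂ * (T : ℝ) ^ 2) with hZ
  have hZ0 : 0 ≤ Z := by positivity
  have hμ : ∀ t, T ≤ t + 2 → t ≤ T → ‖(it t).μ - μs‖ ^ 2 ≤ Z := by
    intro t h1 h2
    have I := inv t h2
    have hg := dualGap_nonneg S hs I.μ_mem
    have ht : (T : ℝ) / 2 ≤ t := by
      have : (T : ℝ) ≤ t + 2 := by exact_mod_cast h1
      linarith
    have h3 : 2 * η₂ * ((t : ℝ) * (t + 2) / 4 * dualGap h c Y μs (it t).μ) ≤ M ^ 2 := by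
      have e1 := I.lyapunov
      have e2 : (t : ℝ) / T ≤ 1 := div_le_one_of_le₀ (by exact_mod_cast h2) (by positivity)
      nlinarith [sq_nonneg ‖auxPoint t (it t) - μs‖]
    have h4 : (T : ℝ) ^ 2 / 16 ≤ (t : ℝ) * (t + 2) / 4 := by nlinarith
    have h5 : 2 * η₂ * ((T : ℝ) ^ 2 / 16 * dualGap h c Y μs (it t).μ) ≤ M ^ 2 :=
      le_trans (by gcongr) h3
    have h6 : dualGap h c Y μs (it t).μ ≤ C * Z / 4 := by
      have : C * Z / 4 = M ^ 2 / (2 * η₂ * ((T : ℝ) ^ 2 / 16)) := by rw [hZ]; field_simp; ring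
      rw [this, le_div_iff₀ (by positivity)]
      linarith
    have h7 : C * Z < C * δ ^ 2 := by
      refine lt_of_eq_of_lt ?_ hball
      rw [hZ]; field_simp
    have h8 := sq_dist_le_of_dualGap S hs hC hδ hRSI I.μ_mem (by linarith)
    refine h8.trans ?_
    rw [div_le_iff₀ hC]
    linarith
  obtain ⟨j, rfl⟩ : ∃ j, T = j + 2 := ⟨T - 2, by omega⟩
  have hμT := hμ (j + 2) (by omega) le_rfl
  set w := momentum (j + 1) (it (j + 1)) with hw
  have hwZ : ‖w - μs‖ ≤ 3 * √Z := by
    have e1 : ‖(it (j + 1)).μ - μs‖ ≤ √Z := Real.le_sqrt_of_sq_le (hμ (j + 1) (by omega) (by omega))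
    have e2 : ‖(it j).μ - μs‖ ≤ √Z := Real.le_sqrt_of_sq_le (hμ j (by omega) (by omega))
    set β : ℝ := (((j + 1 : ℕ) : ℝ) - 1) / (((j + 1 : ℕ) : ℝ) + 2) with hβ
    have hβ0 : 0 ≤ β := by rw [hβ]; push_cast; apply div_nonneg <;> linarith [Nat.cast_nonneg (α := ℝ) j]
    have hβ1 : β ≤ 1 := by
      rw [hβ]; push_cast
      apply div_le_one_of_le₀ <;> linarith [Nat.cast_nonneg (α := ℝ) j]
    have e3 : w - μs = (1 + β) • ((it (j + 1)).μ - μs) - β • ((it j).μ - μs) := by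
      have : w = (it (j + 1)).μ + β • ((it (j + 1)).μ - (it j).μ) := rfl
      rw [this, add_smul, one_smul, smul_sub, smul_sub, smul_sub]; abel
    rw [e3]
    refine (norm_sub_le _ _).trans ?_
    rw [norm_smul, norm_smul, Real.norm_of_nonneg hβ0, Real.norm_of_nonneg (by linarith)]
    nlinarith [Real.sqrt_nonneg Z, norm_nonneg ((it (j + 1)).μ - μs), norm_nonneg ((it j).μ - μs)]
  have I := inv (j + 1) (by omega)
  have hημ : η₁ * (l1 + ‖μs‖ * l2) ≤ 1 / 4 :=
    (mul_le_mul_of_nonneg_left (add_le_add_right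
      (mul_le_mul_of_nonneg_right (by linarith) S.l2_nonneg) _) hη₁.le).trans hη.smooth
  have hyT := pgd_dist_le S hη₁ hη.strong hs.nonneg hημ hwZ hs.argmin I.y_mem K
  have hyT' : (it (j + 2)).y = (pgdStep (saddleFn h c) Y η₁ w)^[K] (it (j + 1)).y := rfl
  rw [← hyT'] at hyT
  have hyW : ‖(it (j + 1)).y - ys‖ ≤ warmRadius α l0 R := by
    have e1 := I.y_bdd
    have e2 : 3 * (R + 1) * l0 / α ≤ 4 * (R + 1) * l0 / α := by gcongr; norm_num
    rw [warmRadius]; linarith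
  set T : ℝ := ((j + 2 : ℕ) : ℝ) with hTdef
  have hgeo : (1 - η₁ * α / 2) ^ K * ‖(it (j + 1)).y - ys‖ ^ 2 ≤ η₁ / η₂ * (1 / T ^ 2) := by
    have e1 : (1 - η₁ * α / 2) ^ K * ‖(it (j + 1)).y - ys‖ ^ 2
        ≤ (1 - η₁ * α / 2) ^ K * warmRadius α l0 R ^ 2 := by gcongr
    refine e1.trans ?_
    set q := (1 - η₁ * α / 2) ^ K * warmRadius α l0 R ^ 2 with hq
    have hq0 : 0 ≤ q := by positivity
    have e2 : η₁ / η₂ * (1 / T ^ 2) = η₁ / (η₂ * T ^ 2) := by field_simp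
    rw [e2, le_div_iff₀ (by positivity)]
    refine le_trans ?_ hprec
    have e3 : T ^ 2 ≤ 16 * T ^ 3 := by nlinarith [pow_pos hTpos 2]
    calc q * (η₂ * T ^ 2) = T ^ 2 * (q * η₂) := by ring
      _ ≤ 16 * T ^ 3 * (q * η₂) := mul_le_mul_of_nonneg_right e3 (by positivity)
  have hsq : (3 * √Z) ^ 2 = 9 * Z := by rw [mul_pow, Real.sq_sqrt hZ0]; norm_num
  rw [hsq] at hyT
  have hfin : accelConst α l0 R C η₁ η₂ * (1 / T ^ 2)
      = Z + 8 * (9 * Z * l0 ^ 2 / α ^ 2) + η₁ / η₂ * (1 / T ^ 2) := by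
    rw [accelConst, hZ]; field_simp; ring
  rw [hfin]
  change ‖(it (j + 2)).y - ys‖ ^ 2 + ‖(it (j + 2)).μ - μs‖ ^ 2 ≤ _
  linarith

theorem maxMin_mem (S : SmoothSaddle h c Y α l1 l0 l2) (L : Vec dc → Vec dy → ℝ) (η₁ η₂ : ℝ)
    (T K : ℕ) {y₀ : Vec dy} {μ₀ : Vec dc} (hy₀ : y₀ ∈ Y) (hμ₀ : μ₀ ∈ orthant dc) :
    (maxMin L Y η₁ η₂ T K y₀ μ₀).1 ∈ Y ∧ (maxMin L Y η₁ η₂ T K y₀ μ₀).2 ∈ orthant dc := by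
  induction T with
  | zero => exact ⟨hy₀, hμ₀⟩
  | succ t ih => exact ⟨pgd_iterate_mem S L η₁ _ ih.1 K, proj_orthant_mem _⟩

end Accelerated

/-! ### Rescaling the multiplier -/

section Scaling

variable {dy dc : ℕ} {h : Vec dy → ℝ} {c : Vec dy → Vec dc} {Y : Set (Vec dy)} {α l1 l0 l2 : ℝ}

theorem SmoothSaddle.const_mul (S : SmoothSaddle h c Y α l1 l0 l2) {γ : ℝ} (hγ : 0 < γ) :
    SmoothSaddle (fun y => γ * h y) c Y (γ * α) (γ * l1) l0 l2 where
  α_pos := mul_pos hγ S.α_pos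
  l1_nonneg := mul_nonneg hγ.le S.l1_nonneg
  l0_nonneg := S.l0_nonneg
  l2_nonneg := S.l2_nonneg
  closed := S.closed
  conv := S.conv
  nonempty := S.nonempty
  diff_h := fun y hy => (S.diff_h y hy).const_mul γ
  diff_c := S.diff_c
  strong := fun y hy z hz => by
    rw [fderiv_const_mul (S.diff_h y hy)]
    simp only [smul_apply, smul_eq_mul]
    linarith [mul_le_mul_of_nonneg_left (S.strong y hy z hz) hγ.le]
  smooth := fun y hy z hz => by
    rw [fderiv_const_mul (S.diff_h y hy)]
    simp only [smul_apply, smul_eq_mul]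
    linarith [mul_le_mul_of_nonneg_left (S.smooth y hy z hz) hγ.le]
  c_convex := S.c_convex
  c_lip := S.c_lip
  c_smooth := S.c_smooth

theorem saddleFn_const_mul (h : Vec dy → ℝ) (c : Vec dy → Vec dc) {γ : ℝ} (hγ : 0 < γ)
    (μ : Vec dc) (y : Vec dy) :
    saddleFn (fun y => γ * h y) c μ y = γ * saddleFn h c (γ⁻¹ • μ) y := by
  simp only [saddleFn, real_inner_smul_left]
  field_simp

theorem isArgmin_const_mul {γ : ℝ} (hγ : 0 < γ) {μ : Vec dc} {y : Vec dy} :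
    IsArgmin (saddleFn (fun y => γ * h y) c μ) Y y ↔ IsArgmin (saddleFn h c (γ⁻¹ • μ)) Y y := by
  simp only [IsArgmin, saddleFn_const_mul h c hγ, mul_le_mul_iff_right₀ hγ]

theorem SaddleSol.of_isMaxMin (S : SmoothSaddle h c Y α l1 l0 l2) {μs : Vec dc} {ys : Vec dy}
    (hs : IsMaxMin (saddleFn h c) Y μs ys) : SaddleSol h c Y μs ys :=
  ⟨hs.nonneg, ⟨hs.mem, hs.min⟩, fun _ hu => inner_nonpos_of_isMaxMin S.α_pos hs
    (fun _ hy => S.argmin_growth hs.nonneg ⟨hs.mem, hs.min⟩ hy)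
    (fun _ hy => S.c_lip _ hs.mem _ hy) hu⟩

theorem SaddleSol.of_const_mul {γ : ℝ} (hγ : 0 < γ) {μs : Vec dc} {ys : Vec dy}
    (hs : SaddleSol (fun y => γ * h y) c Y μs ys) : SaddleSol h c Y (γ⁻¹ • μs) ys where
  nonneg := smul_mem_orthant (inv_nonneg.2 hγ.le) hs.nonneg
  argmin := (isArgmin_const_mul hγ).1 hs.argmin
  opt := fun u hu => by
    have h1 := hs.opt (γ • u) (smul_mem_orthant hγ.le hu)
    have h2 : γ • u - μs = γ • (u - γ⁻¹ • μs) := by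
      rw [smul_sub, smul_smul, mul_inv_cancel₀ hγ.ne', one_smul]
    rw [h2, real_inner_smul_right] at h1
    exact nonpos_of_mul_nonpos_right h1 hγ

theorem ArgminRSI.of_localRSI (S : SmoothSaddle h c Y α l1 l0 l2) {μs : Vec dc} {ys : Vec dy}
    (hs : SaddleSol h c Y μs ys) {C δ : ℝ}
    (hR : LocalRSI (dualFn (saddleFn h c) Y) μs C δ) : ArgminRSI h c Y μs ys C δ := by
  intro μ hμ hd y hy
  have hgrad : ∀ {m : Vec dc} {z : Vec dy}, m ∈ orthant dc → IsArgmin (saddleFn h c m) Y z →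
      gradient (dualFn (saddleFn h c) Y) m = c z := fun hm hz =>
    (hasGradientAt_dualFn S.α_pos hz.1 (fun _ hy => S.argmin_growth hm hz hy)
      (fun _ hy => S.c_lip _ hz.1 _ hy)).gradient
  have h1 := hR μ ⟨by rwa [Metric.mem_ball, dist_eq_norm], hμ⟩
  rwa [hgrad hμ hy, hgrad hs.nonneg hs.argmin, neg_add_eq_sub] at h1

theorem ArgminRSI.of_const_mul {γ : ℝ} (hγ : 0 < γ) {μs : Vec dc} {ys : Vec dy} {C δ : ℝ}
    (hR : ArgminRSI (fun y => γ * h y) c Y μs ys C δ) :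
    ArgminRSI h c Y (γ⁻¹ • μs) ys (γ * C) (δ / γ) := by
  intro μ hμ hd y hy
  have h2 : γ • μ - μs = γ • (μ - γ⁻¹ • μs) := by
    rw [smul_sub, smul_smul, mul_inv_cancel₀ hγ.ne', one_smul]
  have h1 := hR (γ • μ) (smul_mem_orthant hγ.le hμ)
    (by rw [h2, norm_smul, Real.norm_of_nonneg hγ.le]; rwa [lt_div_iff₀' hγ] at hd) y
    ((isArgmin_const_mul hγ).2 (by rwa [smul_smul, inv_mul_cancel₀ hγ.ne', one_smul]))
  rw [h2, norm_smul, Real.norm_of_nonneg hγ.le, real_inner_smul_right, mul_pow] at h1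
  refine le_of_mul_le_mul_left ?_ hγ
  linarith

theorem pgdStep_const_mul (h : Vec dy → ℝ) (c : Vec dy → Vec dc) (Y : Set (Vec dy)) {γ : ℝ}
    (hγ : 0 < γ) (η : ℝ) (μ : Vec dc) :
    pgdStep (saddleFn (fun y => γ * h y) c) Y (η / γ) μ = pgdStep (saddleFn h c) Y η (γ⁻¹ • μ) := by
  funext y
  have h1 : (fun y' => saddleFn (fun y => γ * h y) c μ y')
      = fun y' => γ • saddleFn h c (γ⁻¹ • μ) y' := by
    funext y'; rw [saddleFn_const_mul h c hγ, smul_eq_mul]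
  have h2 : (η / γ) • gradient (fun y' => saddleFn (fun y => γ * h y) c μ y') y
      = η • gradient (fun y' => saddleFn h c (γ⁻¹ • μ) y') y := by
    refine ext_inner_right ℝ fun d => ?_
    rw [real_inner_smul_left, real_inner_smul_left, gradient_inner, gradient_inner, h1,
      show (fun y' => γ • saddleFn h c (γ⁻¹ • μ) y') = γ • saddleFn h c (γ⁻¹ • μ) from rfl,
      fderiv_const_smul_field, Pi.smul_apply, smul_apply, smul_eq_mul]
    field_simp
  rw [pgdStep, pgdStep, h2]

/-- Multiplying `h` by `γ` amounts to rescaling the multiplier by `γ` and the stepsizes by `1/γ`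
and `γ`. -/
theorem maxMin_const_mul (h : Vec dy → ℝ) (c : Vec dy → Vec dc) (Y : Set (Vec dy)) {γ : ℝ}
    (hγ : 0 < γ) (η₁ η₂ : ℝ) (T K : ℕ) (y₀ : Vec dy) (μ₀ : Vec dc) :
    maxMin (saddleFn (fun y => γ * h y) c) Y (η₁ / γ) (η₂ * γ) T K y₀ μ₀
      = ((maxMin (saddleFn h c) Y η₁ η₂ T K y₀ (γ⁻¹ • μ₀)).1,
        γ • (maxMin (saddleFn h c) Y η₁ η₂ T K y₀ (γ⁻¹ • μ₀)).2) := by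
  have hγ' : γ ≠ 0 := hγ.ne'
  have key : ∀ t, maxMinIter (saddleFn (fun y => γ * h y) c) Y (η₁ / γ) (η₂ * γ) K y₀ μ₀ t
      = ⟨γ • (maxMinIter (saddleFn h c) Y η₁ η₂ K y₀ (γ⁻¹ • μ₀) t).μprev,
        γ • (maxMinIter (saddleFn h c) Y η₁ η₂ K y₀ (γ⁻¹ • μ₀) t).μ,
        (maxMinIter (saddleFn h c) Y η₁ η₂ K y₀ (γ⁻¹ • μ₀) t).y⟩ := by
    intro t
    induction t with
    | zero => simp [maxMinIter, smul_smul, mul_inv_cancel₀ hγ']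
    | succ t ih =>
      rw [maxMinIter, maxMinIter, ih]
      set s := maxMinIter (saddleFn h c) Y η₁ η₂ K y₀ (γ⁻¹ • μ₀) t
      have hm : momentum t (⟨γ • s.μprev, γ • s.μ, s.y⟩ : MaxMinState dc dy)
          = γ • momentum t s := by
        simp only [momentum]
        rw [smul_add, ← smul_sub, smul_comm]
      simp only [maxMinStep, hm, pgdStep_const_mul h c Y hγ, smul_smul, inv_mul_cancel₀ hγ',
        one_smul, gradient_saddleFn_left]
      rw [← proj_orthant_smul hγ, smul_add, smul_smul, mul_comm γ η₂]
  simp only [maxMin, key]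

end Scaling

/-! ### Families of problems depending on the upper-level variable -/

section Family

variable {dx dy dc : ℕ}

/-- Problems `L(μ, y) = h(x, y) + ⟨μ, c(x, y)⟩` with regularity uniform in `x ∈ X`, and with `y`
differences that are Lipschitz in `x`. -/
structure SaddleFamily (h : Vec dx → Vec dy → ℝ) (c : Vec dx → Vec dy → Vec dc) (X : Set (Vec dx))
    (Y : Set (Vec dy)) (α l1 l0 l2 : ℝ) : Prop where
  saddle : ∀ x ∈ X, SmoothSaddle (h x) (c x) Y α l1 l0 l2
  h_mixed : ∀ x ∈ X, ∀ x' ∈ X, ∀ y ∈ Y, ∀ y' ∈ Y,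
    |h x' y' - h x' y - (h x y' - h x y)| ≤ l1 * (‖x' - x‖ * ‖y' - y‖)
  c_mixed : ∀ x ∈ X, ∀ x' ∈ X, ∀ y ∈ Y, ∀ y' ∈ Y,
    ‖c x' y' - c x' y - (c x y' - c x y)‖ ≤ l2 * (‖x' - x‖ * ‖y' - y‖)
  c_lip_x : ∀ x ∈ X, ∀ x' ∈ X, ∀ y ∈ Y, ‖c x' y - c x y‖ ≤ l0 * ‖x' - x‖

namespace SaddleFamily

variable {h : Vec dx → Vec dy → ℝ} {c : Vec dx → Vec dy → Vec dc} {X : Set (Vec dx)}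
  {Y : Set (Vec dy)} {α l1 l0 l2 : ℝ}

theorem argmin_dist_le (F : SaddleFamily h c X Y α l1 l0 l2) {x x' : Vec dx} (hx : x ∈ X)
    (hx' : x' ∈ X) {m m' : Vec dc} (hm : m ∈ orthant dc) (hm' : m' ∈ orthant dc) {y y' : Vec dy}
    (hy : IsArgmin (saddleFn (h x) (c x) m) Y y)
    (hy' : IsArgmin (saddleFn (h x') (c x') m') Y y') :
    α * ‖y' - y‖ ≤ (l1 + ‖m‖ * l2) * ‖x' - x‖ + l0 * ‖m' - m‖ := by
  have S := F.saddle x hx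
  have S' := F.saddle x' hx'
  have e1 := S.argmin_growth hm hy hy'.1
  have e2 := S'.argmin_growth hm' hy' hy.1
  have e3 := (abs_le.1 (F.h_mixed x hx x' hx' y hy.1 y' hy'.1)).1
  have e4 : -inner ℝ m (c x' y' - c x' y - (c x y' - c x y))
      ≤ ‖m‖ * (l2 * (‖x' - x‖ * ‖y' - y‖)) := by
    rw [← inner_neg_left]
    refine (real_inner_le_norm _ _).trans ?_
    rw [norm_neg]
    exact mul_le_mul_of_nonneg_left (F.c_mixed x hx x' hx' y hy.1 y' hy'.1) (norm_nonneg _)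
  have e5 := S'.inner_c_sub_le (le_refl ‖m' - m‖) hy'.1 hy.1
  rw [norm_sub_rev y y'] at e2 e5
  simp only [inner_sub_right, inner_sub_left] at e4 e5
  simp only [saddleFn] at e1 e2
  rcases (norm_nonneg (y' - y)).eq_or_lt with h0 | h0
  · rw [← h0, mul_zero]
    have := S.l0_nonneg
    have := S.l1_nonneg
    have := S.l2_nonneg
    positivity
  · refine le_of_mul_le_mul_right ?_ h0
    linarith

/-- The multiplier is Lipschitz in `x` at scales where the restricted secant inequality can be
used. -/
theorem multiplier_local_lipschitz (F : SaddleFamily h c X Y α l1 l0 l2) {μs : Vec dx → Vec dc}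
    {ys : Vec dx → Vec dy} (hs : ∀ x ∈ X, SaddleSol (h x) (c x) Y (μs x) (ys x)) {B C δ : ℝ}
    (hB : ∀ x ∈ X, ‖μs x‖ ≤ B) (hC : 0 < C) (hδ : 0 < δ)
    (hR : ∀ x ∈ X, ArgminRSI (h x) (c x) Y (μs x) (ys x) C δ) {x x' : Vec dx} (hx : x ∈ X)
    (hx' : x' ∈ X) (hsmall : l0 * (1 + (l1 + B * l2) / α) * ‖x' - x‖ < C * δ / 2) :
    ‖μs x' - μs x‖ ≤ 2 * (l0 * (1 + (l1 + B * l2) / α)) / C * ‖x' - x‖ := by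
  have S := F.saddle x hx
  have hα := S.α_pos
  set N := l0 * (1 + (l1 + B * l2) / α) with hN
  obtain ⟨ym, hym⟩ := S.exists_argmin (hs x' hx').nonneg
  have h1 := (hs x hx).opt _ (hs x' hx').nonneg
  have h2 := (hs x' hx').opt _ (hs x hx).nonneg
  have h3 : ‖ys x' - ym‖ ≤ (l1 + B * l2) / α * ‖x' - x‖ := by
    have e := F.argmin_dist_le hx hx' (hs x' hx').nonneg (hs x' hx').nonneg hym (hs x' hx').argmin
    rw [sub_self, norm_zero, mul_zero, add_zero] at e
    have e' : (l1 + ‖μs x'‖ * l2) * ‖x' - x‖ ≤ (l1 + B * l2) * ‖x' - x‖ := by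
      have := S.l2_nonneg
      have := hB x' hx'
      gcongr
    rw [div_mul_eq_mul_div, le_div_iff₀ hα]
    linarith
  have h4 : ‖c x' (ys x') - c x ym‖ ≤ N * ‖x' - x‖ := by
    have e1 := F.c_lip_x x hx x' hx' (ys x') (hs x' hx').argmin.1
    have e2 := S.c_lip ym hym.1 (ys x') (hs x' hx').argmin.1
    have e3 := norm_sub_le_norm_sub_add_norm_sub (c x' (ys x')) (c x (ys x')) (c x ym)
    have e4 := mul_le_mul_of_nonneg_left h3 S.l0_nonneg
    have e5 : N * ‖x' - x‖ = l0 * ‖x' - x‖ + l0 * ((l1 + B * l2) / α * ‖x' - x‖) := by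
      rw [hN]; ring
    linarith
  set Δ := μs x' - μs x with hΔ
  have h5 : inner ℝ (c x (ys x) - c x ym) Δ ≤ N * ‖x' - x‖ * ‖Δ‖ := by
    have e1 : inner ℝ (c x' (ys x') - c x ym) Δ ≤ N * ‖x' - x‖ * ‖Δ‖ :=
      (real_inner_le_norm _ _).trans (mul_le_mul_of_nonneg_right h4 (norm_nonneg _))
    have e2 : μs x - μs x' = -Δ := by rw [hΔ]; abel
    rw [e2, inner_neg_right] at h2
    rw [inner_sub_left] at e1 ⊢
    linarith
  have h6 : ∀ s : ℝ, 0 < s → s < 1 → s * ‖Δ‖ < δ → C * s * ‖Δ‖ ^ 2 ≤ N * ‖x' - x‖ * ‖Δ‖ := by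
    intro s hs0 hs1 hsδ
    have hm : μs x + s • Δ ∈ orthant dc :=
      convex_orthant.line_mem (hs x hx).nonneg (hs x' hx').nonneg hs0.le hs1.le
    obtain ⟨y, hy⟩ := S.exists_argmin hm
    have e1 := hR x hx _ hm (by rwa [add_sub_cancel_left, norm_smul, Real.norm_of_nonneg hs0.le])
      y hy
    rw [add_sub_cancel_left, norm_smul, Real.norm_of_nonneg hs0.le, real_inner_smul_right] at e1
    have e2 := inner_argmin_mono hym hy
    have e3 : μs x' - (μs x + s • Δ) = (1 - s) • Δ := by rw [sub_smul, one_smul, hΔ]; abel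
    rw [e3, real_inner_smul_right] at e2
    have e4 : 0 ≤ inner ℝ (c x y - c x ym) Δ := nonneg_of_mul_nonneg_right e2 (by linarith)
    have e5 : C * s * ‖Δ‖ ^ 2 ≤ inner ℝ (c x (ys x) - c x y) Δ := by
      refine le_of_mul_le_mul_left ?_ hs0
      linarith
    rw [inner_sub_left] at e4 e5 h5
    linarith
  rcases lt_or_ge ‖Δ‖ (2 * δ) with hlt | hge
  · have e1 := h6 (1 / 2) (by norm_num) (by norm_num) (by linarith)
    rcases (norm_nonneg Δ).eq_or_lt with h0 | h0
    · rw [← h0]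
      have := S.l0_nonneg
      have := S.l1_nonneg
      have := S.l2_nonneg
      have : 0 ≤ B := (norm_nonneg _).trans (hB x hx)
      positivity
    · have e2 : C * (1 / 2) * ‖Δ‖ ≤ N * ‖x' - x‖ := by
        refine le_of_mul_le_mul_right ?_ h0
        linarith
      rw [div_mul_eq_mul_div, le_div_iff₀ hC]
      linarith
  · exfalso
    have hpos : 0 < ‖Δ‖ := by linarith
    have e0 : δ / (2 * ‖Δ‖) * ‖Δ‖ = δ / 2 := by field_simp
    have e1 := h6 (δ / (2 * ‖Δ‖)) (by positivity)
      (by rw [div_lt_one (by positivity)]; linarith) (by linarith)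
    have e2 : C * (δ / (2 * ‖Δ‖)) * ‖Δ‖ ^ 2 = C * δ / 2 * ‖Δ‖ := by field_simp
    rw [e2] at e1
    linarith [le_of_mul_le_mul_right e1 hpos]

end SaddleFamily

/-- On a convex set, Lipschitz continuity at small scales implies Lipschitz continuity. -/
theorem norm_sub_le_of_local_lipschitz {E G : Type*} [NormedAddCommGroup E] [NormedSpace ℝ E]
    [NormedAddCommGroup G] {X : Set E} (hX : Convex ℝ X) {φ : E → G} {r L : ℝ} (hr : 0 < r)
    (hloc : ∀ x ∈ X, ∀ x' ∈ X, ‖x' - x‖ < r → ‖φ x' - φ x‖ ≤ L * ‖x' - x‖) {x x' : E} (hx : x ∈ X)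
    (hx' : x' ∈ X) : ‖φ x' - φ x‖ ≤ L * ‖x' - x‖ := by
  obtain ⟨n, hn⟩ := exists_nat_gt (‖x' - x‖ / r)
  have hn0 : (0 : ℝ) < n := (div_nonneg (norm_nonneg _) hr.le).trans_lt hn
  set p : ℕ → E := fun k => x + ((k : ℝ) / n) • (x' - x) with hp
  have hpX : ∀ k ≤ n, p k ∈ X := fun k hk =>
    hX.line_mem hx hx' (by positivity) (div_le_one_of_le₀ (by exact_mod_cast hk) hn0.le)
  have hstep : ∀ k, ‖p (k + 1) - p k‖ = ‖x' - x‖ / n := by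
    intro k
    have : p (k + 1) - p k = ((1 : ℝ) / n) • (x' - x) := by
      simp only [hp]
      rw [add_sub_add_left_eq_sub, ← sub_smul]
      congr 1
      push_cast
      ring
    rw [this, norm_smul, Real.norm_of_nonneg (by positivity)]
    ring
  have hk : ∀ k ≤ n, ‖φ (p k) - φ x‖ ≤ k * (L * (‖x' - x‖ / n)) := by
    intro k hk
    induction k with
    | zero => simp [hp]
    | succ k ih =>
      have h1 := hloc _ (hpX k (by omega)) _ (hpX (k + 1) hk) (by
        rw [hstep, div_lt_iff₀ hn0]
        rw [div_lt_iff₀ hr] at hn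
        linarith)
      rw [hstep] at h1
      have h2 := norm_sub_le_norm_sub_add_norm_sub (φ (p (k + 1))) (φ (p k)) (φ x)
      have h3 := ih (by omega)
      push_cast
      linarith
  have h1 := hk n le_rfl
  have h2 : p n = x' := by simp [hp, div_self hn0.ne']
  rw [h2] at h1
  calc _ ≤ _ := h1
    _ = _ := by field_simp

theorem SaddleFamily.multiplier_lipschitz {h : Vec dx → Vec dy → ℝ} {c : Vec dx → Vec dy → Vec dc}
    {X : Set (Vec dx)} {Y : Set (Vec dy)} {α l1 l0 l2 : ℝ} (F : SaddleFamily h c X Y α l1 l0 l2)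
    (hX : Convex ℝ X) {μs : Vec dx → Vec dc}
    {ys : Vec dx → Vec dy} (hs : ∀ x ∈ X, SaddleSol (h x) (c x) Y (μs x) (ys x)) {B C δ : ℝ}
    (hB : ∀ x ∈ X, ‖μs x‖ ≤ B) (hC : 0 < C) (hδ : 0 < δ)
    (hR : ∀ x ∈ X, ArgminRSI (h x) (c x) Y (μs x) (ys x) C δ) {x x' : Vec dx} (hx : x ∈ X)
    (hx' : x' ∈ X) :
    ‖μs x' - μs x‖ ≤ 2 * (l0 * (1 + (l1 + B * l2) / α)) / C * ‖x' - x‖ := by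
  have S := F.saddle x hx
  have hN : 0 ≤ l0 * (1 + (l1 + B * l2) / α) := by
    have := S.l0_nonneg
    have := S.l1_nonneg
    have := S.l2_nonneg
    have := S.α_pos
    have : 0 ≤ B := (norm_nonneg _).trans (hB x hx)
    positivity
  set N := l0 * (1 + (l1 + B * l2) / α)
  refine norm_sub_le_of_local_lipschitz hX (r := C * δ / 2 / (N + 1)) (by positivity)
    (fun x hx x' hx' hlt => ?_) hx hx'
  refine F.multiplier_local_lipschitz hs hB hC hδ hR hx hx' ?_
  rw [lt_div_iff₀ (by positivity)] at hlt
  have : N * ‖x' - x‖ ≤ ‖x' - x‖ * (N + 1) := by linarith [norm_nonneg (x' - x)]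
  linarith

end Family

/-! ### Partial derivatives of jointly smooth functions -/

section Joint

variable {dx dy : ℕ} {G : Type*} [NormedAddCommGroup G] [NormedSpace ℝ G]

/-- The inclusion `u ↦ (u, 0)` into the Euclidean product. -/
noncomputable def inlL (dx dy : ℕ) : Vec dx →L[ℝ] WithLp 2 (Vec dx × Vec dy) :=
  (WithLp.prodContinuousLinearEquiv 2 ℝ (Vec dx) (Vec dy)).symm.toContinuousLinearMap ∘L
    ContinuousLinearMap.inl ℝ (Vec dx) (Vec dy)

/-- The inclusion `u ↦ (0, u)` into the Euclidean product. -/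
noncomputable def inrL (dx dy : ℕ) : Vec dy →L[ℝ] WithLp 2 (Vec dx × Vec dy) :=
  (WithLp.prodContinuousLinearEquiv 2 ℝ (Vec dx) (Vec dy)).symm.toContinuousLinearMap ∘L
    ContinuousLinearMap.inr ℝ (Vec dx) (Vec dy)

theorem inlL_apply (u : Vec dx) : inlL dx dy u = WithLp.toLp 2 (u, 0) := rfl

theorem inrL_apply (u : Vec dy) : inrL dx dy u = WithLp.toLp 2 (0, u) := rfl

theorem norm_inlL_apply (u : Vec dx) : ‖inlL dx dy u‖ = ‖u‖ := by
  rw [inlL_apply, WithLp.prod_norm_eq_of_L2]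
  simp

theorem norm_inrL_apply (u : Vec dy) : ‖inrL dx dy u‖ = ‖u‖ := by
  rw [inrL_apply, WithLp.prod_norm_eq_of_L2]
  simp

theorem norm_comp_inlL_le (A : WithLp 2 (Vec dx × Vec dy) →L[ℝ] G) : ‖A ∘L inlL dx dy‖ ≤ ‖A‖ :=
  ContinuousLinearMap.opNorm_le_bound _ (norm_nonneg _) fun u => by
    simpa [norm_inlL_apply] using A.le_opNorm (inlL dx dy u)

theorem norm_comp_inrL_le (A : WithLp 2 (Vec dx × Vec dy) →L[ℝ] G) : ‖A ∘L inrL dx dy‖ ≤ ‖A‖ :=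
  ContinuousLinearMap.opNorm_le_bound _ (norm_nonneg _) fun u => by
    simpa [norm_inrL_apply] using A.le_opNorm (inrL dx dy u)

theorem toLp_eq_left (x x₀ : Vec dx) (y : Vec dy) :
    WithLp.toLp 2 (x, y) = WithLp.toLp 2 (x₀, y) + inlL dx dy (x - x₀) := by
  rw [inlL_apply, ← WithLp.toLp_add]; simp

theorem toLp_eq_right (x : Vec dx) (y y₀ : Vec dy) :
    WithLp.toLp 2 (x, y) = WithLp.toLp 2 (x, y₀) + inrL dx dy (y - y₀) := by
  rw [inrL_apply, ← WithLp.toLp_add]; simp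

theorem norm_toLp_sub_left (x x₀ : Vec dx) (y : Vec dy) :
    ‖(WithLp.toLp 2 (x, y) : WithLp 2 (Vec dx × Vec dy)) - WithLp.toLp 2 (x₀, y)‖ = ‖x - x₀‖ := by
  rw [toLp_eq_left x x₀, add_sub_cancel_left, norm_inlL_apply]

theorem norm_toLp_sub_right (x : Vec dx) (y y₀ : Vec dy) :
    ‖(WithLp.toLp 2 (x, y) : WithLp 2 (Vec dx × Vec dy)) - WithLp.toLp 2 (x, y₀)‖ = ‖y - y₀‖ := by
  rw [toLp_eq_right x y y₀, add_sub_cancel_left, norm_inrL_apply]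

/-- `Φ` is differentiable at the points of `X × Y`, with derivative `l`-Lipschitz there. -/
structure JointSmooth (Φ : WithLp 2 (Vec dx × Vec dy) → G) (X : Set (Vec dx)) (Y : Set (Vec dy))
    (l : ℝ) : Prop where
  l_nonneg : 0 ≤ l
  diff : ∀ x ∈ X, ∀ y ∈ Y, DifferentiableAt ℝ Φ (WithLp.toLp 2 (x, y))
  lip : ∀ x ∈ X, ∀ y ∈ Y, ∀ x' ∈ X, ∀ y' ∈ Y,
    ‖fderiv ℝ Φ (WithLp.toLp 2 (x', y')) - fderiv ℝ Φ (WithLp.toLp 2 (x, y))‖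
      ≤ l * ‖(WithLp.toLp 2 (x', y') : WithLp 2 (Vec dx × Vec dy)) - WithLp.toLp 2 (x, y)‖

theorem hasFDerivAt_left {Φ : WithLp 2 (Vec dx × Vec dy) → G} {x : Vec dx} {y : Vec dy}
    (h : DifferentiableAt ℝ Φ (WithLp.toLp 2 (x, y))) :
    HasFDerivAt (fun x' => Φ (WithLp.toLp 2 (x', y)))
      (fderiv ℝ Φ (WithLp.toLp 2 (x, y)) ∘L inlL dx dy) x := by
  have h1 : HasFDerivAt (fun x' : Vec dx => (WithLp.toLp 2 (x', y) : WithLp 2 (Vec dx × Vec dy)))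
      (inlL dx dy) x := by
    have := ((inlL dx dy).hasFDerivAt (x := x)).add_const (WithLp.toLp 2 ((0 : Vec dx), y))
    refine this.congr_of_eventuallyEq (Filter.Eventually.of_forall fun x' => ?_)
    simp only [inlL_apply]
    rw [← WithLp.toLp_add]; simp
  exact h.hasFDerivAt.comp x h1

theorem hasFDerivAt_right {Φ : WithLp 2 (Vec dx × Vec dy) → G} {x : Vec dx} {y : Vec dy}
    (h : DifferentiableAt ℝ Φ (WithLp.toLp 2 (x, y))) :
    HasFDerivAt (fun y' => Φ (WithLp.toLp 2 (x, y')))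
      (fderiv ℝ Φ (WithLp.toLp 2 (x, y)) ∘L inrL dx dy) y := by
  have h1 : HasFDerivAt (fun y' : Vec dy => (WithLp.toLp 2 (x, y') : WithLp 2 (Vec dx × Vec dy)))
      (inrL dx dy) y := by
    have := ((inrL dx dy).hasFDerivAt (x := y)).add_const (WithLp.toLp 2 (x, (0 : Vec dy)))
    refine this.congr_of_eventuallyEq (Filter.Eventually.of_forall fun y' => ?_)
    simp only [inrL_apply]
    rw [← WithLp.toLp_add]; simp
  exact h.hasFDerivAt.comp y h1

namespace JointSmooth

variable {X : Set (Vec dx)} {Y : Set (Vec dy)} {l : ℝ} {Φ : WithLp 2 (Vec dx × Vec dy) → G}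

theorem diff_left (J : JointSmooth Φ X Y l) {x : Vec dx} {y : Vec dy} (hx : x ∈ X) (hy : y ∈ Y) :
    DifferentiableAt ℝ (fun x' => Φ (WithLp.toLp 2 (x', y))) x :=
  (hasFDerivAt_left (J.diff x hx y hy)).differentiableAt

theorem diff_right (J : JointSmooth Φ X Y l) {x : Vec dx} {y : Vec dy} (hx : x ∈ X) (hy : y ∈ Y) :
    DifferentiableAt ℝ (fun y' => Φ (WithLp.toLp 2 (x, y'))) y :=
  (hasFDerivAt_right (J.diff x hx y hy)).differentiableAt

theorem lip_left (J : JointSmooth Φ X Y l) {x x' : Vec dx} {y y' : Vec dy} (hx : x ∈ X)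
    (hx' : x' ∈ X) (hy : y ∈ Y) (hy' : y' ∈ Y) :
    ‖fderiv ℝ (fun u => Φ (WithLp.toLp 2 (u, y'))) x'
        - fderiv ℝ (fun u => Φ (WithLp.toLp 2 (u, y))) x‖
      ≤ l * ‖(WithLp.toLp 2 (x', y') : WithLp 2 (Vec dx × Vec dy)) - WithLp.toLp 2 (x, y)‖ := by
  rw [(hasFDerivAt_left (J.diff x' hx' y' hy')).fderiv, (hasFDerivAt_left (J.diff x hx y hy)).fderiv,
    ← ContinuousLinearMap.sub_comp]
  exact (norm_comp_inlL_le _).trans (J.lip x hx y hy x' hx' y' hy')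

theorem lip_right (J : JointSmooth Φ X Y l) {x x' : Vec dx} {y y' : Vec dy} (hx : x ∈ X)
    (hx' : x' ∈ X) (hy : y ∈ Y) (hy' : y' ∈ Y) :
    ‖fderiv ℝ (fun u => Φ (WithLp.toLp 2 (x', u))) y'
        - fderiv ℝ (fun u => Φ (WithLp.toLp 2 (x, u))) y‖
      ≤ l * ‖(WithLp.toLp 2 (x', y') : WithLp 2 (Vec dx × Vec dy)) - WithLp.toLp 2 (x, y)‖ := by
  rw [(hasFDerivAt_right (J.diff x' hx' y' hy')).fderiv,
    (hasFDerivAt_right (J.diff x hx y hy)).fderiv, ← ContinuousLinearMap.sub_comp]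
  exact (norm_comp_inrL_le _).trans (J.lip x hx y hy x' hx' y' hy')

theorem taylor_left (J : JointSmooth Φ X Y l) (hX : Convex ℝ X) {x x' : Vec dx} {y : Vec dy}
    (hx : x ∈ X) (hx' : x' ∈ X) (hy : y ∈ Y) :
    ‖Φ (WithLp.toLp 2 (x', y)) - Φ (WithLp.toLp 2 (x, y))
        - fderiv ℝ (fun u => Φ (WithLp.toLp 2 (u, y))) x (x' - x)‖ ≤ l * ‖x' - x‖ ^ 2 :=
  norm_sub_sub_fderiv_le (φ := fun u => Φ (WithLp.toLp 2 (u, y))) hX J.l_nonneg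
    (fun _ hu => J.diff_left hu hy)
    (fun u hu u' hu' => by simpa [norm_toLp_sub_left] using J.lip_left hu hu' hy hy) hx hx'

theorem taylor_right (J : JointSmooth Φ X Y l) (hY : Convex ℝ Y) {x : Vec dx} {y y' : Vec dy}
    (hx : x ∈ X) (hy : y ∈ Y) (hy' : y' ∈ Y) :
    ‖Φ (WithLp.toLp 2 (x, y')) - Φ (WithLp.toLp 2 (x, y))
        - fderiv ℝ (fun u => Φ (WithLp.toLp 2 (x, u))) y (y' - y)‖ ≤ l * ‖y' - y‖ ^ 2 :=
  norm_sub_sub_fderiv_le (φ := fun u => Φ (WithLp.toLp 2 (x, u))) hY J.l_nonneg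
    (fun _ hu => J.diff_right hx hu)
    (fun u hu u' hu' => by simpa [norm_toLp_sub_right] using J.lip_right hx hx hu hu') hy hy'

theorem mixed (J : JointSmooth Φ X Y l) (hY : Convex ℝ Y) {x x' : Vec dx} {y y' : Vec dy}
    (hx : x ∈ X) (hx' : x' ∈ X) (hy : y ∈ Y) (hy' : y' ∈ Y) :
    ‖Φ (WithLp.toLp 2 (x', y')) - Φ (WithLp.toLp 2 (x', y))
        - (Φ (WithLp.toLp 2 (x, y')) - Φ (WithLp.toLp 2 (x, y)))‖ ≤ l * (‖x' - x‖ * ‖y' - y‖) := by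
  have h := hY.norm_image_sub_le_of_norm_hasFDerivWithin_le
    (f := fun u => Φ (WithLp.toLp 2 (x', u)) - Φ (WithLp.toLp 2 (x, u))) (C := l * ‖x' - x‖)
    (fun u hu => ((J.diff_right hx' hu).hasFDerivAt.sub
      (J.diff_right hx hu).hasFDerivAt).hasFDerivWithinAt)
    (fun u hu => by simpa [norm_toLp_sub_left] using J.lip_right hx hx' hu hu) hy hy'
  rw [sub_sub_sub_comm, ← mul_assoc]
  exact h

end JointSmooth

end Joint

/-! ### The lower-level and the penalized problem as families -/

namespace BLOData

variable {dx dy dc : ℕ} {P : BLOData dx dy dc} {lf0 lf1 lg1 lgx0 lgc0 lgc1 : ℝ≥0} {αg : ℝ}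

theorem LipschitzAss.jointSmooth_f (hL : P.LipschitzAss lf0 lf1 lg1 lgx0 lgc0 lgc1) :
    JointSmooth P.fJ P.X P.Y lf1 where
  l_nonneg := lf1.2
  diff := fun _ hx _ hy => hL.diff_f _ ⟨hx, hy⟩
  lip := fun x hx y hy x' hx' y' hy' => by
    rw [← norm_gradient_sub]
    exact hL.lip_grad_f.norm_sub_le (x := WithLp.toLp 2 (x', y')) (y := WithLp.toLp 2 (x, y))
      ⟨hx', hy'⟩ ⟨hx, hy⟩

theorem LipschitzAss.jointSmooth_g (hL : P.LipschitzAss lf0 lf1 lg1 lgx0 lgc0 lgc1) :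
    JointSmooth P.gJ P.X P.Y lg1 where
  l_nonneg := lg1.2
  diff := fun _ hx _ hy => hL.diff_g _ ⟨hx, hy⟩
  lip := fun x hx y hy x' hx' y' hy' => by
    rw [← norm_gradient_sub]
    exact hL.lip_grad_g.norm_sub_le (x := WithLp.toLp 2 (x', y')) (y := WithLp.toLp 2 (x, y))
      ⟨hx', hy'⟩ ⟨hx, hy⟩

theorem LipschitzAss.jointSmooth_gc (hL : P.LipschitzAss lf0 lf1 lg1 lgx0 lgc0 lgc1) :
    JointSmooth P.gcJ P.X P.Y lgc1 where
  l_nonneg := lgc1.2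
  diff := fun _ hx _ hy => hL.diff_gc _ ⟨hx, hy⟩
  lip := fun x hx y hy x' hx' y' hy' =>
    hL.lip_grad_gc.norm_sub_le (x := WithLp.toLp 2 (x', y')) (y := WithLp.toLp 2 (x, y))
      ⟨hx', hy'⟩ ⟨hx, hy⟩

theorem LipschitzAss.f_left (hL : P.LipschitzAss lf0 lf1 lg1 lgx0 lgc0 lgc1) {x x' : Vec dx}
    {y : Vec dy} (hx : x ∈ P.X) (hx' : x' ∈ P.X) (hy : y ∈ P.Y) :
    |P.f x' y - P.f x y| ≤ lf0 * ‖x' - x‖ := by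
  have := hL.lip_f.norm_sub_le (x := WithLp.toLp 2 (x', y)) (y := WithLp.toLp 2 (x, y))
      ⟨hx', hy⟩ ⟨hx, hy⟩
  rwa [norm_toLp_sub_left] at this

theorem LipschitzAss.f_right (hL : P.LipschitzAss lf0 lf1 lg1 lgx0 lgc0 lgc1) {x : Vec dx}
    {y y' : Vec dy} (hx : x ∈ P.X) (hy : y ∈ P.Y) (hy' : y' ∈ P.Y) :
    |P.f x y' - P.f x y| ≤ lf0 * ‖y' - y‖ := by
  have := hL.lip_f.norm_sub_le (x := WithLp.toLp 2 (x, y')) (y := WithLp.toLp 2 (x, y))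
      ⟨hx, hy'⟩ ⟨hx, hy⟩
  rwa [norm_toLp_sub_right] at this

theorem LipschitzAss.gc_left (hL : P.LipschitzAss lf0 lf1 lg1 lgx0 lgc0 lgc1) {x x' : Vec dx}
    {y : Vec dy} (hx : x ∈ P.X) (hx' : x' ∈ P.X) (hy : y ∈ P.Y) :
    ‖P.gc x' y - P.gc x y‖ ≤ lgc0 * ‖x' - x‖ := by
  have := hL.lip_gc.norm_sub_le (x := WithLp.toLp 2 (x', y)) (y := WithLp.toLp 2 (x, y))
      ⟨hx', hy⟩ ⟨hx, hy⟩
  rwa [norm_toLp_sub_left] at this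

theorem LipschitzAss.gc_right (hL : P.LipschitzAss lf0 lf1 lg1 lgx0 lgc0 lgc1) {x : Vec dx}
    {y y' : Vec dy} (hx : x ∈ P.X) (hy : y ∈ P.Y) (hy' : y' ∈ P.Y) :
    ‖P.gc x y' - P.gc x y‖ ≤ lgc0 * ‖y' - y‖ := by
  have := hL.lip_gc.norm_sub_le (x := WithLp.toLp 2 (x, y')) (y := WithLp.toLp 2 (x, y))
      ⟨hx, hy'⟩ ⟨hx, hy⟩
  rwa [norm_toLp_sub_right] at this

theorem gc_linearize_convex (hL : P.LipschitzAss lf0 lf1 lg1 lgx0 lgc0 lgc1)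
    (hC : P.ConvexAss αg) {x : Vec dx} (hx : x ∈ P.X) {y z : Vec dy} (hy : y ∈ P.Y) (hz : z ∈ P.Y)
    (i : Fin dc) : P.gc x y i + fderiv ℝ (P.gc x) y (z - y) i ≤ P.gc x z i := by
  have hd : DifferentiableAt ℝ (P.gc x) y := hL.jointSmooth_gc.diff_right hx hy
  have h1 : HasFDerivAt (fun u => P.gc x u i)
      ((EuclideanSpace.proj i : Vec dc →L[ℝ] ℝ) ∘L fderiv ℝ (P.gc x) y) y :=
    (EuclideanSpace.proj i : Vec dc →L[ℝ] ℝ).hasFDerivAt.comp y hd.hasFDerivAt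
  have h2 := fderiv_le_of_convexOn (hC.convex x hx i) hy hz h1.differentiableAt
  rw [h1.fderiv] at h2
  exact h2

theorem family_Lg (hαg : 0 < αg) (hL : P.LipschitzAss lf0 lf1 lg1 lgx0 lgc0 lgc1)
    (hC : P.ConvexAss αg) (hD : P.DomainAss) :
    SaddleFamily P.g P.gc P.X P.Y αg lg1 lgc0 lgc1 where
  saddle := fun x hx =>
    { α_pos := hαg
      l1_nonneg := lg1.2
      l0_nonneg := lgc0.2
      l2_nonneg := lgc1.2
      closed := hD.Y_closed
      conv := hD.Y_convex
      nonempty := hD.Y_nonempty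
      diff_h := fun y hy => hL.jointSmooth_g.diff_right hx hy
      diff_c := fun y hy => hL.jointSmooth_gc.diff_right hx hy
      strong := fun y hy z hz =>
        fderiv_le_of_strongConvexOn (hC.strong x hx) hy hz (hL.jointSmooth_g.diff_right hx hy)
      smooth := fun y hy z hz => by
        have : |P.g x z - P.g x y - fderiv ℝ (P.g x) y (z - y)| ≤ lg1 * ‖z - y‖ ^ 2 :=
          hL.jointSmooth_g.taylor_right hD.Y_convex hx hy hz
        linarith [(abs_le.1 this).2]
      c_convex := fun y hy z hz i => gc_linearize_convex hL hC hx hy hz i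
      c_lip := fun y hy z hz => hL.gc_right hx hy hz
      c_smooth := fun y hy z hz => hL.jointSmooth_gc.taylor_right hD.Y_convex hx hy hz }
  h_mixed := fun x hx x' hx' y hy y' hy' =>
    hL.jointSmooth_g.mixed hD.Y_convex hx hx' hy hy'
  c_mixed := fun x hx x' hx' y hy y' hy' =>
    hL.jointSmooth_gc.mixed hD.Y_convex hx hx' hy hy'
  c_lip_x := fun x hx x' hx' y hy => hL.gc_left hx hx' hy

/-- The objective `f/γ + (g - v)` of the penalized problem, divided by the penalty constant. In
this scaling the regularity constants do not deteriorate as `γ → ∞`. -/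
noncomputable def penalized (P : BLOData dx dy dc) (γ : ℝ) (x : Vec dx) (y : Vec dy) : ℝ :=
  γ⁻¹ * P.f x y + (P.g x y - P.v x)

theorem LF_eq {γ : ℝ} (hγ : 0 < γ) (x : Vec dx) :
    P.LF γ x = saddleFn (fun y => γ * P.penalized γ x y) (P.gc x) := by
  funext μ y
  simp only [LF, saddleFn, penalized]
  field_simp

theorem family_LF (hL : P.LipschitzAss lf0 lf1 lg1 lgx0 lgc0 lgc1)
    (hC : P.ConvexAss αg) (hD : P.DomainAss) {γ₁ γ : ℝ} (hγ₁ : 0 < γ₁) (hγ : γ₁ ≤ γ)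
    (hα : (lf1 : ℝ) / γ₁ < αg) :
    SaddleFamily (P.penalized γ) P.gc P.X P.Y (αg - lf1 / γ₁) (lf1 / γ₁ + lg1) lgc0 lgc1 := by
  have hγ0 : 0 < γ := hγ₁.trans_le hγ
  have hi0 : 0 ≤ γ⁻¹ := (inv_pos.2 hγ0).le
  have hinv : γ⁻¹ * lf1 ≤ lf1 / γ₁ := by
    rw [inv_mul_eq_div]
    exact div_le_div_of_nonneg_left lf1.2 hγ₁ hγ
  have hdf : ∀ x ∈ P.X, ∀ y ∈ P.Y, DifferentiableAt ℝ (P.f x) y := fun x hx y hy =>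
    hL.jointSmooth_f.diff_right hx hy
  have hdg : ∀ x ∈ P.X, ∀ y ∈ P.Y, DifferentiableAt ℝ (P.g x) y := fun x hx y hy =>
    hL.jointSmooth_g.diff_right hx hy
  have hfd : ∀ x ∈ P.X, ∀ y ∈ P.Y, ∀ d, fderiv ℝ (P.penalized γ x) y d
      = γ⁻¹ * fderiv ℝ (P.f x) y d + fderiv ℝ (P.g x) y d := by
    intro x hx y hy d
    have h1 : HasFDerivAt (P.penalized γ x) (γ⁻¹ • fderiv ℝ (P.f x) y + fderiv ℝ (P.g x) y) y :=
      ((hdf x hx y hy).hasFDerivAt.const_mul γ⁻¹).add ((hdg x hx y hy).hasFDerivAt.sub_const _)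
    rw [h1.fderiv]
    simp
  exact
  { saddle := fun x hx =>
      { α_pos := sub_pos.2 hα
        l1_nonneg := add_nonneg (div_nonneg lf1.2 hγ₁.le) lg1.2
        l0_nonneg := lgc0.2
        l2_nonneg := lgc1.2
        closed := hD.Y_closed
        conv := hD.Y_convex
        nonempty := hD.Y_nonempty
        diff_h := fun y hy =>
          ((hdf x hx y hy).const_mul γ⁻¹).add ((hdg x hx y hy).sub_const _)
        diff_c := fun y hy => hL.jointSmooth_gc.diff_right hx hy
        strong := fun y hy z hz => by
          have h1 := fderiv_le_of_strongConvexOn (hC.strong x hx) hy hz (hdg x hx y hy)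
          have h2 := le_of_lipschitz_fderiv (φ := P.f x) hD.Y_convex (l := lf1) (hdf x hx)
            (fun u hu u' hu' => by
              have := hL.jointSmooth_f.lip_right hx hx hu hu'
              rwa [norm_toLp_sub_right] at this) hy hz
          have h3 := mul_le_mul_of_nonneg_left h2 hi0
          have h4 := mul_le_mul_of_nonneg_right hinv (sq_nonneg ‖z - y‖)
          rw [hfd x hx y hy]
          simp only [penalized]
          linarith
        smooth := fun y hy z hz => by
          have h1 : |P.g x z - P.g x y - fderiv ℝ (P.g x) y (z - y)| ≤ lg1 * ‖z - y‖ ^ 2 :=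
            hL.jointSmooth_g.taylor_right hD.Y_convex hx hy hz
          have h2 : |P.f x z - P.f x y - fderiv ℝ (P.f x) y (z - y)| ≤ lf1 * ‖z - y‖ ^ 2 :=
            hL.jointSmooth_f.taylor_right hD.Y_convex hx hy hz
          have h3 := mul_le_mul_of_nonneg_left (abs_le.1 h2).2 hi0
          have h4 := mul_le_mul_of_nonneg_right hinv (sq_nonneg ‖z - y‖)
          rw [hfd x hx y hy]
          simp only [penalized]
          linarith [(abs_le.1 h1).2]
        c_convex := fun y hy z hz i => gc_linearize_convex hL hC hx hy hz i
        c_lip := fun y hy z hz => hL.gc_right hx hy hz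
        c_smooth := fun y hy z hz => hL.jointSmooth_gc.taylor_right hD.Y_convex hx hy hz }
    h_mixed := fun x hx x' hx' y hy y' hy' => by
      have h1 : |P.g x' y' - P.g x' y - (P.g x y' - P.g x y)| ≤ lg1 * (‖x' - x‖ * ‖y' - y‖) :=
        hL.jointSmooth_g.mixed hD.Y_convex hx hx' hy hy'
      have h2 : |P.f x' y' - P.f x' y - (P.f x y' - P.f x y)| ≤ lf1 * (‖x' - x‖ * ‖y' - y‖) :=
        hL.jointSmooth_f.mixed hD.Y_convex hx hx' hy hy'
      have h3 : 0 ≤ ‖x' - x‖ * ‖y' - y‖ := by positivity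
      have h4 := mul_le_mul_of_nonneg_left h2 hi0
      have h5 := mul_le_mul_of_nonneg_right hinv h3
      have h6 : P.penalized γ x' y' - P.penalized γ x' y - (P.penalized γ x y' - P.penalized γ x y)
          = γ⁻¹ * (P.f x' y' - P.f x' y - (P.f x y' - P.f x y))
            + (P.g x' y' - P.g x' y - (P.g x y' - P.g x y)) := by
        simp only [penalized]; ring
      rw [h6]
      refine (abs_add_le _ _).trans ?_
      rw [abs_mul, abs_of_nonneg hi0]
      linarith
    c_mixed := fun x hx x' hx' y hy y' hy' =>
      hL.jointSmooth_gc.mixed hD.Y_convex hx hx' hy hy'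
    c_lip_x := fun x hx x' hx' y hy => hL.gc_left hx hx' hy }

/-- A primal-dual solution for the lower-level problem at `x` attains `v(x)`: strong duality. -/
theorem v_eq {x : Vec dx} {μ : Vec dc} {y : Vec dy} (hs : SaddleSol (P.g x) (P.gc x) P.Y μ y) :
    y ∈ P.feas x ∧ P.v x = P.g x y ∧ ∀ z ∈ P.feas x, P.v x ≤ P.g x z := by
  have hf : y ∈ P.feas x := ⟨hs.argmin.1, hs.c_nonpos⟩
  have hmin : ∀ z ∈ P.feas x, P.g x y ≤ P.g x z := by
    intro z hz
    have h1 := hs.argmin.2 z hz.1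
    have h2 := inner_nonpos_of_orthant hs.nonneg hz.2
    simp only [saddleFn, hs.inner_c_eq_zero] at h1
    linarith
  have hv : P.v x = P.g x y :=
    IsLeast.csInf_eq ⟨⟨y, hf, rfl⟩, by rintro _ ⟨z, hz, rfl⟩; exact hmin z hz⟩
  exact ⟨hf, hv, fun z hz => hv ▸ hmin z hz⟩

end BLOData

/-! ### Smoothness of the penalized value function and inexact projected gradient steps -/

section Outer

variable {dx dy dc : ℕ}

/-- The penalized problem at penalty constant `γ ≥ γ₁` together with the lower-level problem:
solutions with bounded multipliers, those of the penalized problem rescaled by `1/γ` and Lipschitz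
in `x`. All constants are to be independent of `γ`. -/
structure PenaltySetting (P : BLOData dx dy dc) (lf0 lf1 lg1 lgx0 lgc0 lgc1 : ℝ≥0)
    (αg αF l1F γ₁ γ Bg BF Lν : ℝ) (μg : Vec dx → Vec dc) (yg : Vec dx → Vec dy)
    (ν : Vec dx → Vec dc) (yF : Vec dx → Vec dy) : Prop where
  lip : P.LipschitzAss lf0 lf1 lg1 lgx0 lgc0 lgc1
  dom : P.DomainAss
  γ₁_pos : 0 < γ₁
  γ₁_le : γ₁ ≤ γ
  famG : SaddleFamily P.g P.gc P.X P.Y αg lg1 lgc0 lgc1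
  famF : SaddleFamily (P.penalized γ) P.gc P.X P.Y αF l1F lgc0 lgc1
  solG : ∀ x ∈ P.X, SaddleSol (P.g x) (P.gc x) P.Y (μg x) (yg x)
  solF : ∀ x ∈ P.X, SaddleSol (P.penalized γ x) (P.gc x) P.Y (ν x) (yF x)
  bddG : ∀ x ∈ P.X, ‖μg x‖ ≤ Bg
  bddF : ∀ x ∈ P.X, ‖ν x‖ ≤ BF
  lip_ν : ∀ x ∈ P.X, ∀ x' ∈ P.X, ‖ν x' - ν x‖ ≤ Lν * ‖x' - x‖

/-- Quadratic constant in the lower bound for `v`. -/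
noncomputable def valueConst (lg1 lgc1 : ℝ≥0) (αg Bg : ℝ) : ℝ :=
  (lg1 + Bg * lgc1) + (lg1 + Bg * lgc1) * ((lg1 + Bg * lgc1) / αg)

/-- Quadratic constant in the upper bound for the penalized value function, divided by `γ`. -/
noncomputable def smoothConst (lf1 lg1 lgc0 lgc1 : ℝ≥0) (αg γ₁ Bg BF Lν : ℝ) : ℝ :=
  lf1 / γ₁ + lg1 + valueConst lg1 lgc1 αg Bg + Lν * lgc0 + BF * lgc1

/-- Bound for the slopes of the gradient estimates along `X`, divided by `γ`. -/
noncomputable def slopeConst (lf0 lgx0 lgc0 : ℝ≥0) (γ₁ Bg BF : ℝ) : ℝ :=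
  lf0 / γ₁ + 2 * lgx0 + (Bg + 1) * lgc0 + (BF + 1) * lgc0

/-- Sensitivity of the gradient estimates to errors in the subproblem solutions, divided by `γ`. -/
noncomputable def errConst (lf1 lg1 lgc0 lgc1 : ℝ≥0) (γ₁ Bg BF : ℝ) : ℝ :=
  lf1 / γ₁ + 2 * lg1 + 2 * lgc0 + (Bg + 1) * lgc1 + (BF + 1) * lgc1

namespace PenaltySetting

variable {P : BLOData dx dy dc} {lf0 lf1 lg1 lgx0 lgc0 lgc1 : ℝ≥0}
  {αg αF l1F γ₁ γ Bg BF Lν : ℝ} {μg : Vec dx → Vec dc} {yg : Vec dx → Vec dy}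
  {ν : Vec dx → Vec dc} {yF : Vec dx → Vec dy}

theorem γ_pos
    (H : PenaltySetting P lf0 lf1 lg1 lgx0 lgc0 lgc1 αg αF l1F γ₁ γ Bg BF Lν μg yg ν yF) : 0 < γ :=
  H.γ₁_pos.trans_le H.γ₁_le

theorem inv_mul_le
    (H : PenaltySetting P lf0 lf1 lg1 lgx0 lgc0 lgc1 αg αF l1F γ₁ γ Bg BF Lν μg yg ν yF) {a : ℝ}
    (ha : 0 ≤ a) : γ⁻¹ * a ≤ a / γ₁ := by
  rw [inv_mul_eq_div]
  exact div_le_div_of_nonneg_left ha H.γ₁_pos H.γ₁_le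

theorem inner_gradXgc (hL : P.LipschitzAss lf0 lf1 lg1 lgx0 lgc0 lgc1) {x : Vec dx} (hx : x ∈ P.X)
    {y : Vec dy} (hy : y ∈ P.Y) (μ : Vec dc) (d : Vec dx) :
    inner ℝ (P.gradXgc x μ y) d = inner ℝ μ (fderiv ℝ (fun u => P.gc u y) x d) := by
  have hd : DifferentiableAt ℝ (fun u => P.gc u y) x := hL.jointSmooth_gc.diff_left hx hy
  rw [BLOData.gradXgc, gradient_inner, fderiv_inner_apply ℝ (differentiableAt_const μ) hd]
  simp

/-- Slopes of the gradient estimates, rescaled by `1/γ`. -/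
theorem inner_estF
    (H : PenaltySetting P lf0 lf1 lg1 lgx0 lgc0 lgc1 αg αF l1F γ₁ γ Bg BF Lν μg yg ν yF)
    {x : Vec dx} (hx : x ∈ P.X) {q r : Vec dy × Vec dc} (hq : q.1 ∈ P.Y) (hr : r.1 ∈ P.Y)
    (d : Vec dx) :
    γ⁻¹ * inner ℝ (P.estF γ x q r) d
      = γ⁻¹ * fderiv ℝ (fun u => P.f u r.1) x d + fderiv ℝ (fun u => P.g u r.1) x d
        - (fderiv ℝ (fun u => P.g u q.1) x d + inner ℝ q.2 (fderiv ℝ (fun u => P.gc u q.1) x d))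
        + inner ℝ (γ⁻¹ • r.2) (fderiv ℝ (fun u => P.gc u r.1) x d) := by
  have hγ := H.γ_pos.ne'
  simp only [BLOData.estF, BLOData.estV, inner_add_left, inner_sub_left, real_inner_smul_left,
    inner_gradXgc H.lip hx hq, inner_gradXgc H.lip hx hr, BLOData.gradXf, BLOData.gradXg,
    gradient_inner]
  field_simp
  ring

theorem gc_tangent (hL : P.LipschitzAss lf0 lf1 lg1 lgx0 lgc0 lgc1) (hD : P.DomainAss)
    {x x' : Vec dx} (hx : x ∈ P.X) (hx' : x' ∈ P.X) {y : Vec dy} (hy : y ∈ P.Y) :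
    ‖fderiv ℝ (fun u => P.gc u y) x (x' - x)‖ ≤ lgc0 * ‖x' - x‖ :=
  norm_fderiv_sub_le_of_lipschitz (φ := fun u => P.gc u y) hD.X_convex
    (fun _ hu _ hu' => hL.gc_left hu hu' hy) hx hx' (hL.jointSmooth_gc.diff_left hx hy)

theorem norm_fderiv_left_sub {G : Type*} [NormedAddCommGroup G] [NormedSpace ℝ G]
    {Φ : WithLp 2 (Vec dx × Vec dy) → G} {X : Set (Vec dx)} {Y : Set (Vec dy)} {l : ℝ}
    (J : JointSmooth Φ X Y l) {x : Vec dx} (hx : x ∈ X) {y y' : Vec dy} (hy : y ∈ Y)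
    (hy' : y' ∈ Y) (d : Vec dx) :
    ‖fderiv ℝ (fun u => Φ (WithLp.toLp 2 (u, y'))) x d
      - fderiv ℝ (fun u => Φ (WithLp.toLp 2 (u, y))) x d‖ ≤ l * ‖y' - y‖ * ‖d‖ := by
  have h1 := J.lip_left hx hx hy hy'
  rw [norm_toLp_sub_right] at h1
  rw [← sub_apply]
  exact (ContinuousLinearMap.le_opNorm _ _).trans (mul_le_mul_of_nonneg_right h1 (norm_nonneg _))

theorem abs_inner_estF_le
    (H : PenaltySetting P lf0 lf1 lg1 lgx0 lgc0 lgc1 αg αF l1F γ₁ γ Bg BF Lν μg yg ν yF)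
    {x x' : Vec dx} (hx : x ∈ P.X) (hx' : x' ∈ P.X) {q r : Vec dy × Vec dc} (hq : q.1 ∈ P.Y)
    (hr : r.1 ∈ P.Y) (hqB : ‖q.2‖ ≤ Bg + 1) (hrB : ‖γ⁻¹ • r.2‖ ≤ BF + 1) :
    |γ⁻¹ * inner ℝ (P.estF γ x q r) (x' - x)|
      ≤ slopeConst lf0 lgx0 lgc0 γ₁ Bg BF * ‖x' - x‖ := by
  have hi0 : 0 ≤ γ⁻¹ := (inv_pos.2 H.γ_pos).le
  rw [H.inner_estF hx hq hr]
  have hf : |fderiv ℝ (fun u => P.f u r.1) x (x' - x)| ≤ lf0 * ‖x' - x‖ :=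
    abs_fderiv_sub_le_of_lipschitz (φ := fun u => P.f u r.1) H.dom.X_convex
      (fun _ hu _ hu' => H.lip.f_left hu hu' hr) hx hx' (H.lip.jointSmooth_f.diff_left hx hr)
  have hg : ∀ y ∈ P.Y, |fderiv ℝ (fun u => P.g u y) x (x' - x)| ≤ lgx0 * ‖x' - x‖ := fun y hy =>
    abs_fderiv_sub_le_of_lipschitz (φ := fun u => P.g u y) H.dom.X_convex
      (fun u hu u' hu' => (H.lip.lip_g_x y hy).norm_sub_le hu' hu) hx hx'
      (H.lip.jointSmooth_g.diff_left hx hy)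
  have hc : ∀ (μ : Vec dc) (B : ℝ), ‖μ‖ ≤ B → ∀ y ∈ P.Y,
      |inner ℝ μ (fderiv ℝ (fun u => P.gc u y) x (x' - x))| ≤ B * (lgc0 * ‖x' - x‖) :=
    fun μ B hμ y hy => (abs_real_inner_le_norm _ _).trans
      (mul_le_mul hμ (gc_tangent H.lip H.dom hx hx' hy) (norm_nonneg _)
        ((norm_nonneg _).trans hμ))
  have h1 : |γ⁻¹ * fderiv ℝ (fun u => P.f u r.1) x (x' - x)| ≤ lf0 / γ₁ * ‖x' - x‖ := by
    rw [abs_mul, abs_of_nonneg hi0]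
    have := mul_le_mul_of_nonneg_right (H.inv_mul_le lf0.coe_nonneg) (norm_nonneg (x' - x))
    calc _ ≤ γ⁻¹ * (lf0 * ‖x' - x‖) := mul_le_mul_of_nonneg_left hf hi0
      _ = γ⁻¹ * lf0 * ‖x' - x‖ := by ring
      _ ≤ _ := this
  have h2 := abs_le.1 (hg _ hr)
  have h3 := abs_le.1 (hg _ hq)
  have h4 := abs_le.1 (hc _ _ hqB _ hq)
  have h5 := abs_le.1 (hc _ _ hrB _ hr)
  have h1 := abs_le.1 h1
  rw [slopeConst, abs_le]
  constructor <;> linarith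

theorem abs_inner_estF_sub_le
    (H : PenaltySetting P lf0 lf1 lg1 lgx0 lgc0 lgc1 αg αF l1F γ₁ γ Bg BF Lν μg yg ν yF)
    {x x' : Vec dx} (hx : x ∈ P.X) (hx' : x' ∈ P.X) {q r q' r' : Vec dy × Vec dc}
    (hq : q.1 ∈ P.Y) (hr : r.1 ∈ P.Y) (hq' : q'.1 ∈ P.Y) (hr' : r'.1 ∈ P.Y)
    (hqB : ‖q.2‖ ≤ Bg + 1) (hrB : ‖γ⁻¹ • r.2‖ ≤ BF + 1) {e : ℝ} (hqy : ‖q.1 - q'.1‖ ≤ e)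
    (hqμ : ‖q.2 - q'.2‖ ≤ e) (hry : ‖r.1 - r'.1‖ ≤ e) (hrμ : ‖γ⁻¹ • r.2 - γ⁻¹ • r'.2‖ ≤ e) :
    |γ⁻¹ * inner ℝ (P.estF γ x q r) (x' - x) - γ⁻¹ * inner ℝ (P.estF γ x q' r') (x' - x)|
      ≤ errConst lf1 lg1 lgc0 lgc1 γ₁ Bg BF * e * ‖x' - x‖ := by
  have hi0 : 0 ≤ γ⁻¹ := (inv_pos.2 H.γ_pos).le
  have he : 0 ≤ e := (norm_nonneg _).trans hqy
  rw [H.inner_estF hx hq hr, H.inner_estF hx hq' hr']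
  set d := x' - x with hd
  have hf : |fderiv ℝ (fun u => P.f u r.1) x d - fderiv ℝ (fun u => P.f u r'.1) x d|
      ≤ lf1 * e * ‖d‖ := by
    refine (norm_fderiv_left_sub H.lip.jointSmooth_f hx hr' hr d).trans ?_
    have := lf1.2
    gcongr
  have hg : ∀ y ∈ P.Y, ∀ y' ∈ P.Y, ‖y - y'‖ ≤ e →
      |fderiv ℝ (fun u => P.g u y) x d - fderiv ℝ (fun u => P.g u y') x d| ≤ lg1 * e * ‖d‖ := by
    intro y hy y' hy' hyy
    refine (norm_fderiv_left_sub H.lip.jointSmooth_g hx hy' hy d).trans ?_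
    have := lg1.2
    gcongr
  have hc : ∀ (μ μ' : Vec dc) (B : ℝ), ‖μ‖ ≤ B → ‖μ - μ'‖ ≤ e → ∀ y ∈ P.Y, ∀ y' ∈ P.Y,
      ‖y - y'‖ ≤ e → |inner ℝ μ (fderiv ℝ (fun u => P.gc u y) x d)
        - inner ℝ μ' (fderiv ℝ (fun u => P.gc u y') x d)|
        ≤ B * (lgc1 * e * ‖d‖) + e * (lgc0 * ‖d‖) := by
    intro μ μ' B hμ hμμ y hy y' hy' hyy
    have e1 : inner ℝ μ (fderiv ℝ (fun u => P.gc u y) x d)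
        - inner ℝ μ' (fderiv ℝ (fun u => P.gc u y') x d)
        = inner ℝ μ (fderiv ℝ (fun u => P.gc u y) x d - fderiv ℝ (fun u => P.gc u y') x d)
          + inner ℝ (μ - μ') (fderiv ℝ (fun u => P.gc u y') x d) := by
      rw [inner_sub_right, inner_sub_left]; ring
    have e2 : ‖fderiv ℝ (fun u => P.gc u y) x d - fderiv ℝ (fun u => P.gc u y') x d‖
        ≤ lgc1 * e * ‖d‖ := by
      refine (norm_fderiv_left_sub H.lip.jointSmooth_gc hx hy' hy d).trans ?_
      have := lgc1.2
      gcongr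
    rw [e1]
    refine (abs_add_le _ _).trans (add_le_add ?_ ?_)
    · exact (abs_real_inner_le_norm _ _).trans
        (mul_le_mul hμ e2 (norm_nonneg _) ((norm_nonneg _).trans hμ))
    · exact (abs_real_inner_le_norm _ _).trans
        (mul_le_mul hμμ (gc_tangent H.lip H.dom hx hx' hy') (norm_nonneg _) he)
  have h1 : |γ⁻¹ * (fderiv ℝ (fun u => P.f u r.1) x d - fderiv ℝ (fun u => P.f u r'.1) x d)|
      ≤ lf1 / γ₁ * (e * ‖d‖) := by
    rw [abs_mul, abs_of_nonneg hi0]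
    have := mul_le_mul_of_nonneg_right (H.inv_mul_le lf1.coe_nonneg)
      (mul_nonneg he (norm_nonneg d))
    calc _ ≤ γ⁻¹ * (lf1 * e * ‖d‖) := mul_le_mul_of_nonneg_left hf hi0
      _ = γ⁻¹ * lf1 * (e * ‖d‖) := by ring
      _ ≤ _ := this
  have h1 := abs_le.1 h1
  have h2 := abs_le.1 (hg _ hr _ hr' hry)
  have h3 := abs_le.1 (hg _ hq _ hq' hqy)
  have h4 := abs_le.1 (hc _ _ _ hqB hqμ _ hq _ hq' hqy)
  have h5 := abs_le.1 (hc _ _ _ hrB hrμ _ hr _ hr' hry)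
  rw [errConst, abs_le]
  constructor <;> linarith

/-- First-order lower bound for the lower-level value function. By duality `v(x')` is at least the
dual value at `x'` of the multiplier for `x`, so no regularity of the multiplier in `x` is used. -/
theorem v_lower
    (H : PenaltySetting P lf0 lf1 lg1 lgx0 lgc0 lgc1 αg αF l1F γ₁ γ Bg BF Lν μg yg ν yF)
    {x x' : Vec dx} (hx : x ∈ P.X) (hx' : x' ∈ P.X) :
    P.v x + (fderiv ℝ (fun u => P.g u (yg x)) x (x' - x)
        + inner ℝ (μg x) (fderiv ℝ (fun u => P.gc u (yg x)) x (x' - x)))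
      - valueConst lg1 lgc1 αg Bg * ‖x' - x‖ ^ 2 ≤ P.v x' := by
  have hs := H.solG x hx
  have hs' := H.solG x' hx'
  have S' := H.famG.saddle x' hx'
  have hα := S'.α_pos
  have hv := (BLOData.v_eq hs).2.1
  have hv' := (BLOData.v_eq hs').2.1
  obtain ⟨z, hz⟩ := S'.exists_argmin hs.nonneg
  have h1 := dualGap_nonneg S' hs' hs.nonneg
  rw [dualGap, dualFn_eq hs'.argmin, dualFn_eq hz] at h1
  have h2 := hs.argmin.2 z hz.1
  simp only [saddleFn, hs.inner_c_eq_zero, hs'.inner_c_eq_zero] at h1 h2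
  have hzy : αg * ‖z - yg x‖ ≤ (lg1 + Bg * lgc1) * ‖x' - x‖ := by
    have e := H.famG.argmin_dist_le hx hx' hs.nonneg hs.nonneg hs.argmin hz
    rw [sub_self, norm_zero, mul_zero, add_zero] at e
    refine e.trans ?_
    have := H.bddG x hx
    gcongr
  set d := x' - x with hd
  set Q := (lg1 : ℝ) + Bg * lgc1 with hQ
  have hB0 : 0 ≤ Bg := (norm_nonneg _).trans (H.bddG x hx)
  have hQ0 : 0 ≤ Q := by positivity
  have hzy' : ‖z - yg x‖ ≤ Q / αg * ‖d‖ := by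
    rw [div_mul_eq_mul_div, le_div_iff₀ hα]; linarith
  have t1 : |P.g x' z - P.g x z - fderiv ℝ (fun u => P.g u z) x d| ≤ lg1 * ‖d‖ ^ 2 :=
    H.lip.jointSmooth_g.taylor_left H.dom.X_convex hx hx' hz.1
  have t2 : ‖P.gc x' z - P.gc x z - fderiv ℝ (fun u => P.gc u z) x d‖ ≤ lgc1 * ‖d‖ ^ 2 :=
    H.lip.jointSmooth_gc.taylor_left H.dom.X_convex hx hx' hz.1
  have t3 : |fderiv ℝ (fun u => P.g u z) x d - fderiv ℝ (fun u => P.g u (yg x)) x d|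
      ≤ lg1 * ‖z - yg x‖ * ‖d‖ :=
    norm_fderiv_left_sub H.lip.jointSmooth_g hx hs.argmin.1 hz.1 d
  have t4 : ‖fderiv ℝ (fun u => P.gc u z) x d - fderiv ℝ (fun u => P.gc u (yg x)) x d‖
      ≤ lgc1 * ‖z - yg x‖ * ‖d‖ :=
    norm_fderiv_left_sub H.lip.jointSmooth_gc hx hs.argmin.1 hz.1 d
  have t2' := abs_le.1 ((abs_real_inner_le_norm (μg x) _).trans
    (mul_le_mul (H.bddG x hx) t2 (norm_nonneg _) hB0))
  have t4' := abs_le.1 ((abs_real_inner_le_norm (μg x) _).trans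
    (mul_le_mul (H.bddG x hx) t4 (norm_nonneg _) hB0))
  simp only [inner_sub_right] at t2' t4'
  have t1' := abs_le.1 t1
  have t3' := abs_le.1 t3
  have t5 : Q * (‖z - yg x‖ * ‖d‖) ≤ Q * (Q / αg * ‖d‖ * ‖d‖) := by gcongr
  have t6 : Q * (‖z - yg x‖ * ‖d‖) = lg1 * ‖z - yg x‖ * ‖d‖ + Bg * (lgc1 * ‖z - yg x‖ * ‖d‖) := by
    rw [hQ]; ring
  have t7 : valueConst lg1 lgc1 αg Bg * ‖d‖ ^ 2
      = lg1 * ‖d‖ ^ 2 + Bg * (lgc1 * ‖d‖ ^ 2) + Q * (Q / αg * ‖d‖ * ‖d‖) := by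
    rw [valueConst, hQ]; ring
  linarith

/-- The penalized value function, divided by `γ`. -/
noncomputable def value (P : BLOData dx dy dc) (γ : ℝ) (yF : Vec dx → Vec dy) (x : Vec dx) : ℝ :=
  P.penalized γ x (yF x)

/-- First-order upper bound for the penalized value function. -/
theorem value_upper
    (H : PenaltySetting P lf0 lf1 lg1 lgx0 lgc0 lgc1 αg αF l1F γ₁ γ Bg BF Lν μg yg ν yF)
    {x x' : Vec dx} (hx : x ∈ P.X) (hx' : x' ∈ P.X) :
    value P γ yF x' ≤ value P γ yF x
      + γ⁻¹ * inner ℝ (P.estF γ x (yg x, μg x) (yF x, γ • ν x)) (x' - x)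
      + smoothConst lf1 lg1 lgc0 lgc1 αg γ₁ Bg BF Lν * ‖x' - x‖ ^ 2 := by
  have hi0 : 0 ≤ γ⁻¹ := (inv_pos.2 H.γ_pos).le
  have hs := H.solF x hx
  have hs' := H.solF x' hx'
  have hyF := hs.argmin.1
  rw [H.inner_estF hx (q := (yg x, μg x)) (r := (yF x, γ • ν x)) (H.solG x hx).argmin.1 hyF]
  simp only [smul_smul, inv_mul_cancel₀ H.γ_pos.ne', one_smul]
  have h1 := hs'.argmin.2 (yF x) hyF
  simp only [saddleFn, hs'.inner_c_eq_zero] at h1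
  have h2 := inner_nonpos_of_orthant hs'.nonneg hs.c_nonpos
  have hv := H.v_lower hx hx'
  set d := x' - x with hd
  have hB0 : 0 ≤ BF := (norm_nonneg _).trans (H.bddF x hx)
  have t1 : |P.g x' (yF x) - P.g x (yF x) - fderiv ℝ (fun u => P.g u (yF x)) x d|
      ≤ lg1 * ‖d‖ ^ 2 := H.lip.jointSmooth_g.taylor_left H.dom.X_convex hx hx' hyF
  have t2 : |P.f x' (yF x) - P.f x (yF x) - fderiv ℝ (fun u => P.f u (yF x)) x d|
      ≤ lf1 * ‖d‖ ^ 2 := H.lip.jointSmooth_f.taylor_left H.dom.X_convex hx hx' hyF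
  have t3 : ‖P.gc x' (yF x) - P.gc x (yF x) - fderiv ℝ (fun u => P.gc u (yF x)) x d‖
      ≤ lgc1 * ‖d‖ ^ 2 := H.lip.jointSmooth_gc.taylor_left H.dom.X_convex hx hx' hyF
  have t1' := (abs_le.1 t1).2
  have t2' := mul_le_mul_of_nonneg_left (abs_le.1 t2).2 hi0
  have t2'' := mul_le_mul_of_nonneg_right (H.inv_mul_le lf1.coe_nonneg) (sq_nonneg ‖d‖)
  have t3' := (real_inner_le_norm (ν x) _).trans
    (mul_le_mul (H.bddF x hx) t3 (norm_nonneg _) hB0)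
  have t4 : inner ℝ (ν x' - ν x) (P.gc x' (yF x) - P.gc x (yF x))
      ≤ Lν * ‖d‖ * (lgc0 * ‖d‖) :=
    (real_inner_le_norm _ _).trans (mul_le_mul (H.lip_ν x hx x' hx') (H.lip.gc_left hx hx' hyF)
      (norm_nonneg _) ((norm_nonneg _).trans (H.lip_ν x hx x' hx')))
  simp only [inner_sub_right, inner_sub_left] at t3' t4
  have h3 := hs.inner_c_eq_zero
  simp only [value, BLOData.penalized] at h1 ⊢
  rw [smoothConst]
  linarith

theorem value_lower
    (H : PenaltySetting P lf0 lf1 lg1 lgx0 lgc0 lgc1 αg αF l1F γ₁ γ Bg BF Lν μg yg ν yF)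
    {m : ℝ} (hm : ∀ x ∈ P.X, ∀ y ∈ P.feas x, m ≤ P.f x y) {x : Vec dx} (hx : x ∈ P.X) :
    γ⁻¹ * m ≤ value P γ yF x := by
  have hs := H.solF x hx
  have hf : yF x ∈ P.feas x := ⟨hs.argmin.1, hs.c_nonpos⟩
  have h1 := (BLOData.v_eq (H.solG x hx)).2.2 _ hf
  have h2 := mul_le_mul_of_nonneg_left (hm x hx _ hf) (inv_pos.2 H.γ_pos).le
  rw [value, BLOData.penalized]
  linarith

theorem value_le
    (H : PenaltySetting P lf0 lf1 lg1 lgx0 lgc0 lgc1 αg αF l1F γ₁ γ Bg BF Lν μg yg ν yF)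
    {x : Vec dx} (hx : x ∈ P.X) : value P γ yF x ≤ γ⁻¹ * P.f x (yg x) := by
  have hs := H.solF x hx
  obtain ⟨hf, hv, -⟩ := BLOData.v_eq (H.solG x hx)
  have h1 := hs.argmin.2 (yg x) hf.1
  have h2 := inner_nonpos_of_orthant hs.nonneg hf.2
  simp only [saddleFn, hs.inner_c_eq_zero, BLOData.penalized, hv] at h1
  simp only [value, BLOData.penalized, hv]
  linarith

/-- The minimizers of the penalized and the lower-level problem are at bounded distance, uniformly
in `γ` and `x`. -/
theorem norm_yF_sub_yg_le
    (H : PenaltySetting P lf0 lf1 lg1 lgx0 lgc0 lgc1 αg αF l1F γ₁ γ Bg BF Lν μg yg ν yF)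
    {x : Vec dx} (hx : x ∈ P.X) :
    ‖yF x - yg x‖ ≤ 2 * (lf0 / γ₁ + (BF + Bg) * lgc0) / αF := by
  have hi0 : 0 ≤ γ⁻¹ := (inv_pos.2 H.γ_pos).le
  have hs := H.solF x hx
  have hg := H.solG x hx
  have S := H.famF.saddle x hx
  have hα := S.α_pos
  have h1 := S.argmin_growth hs.nonneg hs.argmin hg.argmin.1
  have h2 := hg.argmin.2 _ hs.argmin.1
  rw [norm_sub_rev] at h1
  have h3 := mul_le_mul_of_nonneg_left
    (abs_le.1 (H.lip.f_right hx hs.argmin.1 hg.argmin.1)).2 hi0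
  have h3' := mul_le_mul_of_nonneg_right (H.inv_mul_le lf0.coe_nonneg) (norm_nonneg (yg x - yF x))
  have h4 := S.inner_c_sub_le (p := ν x - μg x) (d := BF + Bg)
    ((norm_sub_le _ _).trans (add_le_add (H.bddF x hx) (H.bddG x hx))) hs.argmin.1 hg.argmin.1
  rw [norm_sub_rev] at h3 h3' h4
  simp only [inner_sub_right, inner_sub_left] at h4
  simp only [saddleFn, BLOData.penalized] at h1 h2
  rw [le_div_iff₀ hα]
  rcases (norm_nonneg (yF x - yg x)).eq_or_lt with h0 | h0
  · rw [← h0, zero_mul]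
    have := H.γ₁_pos
    have : 0 ≤ BF := (norm_nonneg _).trans (H.bddF x hx)
    have : 0 ≤ Bg := (norm_nonneg _).trans (H.bddG x hx)
    positivity
  · refine le_of_mul_le_mul_right ?_ h0
    linarith

end PenaltySetting

/-! ### The outer iteration -/

/-- A radius within which warm starts lie when the upper-level variable moves by at most `D`. -/
noncomputable def restartRadius (α l1 l0 l2 B D : ℝ) : ℝ :=
  (1 + ((l1 + B * l2) * D + l0 * (2 * B)) / α) + (1 + 2 * B)

theorem norm_le_of_sqErr {q : Vec dy × Vec dc} {y : Vec dy} {μ : Vec dc} {e : ℝ} (he : 0 ≤ e)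
    (h : sqErr q y μ ≤ e ^ 2) : ‖q.1 - y‖ ≤ e ∧ ‖q.2 - μ‖ ≤ e := by
  rw [sqErr] at h
  exact ⟨(sq_le_sq₀ (norm_nonneg _) he).1 (by linarith [sq_nonneg ‖q.2 - μ‖]),
    (sq_le_sq₀ (norm_nonneg _) he).1 (by linarith [sq_nonneg ‖q.1 - y‖])⟩

theorem sqErr_le_of_norm_le {q : Vec dy × Vec dc} {y : Vec dy} {μ : Vec dc} {a b R : ℝ}
    (h1 : ‖q.1 - y‖ ≤ a) (h2 : ‖q.2 - μ‖ ≤ b) (hR : a + b ≤ R) : sqErr q y μ ≤ R ^ 2 := by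
  rw [sqErr]
  have ha := norm_nonneg (q.1 - y)
  have hb := norm_nonneg (q.2 - μ)
  calc _ ≤ (‖q.1 - y‖ + ‖q.2 - μ‖) ^ 2 := by nlinarith
    _ ≤ R ^ 2 := pow_le_pow_left₀ (by linarith) (by linarith) 2

theorem SaddleFamily.restart {h : Vec dx → Vec dy → ℝ} {c : Vec dx → Vec dy → Vec dc}
    {X : Set (Vec dx)} {Y : Set (Vec dy)} {α l1 l0 l2 : ℝ} (F : SaddleFamily h c X Y α l1 l0 l2)
    {μs : Vec dx → Vec dc} {ys : Vec dx → Vec dy}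
    (hs : ∀ x ∈ X, SaddleSol (h x) (c x) Y (μs x) (ys x)) {B D : ℝ} (hB : ∀ x ∈ X, ‖μs x‖ ≤ B)
    {x x' : Vec dx} (hx : x ∈ X) (hx' : x' ∈ X) (hD : ‖x' - x‖ ≤ D) {q : Vec dy × Vec dc}
    (hq : sqErr q (ys x) (μs x) ≤ 1) {R : ℝ} (hR : restartRadius α l1 l0 l2 B D ≤ R) :
    sqErr q (ys x') (μs x') ≤ R ^ 2 := by
  have S := F.saddle x hx
  have hα := S.α_pos
  have := S.l0_nonneg
  have := S.l1_nonneg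
  have := S.l2_nonneg
  have hB0 : 0 ≤ B := (norm_nonneg _).trans (hB x hx)
  obtain ⟨h1, h2⟩ := norm_le_of_sqErr zero_le_one (by simpa using hq)
  have h3 : ‖μs x' - μs x‖ ≤ 2 * B :=
    (norm_sub_le _ _).trans (by linarith [hB x hx, hB x' hx'])
  have h4 : ‖ys x' - ys x‖ ≤ ((l1 + B * l2) * D + l0 * (2 * B)) / α := by
    rw [le_div_iff₀ hα, mul_comm]
    refine (F.argmin_dist_le hx hx' (hs x hx).nonneg (hs x' hx').nonneg (hs x hx).argmin
      (hs x' hx').argmin).trans ?_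
    have := hB x hx
    gcongr
  refine sqErr_le_of_norm_le (a := 1 + ((l1 + B * l2) * D + l0 * (2 * B)) / α) (b := 1 + 2 * B)
    ?_ ?_ hR
  · have := norm_sub_le_norm_sub_add_norm_sub q.1 (ys x) (ys x')
    rw [norm_sub_rev (ys x)] at this
    linarith
  · have := norm_sub_le_norm_sub_add_norm_sub q.2 (μs x) (μs x')
    rw [norm_sub_rev (μs x)] at this
    linarith

namespace PenaltySetting

variable {P : BLOData dx dy dc} {lf0 lf1 lg1 lgx0 lgc0 lgc1 : ℝ≥0}
  {αg αF l1F γ₁ γ Bg BF Lν : ℝ} {μg : Vec dx → Vec dc} {yg : Vec dx → Vec dy}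
  {ν : Vec dx → Vec dc} {yF : Vec dx → Vec dy}

/-- What holds at the beginning of every outer iteration: admissible points, and warm starts within
the radii `Rg`, `RF` of the current solutions. -/
structure OuterInv (P : BLOData dx dy dc) (γ Rg RF : ℝ) (μg : Vec dx → Vec dc)
    (yg : Vec dx → Vec dy) (ν : Vec dx → Vec dc) (yF : Vec dx → Vec dy)
    (s : BLOCCState dx dy dc) : Prop where
  init : P.IsInit s
  startG : sqErr (s.yg, s.μg) (yg s.x) (μg s.x) ≤ Rg ^ 2
  startF : sqErr (s.yF, γ⁻¹ • s.μF) (yF s.x) (ν s.x) ≤ RF ^ 2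

/-- The two subroutines, called within the radii `Rg`, `RF`, return solutions up to squared errors
`eg`, `eF`, where the multiplier of the penalized problem is measured after division by `γ`. -/
structure SolverOK (P : BLOData dx dy dc) (p : BLOCCParams) (Rg RF eg eF : ℝ)
    (μg : Vec dx → Vec dc) (yg : Vec dx → Vec dy) (ν : Vec dx → Vec dc) (yF : Vec dx → Vec dy) :
    Prop where
  outG : ∀ x ∈ P.X, ∀ y₀ ∈ P.Y, ∀ μ₀ ∈ orthant dc, sqErr (y₀, μ₀) (yg x) (μg x) ≤ Rg ^ 2 →
    sqErr (maxMin (P.Lg x) P.Y p.ηg1 p.ηg2 p.Tg p.Tyg y₀ μ₀) (yg x) (μg x) ≤ eg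
  outF : ∀ x ∈ P.X, ∀ y₀ ∈ P.Y, ∀ μ₀ ∈ orthant dc, sqErr (y₀, p.γ⁻¹ • μ₀) (yF x) (ν x) ≤ RF ^ 2 →
    sqErr ((maxMin (P.LF p.γ x) P.Y p.ηF1 p.ηF2 p.TF p.TyF y₀ μ₀).1,
      p.γ⁻¹ • (maxMin (P.LF p.γ x) P.Y p.ηF1 p.ηF2 p.TF p.TyF y₀ μ₀).2) (yF x) (ν x) ≤ eF

theorem bloccStep_x_mem (hD : P.DomainAss) (p : BLOCCParams) (s : BLOCCState dx dy dc) :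
    (P.bloccStep p s).x ∈ P.X :=
  proj_mem hD.X_closed hD.X_nonempty _

theorem bloccStep_vi (hD : P.DomainAss) (p : BLOCCParams) {s : BLOCCState dx dy dc}
    (hs : s.x ∈ P.X) :
    ‖(P.bloccStep p s).x - s.x‖ ^ 2
      ≤ -(p.η * inner ℝ (P.estF p.γ s.x (P.outG p s) (P.outF p s)) ((P.bloccStep p s).x - s.x)) := by
  have h := proj_inner_nonpos hD.X_closed hD.X_convex hD.X_nonempty
    (s.x - p.η • P.estF p.γ s.x (P.outG p s) (P.outF p s)) hs
  change inner ℝ (s.x - p.η • P.estF p.γ s.x (P.outG p s) (P.outF p s) - (P.bloccStep p s).x)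
    (s.x - (P.bloccStep p s).x) ≤ 0 at h
  rw [sub_right_comm, inner_sub_left, real_inner_self_eq_norm_sq, real_inner_smul_left,
    norm_sub_rev] at h
  rw [← neg_sub s.x, inner_neg_right]
  rw [norm_neg, norm_sub_rev]
  linarith

theorem out_bounds
    (H : PenaltySetting P lf0 lf1 lg1 lgx0 lgc0 lgc1 αg αF l1F γ₁ γ Bg BF Lν μg yg ν yF)
    {p : BLOCCParams} (hp : p.γ = γ) {Rg RF e : ℝ} (he : 0 ≤ e) (he1 : e ≤ 1)
    (hsol : SolverOK P p Rg RF (e ^ 2) (e ^ 2) μg yg ν yF)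
    {s : BLOCCState dx dy dc} (I : OuterInv P γ Rg RF μg yg ν yF s) :
    (P.outG p s).1 ∈ P.Y ∧ (P.outF p s).1 ∈ P.Y
      ∧ ‖(P.outG p s).2‖ ≤ Bg + 1 ∧ ‖γ⁻¹ • (P.outF p s).2‖ ≤ BF + 1
      ∧ ‖(P.outG p s).1 - yg s.x‖ ≤ e ∧ ‖(P.outG p s).2 - μg s.x‖ ≤ e
      ∧ ‖(P.outF p s).1 - yF s.x‖ ≤ e ∧ ‖γ⁻¹ • (P.outF p s).2 - ν s.x‖ ≤ e := by
  have hx := I.init.x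
  have S := H.famG.saddle s.x hx
  obtain ⟨a1, a2⟩ := norm_le_of_sqErr he
    (hsol.outG s.x hx s.yg I.init.yg s.μg I.init.μg I.startG)
  obtain ⟨b1, b2⟩ := norm_le_of_sqErr he
    (hsol.outF s.x hx s.yF I.init.yF s.μF I.init.μF (hp ▸ I.startF))
  rw [hp] at b1 b2
  refine ⟨(maxMin_mem S _ _ _ _ _ I.init.yg I.init.μg).1,
    (maxMin_mem S _ _ _ _ _ I.init.yF I.init.μF).1, ?_, ?_, a1, a2, ?_, ?_⟩
  · have := norm_le_norm_add_norm_sub' (P.outG p s).2 (μg s.x)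
    have e2 : ‖(P.outG p s).2 - μg s.x‖ ≤ e := a2
    linarith [H.bddG s.x hx]
  · have := norm_le_norm_add_norm_sub' (γ⁻¹ • (P.outF p s).2) (ν s.x)
    have e2 : ‖γ⁻¹ • (P.outF p s).2 - ν s.x‖ ≤ e := by rw [BLOData.outF, hp]; exact b2
    linarith [H.bddF s.x hx]
  · rw [BLOData.outF, hp]; exact b1
  · rw [BLOData.outF, hp]; exact b2

theorem step_le
    (H : PenaltySetting P lf0 lf1 lg1 lgx0 lgc0 lgc1 αg αF l1F γ₁ γ Bg BF Lν μg yg ν yF)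
    {p : BLOCCParams} (hp : p.γ = γ) (hη : 0 < p.η) {Rg RF : ℝ}
    (hsol : SolverOK P p Rg RF (1 ^ 2) (1 ^ 2) μg yg ν yF)
    {s : BLOCCState dx dy dc} (I : OuterInv P γ Rg RF μg yg ν yF s) :
    ‖(P.bloccStep p s).x - s.x‖ ≤ p.η * γ * slopeConst lf0 lgx0 lgc0 γ₁ Bg BF := by
  obtain ⟨h1, h2, h3, h4, -⟩ := H.out_bounds hp zero_le_one le_rfl hsol I
  have hγ := H.γ_pos
  have hx' := bloccStep_x_mem H.dom p s
  have e1 := bloccStep_vi H.dom p I.init.x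
  rw [hp] at e1
  have e2 := (abs_le.1 (H.abs_inner_estF_le I.init.x hx' h1 h2 h3 h4)).1
  set d := (P.bloccStep p s).x - s.x
  set u := inner ℝ (P.estF γ s.x (P.outG p s) (P.outF p s)) d
  have e3 : p.η * u = p.η * γ * (γ⁻¹ * u) := by field_simp
  rw [e3] at e1
  have e4 := mul_le_mul_of_nonneg_left e2 (mul_pos hη hγ).le
  rcases (norm_nonneg d).eq_or_lt with h0 | h0
  · rw [← h0]
    have := H.γ₁_pos
    have : 0 ≤ BF := (norm_nonneg _).trans (H.bddF _ I.init.x)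
    have : 0 ≤ Bg := (norm_nonneg _).trans (H.bddG _ I.init.x)
    rw [slopeConst]
    positivity
  · refine le_of_mul_le_mul_right ?_ h0
    linarith

theorem outerInv_blocc
    (H : PenaltySetting P lf0 lf1 lg1 lgx0 lgc0 lgc1 αg αF l1F γ₁ γ Bg BF Lν μg yg ν yF)
    {p : BLOCCParams} (hp : p.γ = γ) (hη : 0 < p.η) {Rg RF D : ℝ}
    (hD : p.η * γ * slopeConst lf0 lgx0 lgc0 γ₁ Bg BF ≤ D)
    (hRg : restartRadius αg lg1 lgc0 lgc1 Bg D ≤ Rg)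
    (hRF : restartRadius αF l1F lgc0 lgc1 BF D ≤ RF)
    (hsol : SolverOK P p Rg RF (1 ^ 2) (1 ^ 2) μg yg ν yF)
    {s₀ : BLOCCState dx dy dc} (I₀ : OuterInv P γ Rg RF μg yg ν yF s₀) (t : ℕ) :
    OuterInv P γ Rg RF μg yg ν yF (P.blocc p s₀ t) := by
  induction t with
  | zero => exact I₀
  | succ t I =>
    rw [BLOData.blocc, Function.iterate_succ_apply', ← BLOData.blocc]
    set s := P.blocc p s₀ t
    have hx := I.init.x
    have hx' := bloccStep_x_mem H.dom p s
    have S := H.famG.saddle s.x hx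
    have hstep := (H.step_le hp hη hsol I).trans hD
    have hG := hsol.outG s.x hx s.yg I.init.yg s.μg I.init.μg I.startG
    have hF := hsol.outF s.x hx s.yF I.init.yF s.μF I.init.μF (hp ▸ I.startF)
    rw [one_pow] at hG hF
    have mG := maxMin_mem S (P.Lg s.x) p.ηg1 p.ηg2 p.Tg p.Tyg I.init.yg I.init.μg
    have mF := maxMin_mem S (P.LF p.γ s.x) p.ηF1 p.ηF2 p.TF p.TyF I.init.yF I.init.μF
    refine ⟨⟨hx', mG.1, mG.2, mF.1, mF.2⟩, ?_, ?_⟩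
    · exact H.famG.restart H.solG H.bddG hx hx' hstep hG hRg
    · have := H.famF.restart H.solF H.bddF hx hx' hstep hF hRF
      rw [hp] at this
      simpa only [BLOData.bloccStep, BLOData.outF, hp] using this

/-- Decrease of the penalized value function in one outer iteration. -/
theorem descent
    (H : PenaltySetting P lf0 lf1 lg1 lgx0 lgc0 lgc1 αg αF l1F γ₁ γ Bg BF Lν μg yg ν yF)
    {p : BLOCCParams} (hp : p.γ = γ) {c : ℝ} (hc : 0 < c) (hη : p.η = c / γ)
    (hcL : c * smoothConst lf1 lg1 lgc0 lgc1 αg γ₁ Bg BF Lν ≤ 1 / 4) {Rg RF e : ℝ} (he : 0 ≤ e)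
    (he1 : e ≤ 1) (hsol : SolverOK P p Rg RF (e ^ 2) (e ^ 2) μg yg ν yF)
    {s : BLOCCState dx dy dc} (I : OuterInv P γ Rg RF μg yg ν yF s) :
    ‖(P.bloccStep p s).x - s.x‖ ^ 2 ≤ 2 * c * (value P γ yF s.x - value P γ yF (P.bloccStep p s).x)
      + 2 * c ^ 2 * (errConst lf1 lg1 lgc0 lgc1 γ₁ Bg BF * e) ^ 2 := by
  obtain ⟨h1, h2, h3, h4, h5, h6, h7, h8⟩ := H.out_bounds hp he he1 hsol I
  have hγ := H.γ_pos
  have hx := I.init.x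
  have hx' := bloccStep_x_mem H.dom p s
  have e1 := bloccStep_vi H.dom p hx
  have e2 := H.value_upper hx hx'
  have e3 := (abs_le.1 (H.abs_inner_estF_sub_le hx hx' (q' := (yg s.x, μg s.x))
    (r' := (yF s.x, γ • ν s.x)) h1 h2 (H.solG _ hx).argmin.1 (H.solF _ hx).argmin.1 h3 h4 h5 h6 h7
    (by simpa only [smul_smul, inv_mul_cancel₀ hγ.ne', one_smul] using h8))).1
  rw [hp, hη] at e1
  set d := (P.bloccStep p s).x - s.x
  set u := inner ℝ (P.estF γ s.x (P.outG p s) (P.outF p s)) d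
  have e4 : c / γ * u = c * (γ⁻¹ * u) := by field_simp
  rw [e4] at e1
  set E := errConst lf1 lg1 lgc0 lgc1 γ₁ Bg BF * e
  have e5 := mul_le_mul_of_nonneg_right hcL (sq_nonneg ‖d‖)
  have e6 : c * (E * ‖d‖) ≤ 1 / 4 * ‖d‖ ^ 2 + c ^ 2 * E ^ 2 := by
    nlinarith [sq_nonneg (1 / 2 * ‖d‖ - c * E)]
  have e7 := mul_le_mul_of_nonneg_left e2 hc.le
  have e8 := mul_le_mul_of_nonneg_left e3 hc.le
  linarith

/-- Averaged squared projected gradients, by telescoping the decrease of the value function. -/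
theorem avgProjGrad_le
    (H : PenaltySetting P lf0 lf1 lg1 lgx0 lgc0 lgc1 αg αF l1F γ₁ γ Bg BF Lν μg yg ν yF)
    {p : BLOCCParams} (hp : p.γ = γ) {c : ℝ} (hc : 0 < c) (hη : p.η = c / γ)
    (hcL : c * smoothConst lf1 lg1 lgc0 lgc1 αg γ₁ Bg BF Lν ≤ 1 / 4) {Rg RF e : ℝ} (he : 0 ≤ e)
    (he1 : e ≤ 1) (hsol : SolverOK P p Rg RF (e ^ 2) (e ^ 2) μg yg ν yF)
    {s₀ : BLOCCState dx dy dc} (hI : ∀ t, OuterInv P γ Rg RF μg yg ν yF (P.blocc p s₀ t))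
    {m : ℝ} (hm : ∀ x ∈ P.X, ∀ y ∈ P.feas x, m ≤ P.f x y) {K : ℕ} (hK : 0 < K) :
    P.avgProjGrad p s₀ K ≤ 2 * γ * (P.f s₀.x (yg s₀.x) - m) / (c * K)
      + 2 * (γ * (errConst lf1 lg1 lgc0 lgc1 γ₁ Bg BF * e)) ^ 2 := by
  have hγ := H.γ_pos
  set E := errConst lf1 lg1 lgc0 lgc1 γ₁ Bg BF * e
  have hstep : ∀ t, ‖(P.blocc p s₀ (t + 1)).x - (P.blocc p s₀ t).x‖ ^ 2
      ≤ 2 * c * (value P γ yF (P.blocc p s₀ t).x - value P γ yF (P.blocc p s₀ (t + 1)).x)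
        + 2 * c ^ 2 * E ^ 2 := by
    intro t
    have h := H.descent hp hc hη hcL he he1 hsol (hI t)
    have e1 : P.bloccStep p (P.blocc p s₀ t) = P.blocc p s₀ (t + 1) := by
      rw [BLOData.blocc, BLOData.blocc, Function.iterate_succ_apply']
    rwa [e1] at h
  have hsum := Finset.sum_le_sum (s := Finset.range K) fun t _ => hstep t
  rw [Finset.sum_add_distrib, ← Finset.mul_sum, Finset.sum_range_sub', Finset.sum_const,
    Finset.card_range, nsmul_eq_mul] at hsum
  have h0 : value P γ yF (P.blocc p s₀ 0).x ≤ γ⁻¹ * P.f s₀.x (yg s₀.x) := H.value_le (hI 0).init.x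
  have hKv := H.value_lower hm (hI K).init.x
  have hsum' : ∑ t ∈ Finset.range K, ‖(P.blocc p s₀ (t + 1)).x - (P.blocc p s₀ t).x‖ ^ 2
      ≤ 2 * c * (γ⁻¹ * (P.f s₀.x (yg s₀.x) - m)) + K * (2 * c ^ 2 * E ^ 2) := by
    refine hsum.trans (add_le_add_left (mul_le_mul_of_nonneg_left ?_ (by positivity)) _)
    linarith
  have hKR : (0 : ℝ) < K := by exact_mod_cast hK
  have hterm : ∀ t, ‖(p.η)⁻¹ • ((P.blocc p s₀ (t + 1)).x - (P.blocc p s₀ t).x)‖ ^ 2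
      = (γ / c) ^ 2 * ‖(P.blocc p s₀ (t + 1)).x - (P.blocc p s₀ t).x‖ ^ 2 := by
    intro t
    rw [norm_smul, mul_pow, hη, inv_div, Real.norm_of_nonneg (by positivity)]
  rw [BLOData.avgProjGrad]
  simp only [hterm]
  rw [← Finset.mul_sum]
  have h3 : 1 / (K : ℝ) * ((γ / c) ^ 2 * (2 * c * (γ⁻¹ * (P.f s₀.x (yg s₀.x) - m))
      + K * (2 * c ^ 2 * E ^ 2))) = 2 * γ * (P.f s₀.x (yg s₀.x) - m) / (c * K)
      + 2 * (γ * E) ^ 2 := by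
    field_simp
  rw [← h3]
  gcongr

end PenaltySetting

end Outer

/-! ### Choice of stepsizes and iteration counters -/

section Parameters

theorem rpow_neg_half {ε : ℝ} (hε : 0 < ε) : ε ^ (-(1 / 2) : ℝ) = (√ε)⁻¹ := by
  rw [Real.rpow_neg hε.le, Real.sqrt_eq_rpow]

theorem outerCount_bounds {A ε : ℝ} (hA : 0 ≤ A) (hε : 0 < ε) :
    A / √ε ≤ outerCount A ε ∧ (outerCount A ε : ℝ) ≤ A / √ε + 1 := by
  have h : A * ε ^ (-(1 / 2) : ℝ) = A / √ε := by rw [rpow_neg_half hε]; rfl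
  rw [outerCount, h]
  exact ⟨Nat.le_ceil _, (Nat.ceil_lt_add_one (by positivity)).le⟩

/-- Geometric decay over `innerCount A' ε` steps beats any power of `ε`; the square suffices here. -/
theorem pow_innerCount_le {ρ n A' ε : ℝ} (hρ0 : 0 ≤ ρ) (hρ1 : ρ < 1) (hn : 0 ≤ n)
    (hA' : (n + 2) / (1 - ρ) ≤ A') (hε : 0 < ε) :
    ρ ^ innerCount A' ε ≤ Real.exp (-n) * ε ^ 2 := by
  have hlam : 0 < 1 - ρ := by linarith
  set l := Real.log ε⁻¹ with hl
  have hm1 : 1 ≤ max 1 l := le_max_left _ _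
  have hm2 : l ≤ max 1 l := le_max_right _ _
  have hK : A' * max 1 l ≤ innerCount A' ε := Nat.le_ceil _
  have h1 : ρ ≤ Real.exp (-(1 - ρ)) := by linarith [Real.add_one_le_exp (-(1 - ρ))]
  have h2 : ρ ^ innerCount A' ε ≤ Real.exp (-(1 - ρ) * innerCount A' ε) := by
    rw [mul_comm, Real.exp_nat_mul]
    exact pow_le_pow_left₀ hρ0 h1 _
  have h3 : n + 2 * l ≤ (1 - ρ) * innerCount A' ε := by
    rw [div_le_iff₀ hlam] at hA'
    have e1 := mul_le_mul_of_nonneg_left hK hlam.le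
    have e2 := mul_le_mul_of_nonneg_right hA' (zero_le_one.trans hm1)
    have e3 := mul_le_mul_of_nonneg_left hm1 hn
    linarith
  refine h2.trans ?_
  have h4 : ε ^ 2 = Real.exp (-(2 * l)) := by
    rw [hl, Real.log_inv, mul_neg, neg_neg]
    have := Real.exp_nat_mul (Real.log ε) 2
    rw [Real.exp_log hε] at this
    exact_mod_cast this.symm
  rw [h4, ← Real.exp_add]
  exact Real.exp_le_exp.2 (by linarith)

/-- Counters `T` of order `ε^{-1/2}` and `K` of order `ln ε⁻¹` with `1/T² = O(ε)` and
`T³ ρ^K = O(1)`. -/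
theorem exists_counts {ρ q Q c₁ εmax : ℝ} (hρ0 : 0 ≤ ρ) (hρ1 : ρ < 1) (hq : 0 < q) (hQ : 0 ≤ Q)
    (hc₁ : 0 < c₁) (hεmax : 0 < εmax) :
    ∃ A₀ > 0, ∀ A ≥ A₀, ∃ A₀' > 0, ∀ A' ≥ A₀', ∀ ε ∈ Set.Ioc 0 εmax,
      4 ≤ outerCount A ε ∧ 1 ≤ innerCount A' ε ∧ 1 / (outerCount A ε : ℝ) ^ 2 ≤ c₁ * ε ∧
      16 * (outerCount A ε : ℝ) ^ 3 * (ρ ^ innerCount A' ε * Q) ≤ q := by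
  set s := √εmax with hs
  have hs0 : 0 < s := Real.sqrt_pos.2 hεmax
  refine ⟨4 * s + 1 / √c₁, by positivity, fun A hA => ?_⟩
  have hc₁' : 0 < √c₁ := Real.sqrt_pos.2 hc₁
  have hinv : 0 < 1 / √c₁ := by positivity
  have hA0 : 0 < A := by linarith
  set W := 16 * (A + s) ^ 3 * s * Q with hW
  have hlam : 0 < 1 - ρ := by linarith
  refine ⟨(W / q + 2) / (1 - ρ), by positivity, fun A' hA' ε hε => ?_⟩
  have hA'0 : 0 < A' := lt_of_lt_of_le (by positivity) hA'
  obtain ⟨hT1, hT2⟩ := outerCount_bounds hA0.le hε.1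
  set T := outerCount A ε
  set r := √ε with hr
  have hr0 : 0 < r := Real.sqrt_pos.2 hε.1
  have hrs : r ≤ s := Real.sqrt_le_sqrt hε.2
  have hr2 : r ^ 2 = ε := Real.sq_sqrt hε.1.le
  refine ⟨?_, ?_, ?_, ?_⟩
  · have : (4 : ℝ) ≤ A / r := by rw [le_div_iff₀ hr0]; linarith
    exact_mod_cast this.trans hT1
  · have : 0 < A' * max 1 (Real.log ε⁻¹) := mul_pos hA'0 (lt_of_lt_of_le one_pos (le_max_left _ _))
    exact Nat.ceil_pos.2 this
  · have h1 : (A / r) ^ 2 ≤ (T : ℝ) ^ 2 := pow_le_pow_left₀ (by positivity) hT1 2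
    have h2 : 1 / (T : ℝ) ^ 2 ≤ 1 / (A / r) ^ 2 := one_div_le_one_div_of_le (by positivity) h1
    refine h2.trans ?_
    have h3 : 1 / (A / r) ^ 2 = ε / A ^ 2 := by rw [← hr2]; field_simp
    rw [h3, div_le_iff₀ (by positivity)]
    have h4 : (1 / √c₁) ^ 2 ≤ A ^ 2 := pow_le_pow_left₀ hinv.le (by linarith) 2
    rw [div_pow, one_pow, Real.sq_sqrt hc₁.le, div_le_iff₀ hc₁] at h4
    nlinarith [hε.1]
  · have h1 := pow_innerCount_le hρ0 hρ1 (by positivity) hA' hε.1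
    have h2 : (T : ℝ) ≤ (A + s) / r := by
      refine hT2.trans ?_
      rw [add_div]
      have : 1 ≤ s / r := (one_le_div hr0).2 hrs
      linarith
    have h3 : (T : ℝ) ^ 3 ≤ ((A + s) / r) ^ 3 := pow_le_pow_left₀ (by positivity) h2 3
    have h4 : 16 * (T : ℝ) ^ 3 * (ρ ^ innerCount A' ε * Q)
        ≤ 16 * ((A + s) / r) ^ 3 * (Real.exp (-(W / q)) * ε ^ 2 * Q) := by gcongr
    refine h4.trans ?_
    have h5 : 16 * ((A + s) / r) ^ 3 * (Real.exp (-(W / q)) * ε ^ 2 * Q)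
        = 16 * (A + s) ^ 3 * r * Q * Real.exp (-(W / q)) := by
      rw [← hr2]; field_simp
    have h6 : 16 * (A + s) ^ 3 * r * Q * Real.exp (-(W / q)) ≤ W * Real.exp (-(W / q)) := by
      rw [hW]; gcongr
    rw [h5]
    refine h6.trans ?_
    rw [Real.exp_neg, ← div_eq_mul_inv, div_le_iff₀ (Real.exp_pos _)]
    have h7 := Real.add_one_le_exp (W / q)
    have h8 : W = q * (W / q) := by field_simp
    nlinarith

theorem exists_stepsizes {α l1 l0 l2 B R : ℝ} (hα : 0 < α) (hl1 : 0 ≤ l1) (hl2 : 0 ≤ l2)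
    (hB : 0 ≤ B) (hR : 0 ≤ R) : ∃ b₁ > 0, ∃ b₂ > 0, ∀ η₁ ∈ Set.Ioc 0 b₁, ∀ η₂ ∈ Set.Ioc 0 b₂,
      StepsizeOK α l1 l0 l2 B R η₁ η₂ := by
  set l := l1 + (B + (R + 1)) * l2 with hl
  have hl0 : 0 ≤ l := by positivity
  refine ⟨min (1 / α) (1 / (4 * (l + 1))), by positivity, α / (52 * l0 ^ 2 + 1), by positivity,
    fun η₁ h₁ η₂ h₂ => ⟨h₁.1, h₂.1, ?_, ?_, ?_⟩⟩
  · exact (le_div_iff₀ hα).1 (h₁.2.trans (min_le_left _ _))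
  · have h := (le_div_iff₀ (by positivity)).1 (h₁.2.trans (min_le_right _ _))
    have := h₁.1
    nlinarith
  · have h := (le_div_iff₀ (by positivity)).1 h₂.2
    have := h₂.1
    nlinarith

/-- For admissible stepsizes, counters of order `ε^{-1/2}` and `ln ε⁻¹` with large enough constants
solve every problem with the given regularity to accuracy `κ ε`. The radius `δ` of the restricted
secant inequality may depend on the problem and on `ε`, as long as it is of order at least `√ε`. -/
theorem exists_rate {α l1 l0 l2 B R η₁ η₂ C κ c₂ εmax : ℝ} (hα : 0 < α) (hR : 0 ≤ R)
    (hη : StepsizeOK α l1 l0 l2 B R η₁ η₂) (hC : 0 < C) (hκ : 0 < κ) (hc₂ : 0 < c₂)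
    (hεmax : 0 < εmax) :
    ∃ A₀ > 0, ∀ A ≥ A₀, ∃ A₀' > 0, ∀ A' ≥ A₀', ∀ ε ∈ Set.Ioc 0 εmax,
      ∀ {dy dc : ℕ} {h : Vec dy → ℝ} {c : Vec dy → Vec dc} {Y : Set (Vec dy)} {μs : Vec dc}
        {ys : Vec dy} {δ : ℝ}, SmoothSaddle h c Y α l1 l0 l2 → SaddleSol h c Y μs ys →
        ‖μs‖ ≤ B → 0 < δ → ArgminRSI h c Y μs ys C δ →
        32 * (R + 1) ^ 2 / η₂ * (c₂ * ε) < C * δ ^ 2 → ∀ y₀ ∈ Y, ∀ μ₀ ∈ orthant dc,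
        sqErr (y₀, μ₀) ys μs ≤ R ^ 2 →
        sqErr (maxMin (saddleFn h c) Y η₁ η₂ (outerCount A ε) (innerCount A' ε) y₀ μ₀) ys μs
          ≤ κ * ε := by
  have hη₁ := hη.η₁_pos
  have hη₂ := hη.η₂_pos
  have hS : 0 < accelConst α l0 R C η₁ η₂ := by rw [accelConst]; positivity
  have hηα : 0 < η₁ * α := mul_pos hη₁ hα
  obtain ⟨A₀, hA₀, H⟩ := exists_counts (ρ := 1 - η₁ * α / 2) (q := η₁)
    (Q := warmRadius α l0 R ^ 2 * η₂) (c₁ := min c₂ (κ / accelConst α l0 R C η₁ η₂))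
    (εmax := εmax) (by linarith [hη.strong]) (by linarith) hη₁ (by positivity) (by positivity) hεmax
  refine ⟨A₀, hA₀, fun A hA => ?_⟩
  obtain ⟨A₀', hA₀', H'⟩ := H A hA
  refine ⟨A₀', hA₀', fun A' hA' ε hε dy dc h c Y μs ys δ S hs hB hδ hRSI hball y₀ hy₀ μ₀ hμ₀ hst =>
    ?_⟩
  obtain ⟨hT, hK, h1, h2⟩ := H' A' hA' ε hε
  have e1 : 1 / (outerCount A ε : ℝ) ^ 2 ≤ c₂ * ε :=
    h1.trans (mul_le_mul_of_nonneg_right (min_le_left _ _) hε.1.le)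
  have e2 : 1 / (outerCount A ε : ℝ) ^ 2 ≤ κ / accelConst α l0 R C η₁ η₂ * ε :=
    h1.trans (mul_le_mul_of_nonneg_right (min_le_right _ _) hε.1.le)
  refine (maxMin_sqErr_le S hR hη hs hB hC hδ hRSI hT hK (by simpa only [mul_assoc] using h2)
    (lt_of_le_of_lt (mul_le_mul_of_nonneg_left e1 (by positivity)) hball) hy₀ hμ₀ hst).trans ?_
  refine (mul_le_mul_of_nonneg_left e2 hS.le).trans (le_of_eq ?_)
  field_simp

/-- The accelerated rate for a family of problems with a common radius in the restricted secant
inequality, with an arbitrarily small constant `κ`. -/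
theorem SaddleFamily.exists_rate {dx dy dc : ℕ} {h : Vec dx → Vec dy → ℝ}
    {c : Vec dx → Vec dy → Vec dc} {X : Set (Vec dx)} {Y : Set (Vec dy)} {α l1 l0 l2 : ℝ}
    (F : SaddleFamily h c X Y α l1 l0 l2) (hX : X.Nonempty) {μs : Vec dx → Vec dc}
    {ys : Vec dx → Vec dy} (hs : ∀ x ∈ X, SaddleSol (h x) (c x) Y (μs x) (ys x)) {B C δ : ℝ}
    (hB : ∀ x ∈ X, ‖μs x‖ ≤ B) (hC : 0 < C) (hδ : 0 < δ)
    (hRSI : ∀ x ∈ X, ArgminRSI (h x) (c x) Y (μs x) (ys x) C δ) {R εmax : ℝ} (hR : 0 ≤ R)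
    (hεmax : 0 < εmax) :
    ∃ b₁ > 0, ∃ b₂ > 0, ∀ η₁ ∈ Set.Ioc 0 b₁, ∀ η₂ ∈ Set.Ioc 0 b₂, ∀ κ > 0,
      ∃ A₀ > 0, ∀ A ≥ A₀, ∃ A₀' > 0, ∀ A' ≥ A₀', ∀ ε ∈ Set.Ioc 0 εmax, ∀ x ∈ X, ∀ y₀ ∈ Y,
        ∀ μ₀ ∈ orthant dc, sqErr (y₀, μ₀) (ys x) (μs x) ≤ R ^ 2 →
        sqErr (maxMin (saddleFn (h x) (c x)) Y η₁ η₂ (outerCount A ε) (innerCount A' ε) y₀ μ₀)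
          (ys x) (μs x) ≤ κ * ε := by
  obtain ⟨x₀, hx₀⟩ := hX
  have S₀ := F.saddle x₀ hx₀
  obtain ⟨b₁, hb₁, b₂, hb₂, Hb⟩ := exists_stepsizes (l0 := l0) S₀.α_pos S₀.l1_nonneg S₀.l2_nonneg
    ((norm_nonneg _).trans (hB x₀ hx₀)) hR
  refine ⟨b₁, hb₁, b₂, hb₂, fun η₁ h₁ η₂ h₂ κ hκ => ?_⟩
  have hη₂ := h₂.1
  obtain ⟨A₀, hA₀, H⟩ := _root_.exists_rate S₀.α_pos hR (Hb η₁ h₁ η₂ h₂) hC hκ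
    (c₂ := C * δ ^ 2 * η₂ / (64 * (R + 1) ^ 2 * εmax)) (by positivity) hεmax
  refine ⟨A₀, hA₀, fun A hA => ?_⟩
  obtain ⟨A₀', hA₀', H'⟩ := H A hA
  refine ⟨A₀', hA₀', fun A' hA' ε hε x hx y₀ hy₀ μ₀ hμ₀ hst =>
    H' A' hA' ε hε (F.saddle x hx) (hs x hx) (hB x hx) hδ (hRSI x hx) ?_ y₀ hy₀ μ₀ hμ₀ hst⟩
  have h3 : 32 * (R + 1) ^ 2 / η₂ * (C * δ ^ 2 * η₂ / (64 * (R + 1) ^ 2 * εmax) * ε)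
      = C * δ ^ 2 * (ε / εmax) / 2 := by
    have : R + 1 ≠ 0 := by positivity
    field_simp; ring
  have h4 : ε / εmax ≤ 1 := (div_le_one hεmax).2 hε.2
  have h5 : 0 < C * δ ^ 2 := by positivity
  rw [h3]
  nlinarith

theorem sqErr_smul_le {dy dc : ℕ} (a : ℝ) (q : Vec dy × Vec dc) (y : Vec dy) (μ : Vec dc) :
    sqErr (q.1, a • q.2) y (a • μ) ≤ (1 + a ^ 2) * sqErr q y μ := by
  simp only [sqErr]
  rw [← smul_sub, norm_smul, mul_pow, Real.norm_eq_abs, sq_abs]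
  nlinarith [sq_nonneg ‖q.1 - y‖, sq_nonneg ‖q.2 - μ‖, mul_nonneg (sq_nonneg a) (sq_nonneg ‖q.1 - y‖)]

/-- Total number of projected gradient steps, for accuracy `ε²` in the subproblems. -/
theorem bloccCost_le {A A' A'' ε : ℝ} (hA : 0 ≤ A) (hA' : 0 ≤ A') (hA'' : 0 ≤ A'') (hε : 0 < ε)
    (hε1 : ε ≤ Real.exp (-1)) (p : BLOCCParams) (h1 : p.Tg = outerCount A (ε ^ 2))
    (h2 : p.Tyg = innerCount A' (ε ^ 2)) (h3 : p.TF = outerCount A (ε ^ 2))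
    (h4 : p.TyF = innerCount A' (ε ^ 2)) :
    (bloccCost p ⌈A'' * ε ^ (-(3 / 2) : ℝ)⌉₊ : ℝ)
      ≤ (A'' + 1) * (2 * (A + 1) * (2 * A' + 2) + 1) * ε ^ (-(5 / 2) : ℝ) * Real.log ε⁻¹ := by
  set l := Real.log ε⁻¹ with hl
  have hl1 : 1 ≤ l := by
    rw [hl, Real.log_inv]
    have := Real.log_le_log hε hε1
    rw [Real.log_exp] at this
    linarith
  have hε1' : ε ≤ 1 := hε1.trans (Real.exp_le_one_iff.2 (by norm_num))
  have hT : (outerCount A (ε ^ 2) : ℝ) ≤ (A + 1) / ε := by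
    have := (outerCount_bounds hA (pow_pos hε 2)).2
    rw [Real.sqrt_sq hε.le] at this
    have e : 1 ≤ 1 / ε := (one_le_div hε).2 hε1'
    rw [add_div]
    linarith
  have hK' : (innerCount A' (ε ^ 2) : ℝ) + 1 ≤ (2 * A' + 2) * l := by
    have e1 : Real.log (ε ^ 2)⁻¹ = 2 * l := by
      rw [hl, Real.log_inv, Real.log_inv, Real.log_pow]; push_cast; ring
    have e2 : (innerCount A' (ε ^ 2) : ℝ) ≤ A' * (2 * l) + 1 := by
      rw [innerCount, e1, max_eq_right (by linarith)]
      exact (Nat.ceil_lt_add_one (by positivity)).le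
    linarith
  have hpow : 1 ≤ ε ^ (-(3 / 2) : ℝ) := Real.one_le_rpow_of_pos_of_le_one_of_nonpos hε hε1' (by norm_num)
  have hK : (⌈A'' * ε ^ (-(3 / 2) : ℝ)⌉₊ : ℝ) ≤ (A'' + 1) * ε ^ (-(3 / 2) : ℝ) := by
    have := (Nat.ceil_lt_add_one (show 0 ≤ A'' * ε ^ (-(3 / 2) : ℝ) by positivity)).le
    linarith
  have hprod : ε ^ (-(5 / 2) : ℝ) = ε ^ (-(3 / 2) : ℝ) * (1 / ε) := by
    rw [show (-(5 / 2) : ℝ) = -(3 / 2) + -1 by norm_num, Real.rpow_add hε, Real.rpow_neg_one,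
      one_div]
  simp only [bloccCost, maxMinCost, h1, h2, h3, h4]
  push_cast
  have hin : (outerCount A (ε ^ 2) : ℝ) * ((innerCount A' (ε ^ 2) : ℝ) + 1)
      ≤ (A + 1) / ε * ((2 * A' + 2) * l) := mul_le_mul hT hK' (by positivity) (by positivity)
  have hin2 : (outerCount A (ε ^ 2) : ℝ) * ((innerCount A' (ε ^ 2) : ℝ) + 1)
      + (outerCount A (ε ^ 2) : ℝ) * ((innerCount A' (ε ^ 2) : ℝ) + 1) + 1
      ≤ (2 * (A + 1) * (2 * A' + 2) + 1) * (1 / ε * l) := by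
    have e : 1 ≤ 1 / ε := (one_le_div hε).2 hε1'
    have e2 : 1 ≤ 1 / ε * l := one_le_mul_of_one_le_of_one_le e hl1
    have e3 : (A + 1) / ε * ((2 * A' + 2) * l) = (A + 1) * (2 * A' + 2) * (1 / ε * l) := by ring
    linarith
  refine (mul_le_mul hK hin2 (by positivity) (by positivity)).trans (le_of_eq ?_)
  rw [hprod]
  ring

end Parameters

/-! ### The penalized problem in the scaling by the penalty constant -/

section Assembly

variable {dx dy dc : ℕ} {P : BLOData dx dy dc} {lf0 lf1 lg1 lgx0 lgc0 lgc1 : ℝ≥0} {αg : ℝ}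

/-- Multipliers of size `O(γ)` and curvature of order `1/γ` for the penalized problem become
multipliers and curvature of order one after division by `γ`; the multipliers are then Lipschitz
in `x`. -/
theorem PenaltySetting.of_isMaxMin (hαg : 0 < αg)
    (hL : P.LipschitzAss lf0 lf1 lg1 lgx0 lgc0 lgc1) (hC : P.ConvexAss αg) (hD : P.DomainAss)
    {γ₁ γ : ℝ} (hγ₁ : 0 < γ₁) (hγ : γ₁ ≤ γ) (hα : (lf1 : ℝ) / γ₁ < αg)
    {μg : Vec dx → Vec dc} {yg : Vec dx → Vec dy}
    (hg : ∀ x ∈ P.X, IsMaxMin (P.Lg x) P.Y (μg x) (yg x)) {Bg : ℝ} (hBg : ∀ x ∈ P.X, ‖μg x‖ < Bg)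
    {μF : Vec dx → Vec dc} {yF : Vec dx → Vec dy}
    (hF : ∀ x ∈ P.X, IsMaxMin (P.LF γ x) P.Y (μF x) (yF x)) {BF : ℝ}
    (hBF : ∀ x ∈ P.X, ‖μF x‖ < BF * γ) {C δ : ℝ} (hC0 : 0 < C) (hδ : 0 < δ)
    (hR : ∀ x ∈ P.X, LocalRSI (dualFn (P.LF γ x) P.Y) (μF x) (C / γ) δ) :
    PenaltySetting P lf0 lf1 lg1 lgx0 lgc0 lgc1 αg (αg - lf1 / γ₁) (lf1 / γ₁ + lg1) γ₁ γ Bg BF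
        (2 * (lgc0 * (1 + ((lf1 / γ₁ + lg1) + BF * lgc1) / (αg - lf1 / γ₁))) / C) μg yg
        (fun x => γ⁻¹ • μF x) yF
      ∧ ∀ x ∈ P.X, ArgminRSI (P.penalized γ x) (P.gc x) P.Y (γ⁻¹ • μF x) (yF x) C (δ / γ) := by
  have hγ0 : 0 < γ := hγ₁.trans_le hγ
  have famG := BLOData.family_Lg hαg hL hC hD
  have famF := BLOData.family_LF hL hC hD hγ₁ hγ hα
  have solF' : ∀ x ∈ P.X,
      SaddleSol (fun y => γ * P.penalized γ x y) (P.gc x) P.Y (μF x) (yF x) := fun x hx =>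
    SaddleSol.of_isMaxMin ((famF.saddle x hx).const_mul hγ0) (BLOData.LF_eq (P := P) hγ0 x ▸ hF x hx)
  have solF := fun x hx => (solF' x hx).of_const_mul hγ0
  have hB : ∀ x ∈ P.X, ‖γ⁻¹ • μF x‖ ≤ BF := fun x hx => by
    rw [norm_smul, Real.norm_of_nonneg (inv_pos.2 hγ0).le, inv_mul_eq_div, div_le_iff₀ hγ0]
    exact (hBF x hx).le
  have hRSI : ∀ x ∈ P.X,
      ArgminRSI (P.penalized γ x) (P.gc x) P.Y (γ⁻¹ • μF x) (yF x) C (δ / γ) := fun x hx => by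
    have h1 := hR x hx
    rw [BLOData.LF_eq hγ0 x] at h1
    have h2 := (ArgminRSI.of_localRSI ((famF.saddle x hx).const_mul hγ0) (solF' x hx)
      h1).of_const_mul hγ0
    rwa [mul_div_cancel₀ _ hγ0.ne'] at h2
  exact ⟨⟨hL, hD, hγ₁, hγ, famG, famF,
    fun x hx => SaddleSol.of_isMaxMin (famG.saddle x hx) (hg x hx), solF,
    fun x hx => (hBg x hx).le, hB,
    fun x hx x' hx' => famF.multiplier_lipschitz hD.X_convex solF hB hC0 (div_pos hδ hγ0) hRSI hx
      hx'⟩, hRSI⟩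

theorem maxMin_LF {γ : ℝ} (hγ : 0 < γ) (x : Vec dx) (η₁ η₂ : ℝ) (T K : ℕ) (y₀ : Vec dy)
    (μ₀ : Vec dc) :
    ((maxMin (P.LF γ x) P.Y (η₁ / γ) (η₂ * γ) T K y₀ μ₀).1,
        γ⁻¹ • (maxMin (P.LF γ x) P.Y (η₁ / γ) (η₂ * γ) T K y₀ μ₀).2)
      = maxMin (saddleFn (P.penalized γ x) (P.gc x)) P.Y η₁ η₂ T K y₀ (γ⁻¹ • μ₀) := by
  rw [BLOData.LF_eq hγ, maxMin_const_mul _ _ _ hγ]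
  simp only [smul_smul, inv_mul_cancel₀ hγ.ne', one_smul]

theorem sqErr_le_of_inv_smul {γ : ℝ} (hγ : 0 < γ) (q : Vec dy × Vec dc) (y : Vec dy) (μ : Vec dc) :
    sqErr q y μ ≤ (1 + γ ^ 2) * sqErr (q.1, γ⁻¹ • q.2) y (γ⁻¹ • μ) := by
  have := sqErr_smul_le γ (q.1, γ⁻¹ • q.2) y (γ⁻¹ • μ)
  simpa only [smul_smul, mul_inv_cancel₀ hγ.ne', one_smul] using this

/-- The accelerated rate for the penalized problem, with multipliers measured after division by
`γ`. -/
theorem exists_rate_LF {γ αF l1F l0 l2 : ℝ} (hγ : 0 < γ)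
    (F : SaddleFamily (P.penalized γ) P.gc P.X P.Y αF l1F l0 l2) (hX : P.X.Nonempty)
    {ν : Vec dx → Vec dc} {yF : Vec dx → Vec dy}
    (hs : ∀ x ∈ P.X, SaddleSol (P.penalized γ x) (P.gc x) P.Y (ν x) (yF x)) {B C δ : ℝ}
    (hB : ∀ x ∈ P.X, ‖ν x‖ ≤ B) (hC : 0 < C) (hδ : 0 < δ)
    (hRSI : ∀ x ∈ P.X, ArgminRSI (P.penalized γ x) (P.gc x) P.Y (ν x) (yF x) C δ) {R εmax : ℝ}
    (hR : 0 ≤ R) (hεmax : 0 < εmax) :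
    ∃ b₁ > 0, ∃ b₂ > 0, ∀ η₁ ∈ Set.Ioc 0 b₁, ∀ η₂ ∈ Set.Ioc 0 b₂, ∀ κ > 0,
      ∃ A₀ > 0, ∀ A ≥ A₀, ∃ A₀' > 0, ∀ A' ≥ A₀', ∀ ε ∈ Set.Ioc 0 εmax, ∀ x ∈ P.X, ∀ y₀ ∈ P.Y,
        ∀ μ₀ ∈ orthant dc, sqErr (y₀, γ⁻¹ • μ₀) (yF x) (ν x) ≤ R ^ 2 →
        sqErr ((maxMin (P.LF γ x) P.Y η₁ η₂ (outerCount A ε) (innerCount A' ε) y₀ μ₀).1,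
          γ⁻¹ • (maxMin (P.LF γ x) P.Y η₁ η₂ (outerCount A ε) (innerCount A' ε) y₀ μ₀).2)
          (yF x) (ν x) ≤ κ * ε := by
  obtain ⟨b₁, hb₁, b₂, hb₂, H⟩ := F.exists_rate hX hs hB hC hδ hRSI hR hεmax
  refine ⟨b₁ / γ, div_pos hb₁ hγ, b₂ * γ, mul_pos hb₂ hγ, fun η₁ h₁ η₂ h₂ κ hκ => ?_⟩
  obtain ⟨A₀, hA₀, H⟩ := H (η₁ * γ) ⟨mul_pos h₁.1 hγ, (le_div_iff₀ hγ).1 h₁.2⟩ (η₂ / γ)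
    ⟨div_pos h₂.1 hγ, (div_le_iff₀ hγ).2 h₂.2⟩ κ hκ
  refine ⟨A₀, hA₀, fun A hA => ?_⟩
  obtain ⟨A₀', hA₀', H⟩ := H A hA
  refine ⟨A₀', hA₀', fun A' hA' ε hε x hx y₀ hy₀ μ₀ hμ₀ hst => ?_⟩
  have h := H A' hA' ε hε x hx y₀ hy₀ _ (smul_mem_orthant (inv_pos.2 hγ).le hμ₀) hst
  rwa [← maxMin_LF hγ, mul_div_cancel_right₀ _ hγ.ne', div_mul_cancel₀ _ hγ.ne'] at h

/-! ### Convergence of the subroutines for a fixed penalty constant -/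

theorem SaddleFamily.accelMaxMinRate {h : Vec dx → Vec dy → ℝ} {c : Vec dx → Vec dy → Vec dc}
    {X : Set (Vec dx)} {Y : Set (Vec dy)} {α l1 l0 l2 : ℝ} (F : SaddleFamily h c X Y α l1 l0 l2)
    (hX : X.Nonempty) {μs : Vec dx → Vec dc} {ys : Vec dx → Vec dy}
    (hs : ∀ x ∈ X, SaddleSol (h x) (c x) Y (μs x) (ys x)) {B C δ : ℝ}
    (hB : ∀ x ∈ X, ‖μs x‖ ≤ B) (hC : 0 < C) (hδ : 0 < δ)
    (hRSI : ∀ x ∈ X, ArgminRSI (h x) (c x) Y (μs x) (ys x) C δ) {εmax : ℝ} (hεmax : 0 < εmax) :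
    AccelMaxMinRate (fun x => saddleFn (h x) (c x)) X Y μs ys εmax := by
  intro R
  obtain ⟨b₁, hb₁, b₂, hb₂, H⟩ := F.exists_rate hX hs hB hC hδ hRSI (abs_nonneg R) hεmax
  refine ⟨b₁, hb₁, b₂, hb₂, fun η₁ h₁ η₂ h₂ => ?_⟩
  obtain ⟨A, hA, H⟩ := H η₁ h₁ η₂ h₂ 1 one_pos
  obtain ⟨A', hA', H⟩ := H A le_rfl
  exact ⟨A, hA, A', hA', 1, one_pos, fun ε hε x hx y₀ hy₀ μ₀ hμ₀ hst =>
    H A' le_rfl ε hε x hx y₀ hy₀ μ₀ hμ₀ (by rwa [sq_abs])⟩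

theorem accelMaxMinRate_LF {γ αF l1F l0 l2 : ℝ} (hγ : 0 < γ)
    (F : SaddleFamily (P.penalized γ) P.gc P.X P.Y αF l1F l0 l2) (hX : P.X.Nonempty)
    {μF : Vec dx → Vec dc} {yF : Vec dx → Vec dy}
    (hs : ∀ x ∈ P.X, SaddleSol (P.penalized γ x) (P.gc x) P.Y (γ⁻¹ • μF x) (yF x)) {B C δ : ℝ}
    (hB : ∀ x ∈ P.X, ‖γ⁻¹ • μF x‖ ≤ B) (hC : 0 < C) (hδ : 0 < δ)
    (hRSI : ∀ x ∈ P.X, ArgminRSI (P.penalized γ x) (P.gc x) P.Y (γ⁻¹ • μF x) (yF x) C δ)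
    {εmax : ℝ} (hεmax : 0 < εmax) : AccelMaxMinRate (P.LF γ) P.X P.Y μF yF εmax := by
  intro R
  have hi : 0 < γ⁻¹ := inv_pos.2 hγ
  obtain ⟨b₁, hb₁, b₂, hb₂, H⟩ := exists_rate_LF hγ F hX hs hB hC hδ hRSI
    (R := (1 + γ⁻¹) * |R|) (by positivity) hεmax
  refine ⟨b₁, hb₁, b₂, hb₂, fun η₁ h₁ η₂ h₂ => ?_⟩
  obtain ⟨A, hA, H⟩ := H η₁ h₁ η₂ h₂ 1 one_pos
  obtain ⟨A', hA', H⟩ := H A le_rfl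
  refine ⟨A, hA, A', hA', 1 + γ ^ 2, by positivity, fun ε hε x hx y₀ hy₀ μ₀ hμ₀ hst => ?_⟩
  refine (sqErr_le_of_inv_smul hγ _ _ _).trans (mul_le_mul_of_nonneg_left ?_ (by positivity))
  refine (H A' le_rfl ε hε x hx y₀ hy₀ μ₀ hμ₀ ?_).trans_eq (one_mul ε)
  refine (sqErr_smul_le γ⁻¹ (y₀, μ₀) _ _).trans ?_
  rw [mul_pow, sq_abs]
  refine mul_le_mul ?_ hst (by rw [sqErr]; positivity) (by positivity)
  nlinarith

theorem inner_convergence {αF l1F γ₁ γ Bg BF Lν : ℝ} {μg : Vec dx → Vec dc}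
    {yg : Vec dx → Vec dy} {μF : Vec dx → Vec dc} {yF : Vec dx → Vec dy}
    (H : PenaltySetting P lf0 lf1 lg1 lgx0 lgc0 lgc1 αg αF l1F γ₁ γ Bg BF Lν μg yg
      (fun x => γ⁻¹ • μF x) yF) {Cg δg CF δF : ℝ} (hCg : 0 < Cg) (hδg : 0 < δg) (hCF : 0 < CF)
    (hδF : 0 < δF) (hRg : ∀ x ∈ P.X, ArgminRSI (P.g x) (P.gc x) P.Y (μg x) (yg x) Cg δg)
    (hRF : ∀ x ∈ P.X, ArgminRSI (P.penalized γ x) (P.gc x) P.Y (γ⁻¹ • μF x) (yF x) CF δF)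
    {εmG εmF : ℝ} (hεmG : 0 < εmG) (hεmF : 0 < εmF) {s₀ : BLOCCState dx dy dc} (hs₀ : P.IsInit s₀)
    {η : ℝ} (hη : 0 < η) :
    ∃ bg1 > 0, ∃ bg2 > 0, ∃ bF1 > 0, ∃ bF2 > 0,
    ∀ ηg1 ∈ Set.Ioc 0 bg1, ∀ ηg2 ∈ Set.Ioc 0 bg2,
    ∀ ηF1 ∈ Set.Ioc 0 bF1, ∀ ηF2 ∈ Set.Ioc 0 bF2,
    ∃ A > 0, ∃ A' > 0, ∃ C > 0, ∀ εg ∈ Set.Ioc 0 εmG, ∀ εF ∈ Set.Ioc 0 εmF,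
      let p : BLOCCParams :=
        { γ := γ, η := η, ηg1 := ηg1, ηg2 := ηg2, ηF1 := ηF1, ηF2 := ηF2
          Tg := outerCount A εg, Tyg := innerCount A' εg
          TF := outerCount A εF, TyF := innerCount A' εF }
      ∀ t : ℕ,
        let s := P.blocc p s₀ t
        sqErr (P.outG p s) (yg s.x) (μg s.x) ≤ C * εg ∧
        sqErr (P.outF p s) (yF s.x) (μF s.x) ≤ C * εF := by
  have hγ := H.γ_pos
  have hX := H.dom.X_nonempty
  set D := η * γ * slopeConst lf0 lgx0 lgc0 γ₁ Bg BF with hD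
  set Rg := max (√(sqErr (s₀.yg, s₀.μg) (yg s₀.x) (μg s₀.x)))
    (restartRadius αg lg1 lgc0 lgc1 Bg D) with hRgd
  set RF := max (√(sqErr (s₀.yF, γ⁻¹ • s₀.μF) (yF s₀.x) (γ⁻¹ • μF s₀.x)))
    (restartRadius αF l1F lgc0 lgc1 BF D) with hRFd
  have hRg0 : 0 ≤ Rg := (Real.sqrt_nonneg _).trans (le_max_left _ _)
  have hRF0 : 0 ≤ RF := (Real.sqrt_nonneg _).trans (le_max_left _ _)
  obtain ⟨bg1, hbg1, bg2, hbg2, G⟩ := H.famG.exists_rate hX H.solG H.bddG hCg hδg hRg hRg0 hεmG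
  obtain ⟨bF1, hbF1, bF2, hbF2, F⟩ := exists_rate_LF hγ H.famF hX H.solF H.bddF hCF hδF hRF hRF0 hεmF
  refine ⟨bg1, hbg1, bg2, hbg2, bF1, hbF1, bF2, hbF2, fun ηg1 hg1 ηg2 hg2 ηF1 hF1 ηF2 hF2 => ?_⟩
  -- with these constants all errors are at most one, as restarting within a fixed radius requires
  obtain ⟨AG, hAG, G⟩ := G ηg1 hg1 ηg2 hg2 (1 / εmG) (by positivity)
  obtain ⟨AF, -, F⟩ := F ηF1 hF1 ηF2 hF2 (1 / εmF) (by positivity)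
  obtain ⟨AG', hAG', G⟩ := G (max AG AF) (le_max_left _ _)
  obtain ⟨AF', -, F⟩ := F (max AG AF) (le_max_right _ _)
  have G := G (max AG' AF') (le_max_left _ _)
  have F := F (max AG' AF') (le_max_right _ _)
  refine ⟨max AG AF, lt_max_of_lt_left hAG, max AG' AF', lt_max_of_lt_left hAG',
    1 / εmG + (1 + γ ^ 2) * (1 / εmF), by positivity, ?_⟩
  intro εg hεg εF hεF p t
  have hone : ∀ {ε εm : ℝ}, 0 < εm → ε ≤ εm → 1 / εm * ε ≤ 1 ^ 2 := fun h1 h2 => by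
    rw [one_pow, one_div_mul_eq_div]; exact (div_le_one h1).2 h2
  have hsol : PenaltySetting.SolverOK P p Rg RF (1 ^ 2) (1 ^ 2) μg yg (fun x => γ⁻¹ • μF x) yF :=
    ⟨fun x hx y₀ hy₀ μ₀ hμ₀ hst => (G εg hεg x hx y₀ hy₀ μ₀ hμ₀ hst).trans (hone hεmG hεg.2),
      fun x hx y₀ hy₀ μ₀ hμ₀ hst => (F εF hεF x hx y₀ hy₀ μ₀ hμ₀ hst).trans (hone hεmF hεF.2)⟩
  have hsq : ∀ {a b : ℝ}, 0 ≤ a → a ≤ (max (√a) b) ^ 2 := fun {a b} ha =>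
    (Real.sq_sqrt ha).ge.trans (pow_le_pow_left₀ (Real.sqrt_nonneg _) (le_max_left _ _) 2)
  have I₀ : PenaltySetting.OuterInv P γ Rg RF μg yg (fun x => γ⁻¹ • μF x) yF s₀ :=
    ⟨hs₀, hsq (by rw [sqErr]; positivity), hsq (by rw [sqErr]; positivity)⟩
  have I := H.outerInv_blocc (p := p) rfl hη le_rfl (le_max_right _ _) (le_max_right _ _) hsol I₀ t
  intro s
  have h1 := G εg hεg s.x I.init.x s.yg I.init.yg s.μg I.init.μg I.startG
  have h2 := F εF hεF s.x I.init.x s.yF I.init.yF s.μF I.init.μF I.startF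
  have hg0 := hεg.1
  have hF0 := hεF.1
  constructor
  · refine h1.trans (mul_le_mul_of_nonneg_right ?_ hg0.le)
    have : 0 ≤ (1 + γ ^ 2) * (1 / εmF) := by positivity
    linarith
  · refine (sqErr_le_of_inv_smul hγ _ _ _).trans ?_
    refine (mul_le_mul_of_nonneg_left h2 (by positivity)).trans ?_
    rw [← mul_assoc]
    refine mul_le_mul_of_nonneg_right ?_ hF0.le
    have : 0 ≤ 1 / εmG := by positivity
    linarith

/-! ### Overall complexity -/

theorem overall_complexity (hαg : 0 < αg) (hL : P.LipschitzAss lf0 lf1 lg1 lgx0 lgc0 lgc1)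
    (hC : P.ConvexAss αg) (hD : P.DomainAss) {μg : Vec dx → Vec dc} {yg : Vec dx → Vec dy}
    (hg : ∀ x ∈ P.X, IsMaxMin (P.Lg x) P.Y (μg x) (yg x)) {Bg : ℝ} (hBg : ∀ x ∈ P.X, ‖μg x‖ < Bg)
    {δg Cg : ℝ} (hδg : 0 < δg) (hCg : 0 < Cg)
    (hRg : ∀ x ∈ P.X, LocalRSI (dualFn (P.Lg x) P.Y) (μg x) Cg δg) {γ₀ : ℝ}
    {μF : ℝ → Vec dx → Vec dc} {yF : ℝ → Vec dx → Vec dy}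
    (hF : ∀ γ > γ₀, ∀ x ∈ P.X, IsMaxMin (P.LF γ x) P.Y (μF γ x) (yF γ x)) {BF : ℝ}
    (hBF : ∀ γ > γ₀, ∀ x ∈ P.X, ‖μF γ x‖ < BF * γ) {δF CF : ℝ} (hδF : 0 < δF) (hCF : 0 < CF)
    (hRF : ∀ γ > γ₀, ∀ x ∈ P.X, LocalRSI (dualFn (P.LF γ x) P.Y) (μF γ x) (CF / γ) δF) {m : ℝ}
    (hm : ∀ x ∈ P.X, ∀ y ∈ P.feas x, m ≤ P.f x y) {s₀ : BLOCCState dx dy dc} (hs₀ : P.IsInit s₀)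
    {cγ : ℝ} (hcγ : 0 < cγ) :
    ∃ b > 0, ∃ bg1 > 0, ∃ bg2 > 0, ∃ bF1 > 0, ∃ bF2 > 0,
    ∀ c ∈ Set.Ioc 0 b, ∀ cg1 ∈ Set.Ioc 0 bg1, ∀ cg2 ∈ Set.Ioc 0 bg2,
    ∀ cF1 ∈ Set.Ioc 0 bF1, ∀ cF2 ∈ Set.Ioc 0 bF2,
    ∃ A > 0, ∃ A' > 0, ∃ A'' > 0, ∃ C > 0, ∃ ε₀ > 0, ∀ ε ∈ Set.Ioc 0 ε₀,
      let γ : ℝ := cγ * ε ^ (-(1 / 2) : ℝ)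
      let p : BLOCCParams :=
        { γ := γ, η := c / γ, ηg1 := cg1, ηg2 := cg2, ηF1 := cF1 / γ, ηF2 := cF2 * γ
          Tg := outerCount A (ε ^ 2), Tyg := innerCount A' (ε ^ 2)
          TF := outerCount A (ε ^ 2), TyF := innerCount A' (ε ^ 2) }
      let K : ℕ := ⌈A'' * ε ^ (-(3 / 2) : ℝ)⌉₊
      γ₀ < γ ∧ 0 < K ∧
      P.avgProjGrad p s₀ K ≤ ε ∧
      (bloccCost p K : ℝ) ≤ C * ε ^ (-(5 / 2) : ℝ) * Real.log ε⁻¹ := by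
  have hx₀ := hs₀.x
  have hX := hD.X_nonempty
  have hBg0 : 0 ≤ Bg := (norm_nonneg _).trans (hBg _ hx₀).le
  have hBF0 : 0 ≤ BF := by
    have h1 := (norm_nonneg _).trans_lt (hBF (|γ₀| + 1) (by linarith [le_abs_self γ₀]) _ hx₀)
    exact (pos_of_mul_pos_left h1 (by positivity)).le
  set γ₁ : ℝ := lf1 / αg + 1 with hγ₁d
  have hγ₁ : 0 < γ₁ := by positivity
  have hα : (lf1 : ℝ) / γ₁ < αg := by
    rw [div_lt_iff₀ hγ₁, hγ₁d, mul_add, mul_div_cancel₀ _ hαg.ne']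
    linarith
  set αF := αg - lf1 / γ₁ with hαFd
  have hαF : 0 < αF := sub_pos.2 hα
  set l1F : ℝ := lf1 / γ₁ + lg1 with hl1F
  set Lν := 2 * (lgc0 * (1 + (l1F + BF * lgc1) / αF)) / CF with hLν
  have HS := fun γ (h₁ : γ₁ ≤ γ) (h₀ : γ₀ < γ) =>
    PenaltySetting.of_isMaxMin hαg hL hC hD hγ₁ h₁ hα hg hBg (hF γ h₀) (hBF γ h₀) hCF hδF (hRF γ h₀)
  have famG := BLOData.family_Lg hαg hL hC hD
  have solG : ∀ x ∈ P.X, SaddleSol (P.g x) (P.gc x) P.Y (μg x) (yg x) := fun x hx =>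
    SaddleSol.of_isMaxMin (famG.saddle x hx) (hg x hx)
  have rsiG : ∀ x ∈ P.X, ArgminRSI (P.g x) (P.gc x) P.Y (μg x) (yg x) Cg δg := fun x hx =>
    ArgminRSI.of_localRSI (famG.saddle x hx) (solG x hx) (hRg x hx)
  set L := smoothConst lf1 lg1 lgc0 lgc1 αg γ₁ Bg BF Lν with hLd
  set E := errConst lf1 lg1 lgc0 lgc1 γ₁ Bg BF with hEd
  set S := slopeConst lf0 lgx0 lgc0 γ₁ Bg BF with hSd
  have hE : 0 ≤ E := by rw [hEd, errConst]; positivity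
  have hS : 0 ≤ S := by rw [hSd, slopeConst]; positivity
  set b := 1 / (4 * (|L| + 1)) with hb
  set Rg := max (√(sqErr (s₀.yg, s₀.μg) (yg s₀.x) (μg s₀.x)))
    (restartRadius αg lg1 lgc0 lgc1 Bg (b * S)) with hRgd
  -- a bound, uniform in `γ`, for the distance of the starting point from the rescaled solution
  set RF := max (‖s₀.yF - yg s₀.x‖ + 2 * (lf0 / γ₁ + (BF + Bg) * lgc0) / αF
      + (‖s₀.μF‖ / γ₁ + BF)) (restartRadius αF l1F lgc0 lgc1 BF (b * S)) with hRFd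
  have hRg0 : 0 ≤ Rg := (Real.sqrt_nonneg _).trans (le_max_left _ _)
  have hRF0 : 0 ≤ RF := le_trans (by positivity) (le_max_left _ _)
  obtain ⟨bg1, hbg1, bg2, hbg2, G⟩ := famG.exists_rate hX solG (fun x hx => (hBg x hx).le) hCg hδg
    rsiG hRg0 one_pos
  obtain ⟨bF1, hbF1, bF2, hbF2, F⟩ := exists_stepsizes (l0 := lgc0) (l2 := lgc1) hαF
    (show 0 ≤ l1F by positivity) lgc1.2 hBF0 hRF0
  refine ⟨b, by positivity, bg1, hbg1, bg2, hbg2, bF1, hbF1, bF2, hbF2,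
    fun c hc cg1 hg1 cg2 hg2 cF1 hF1 cF2 hF2 => ?_⟩
  have hc0 := hc.1
  have hcF2 := hF2.1
  -- error tolerance `(ς ε)²` in the subproblems, small enough for the `γ²`-fold amplification
  set ς := 1 / (2 * (cγ * E + 1)) with hς
  have hς0 : 0 < ς := by positivity
  have hςE : cγ * E * ς ≤ 1 / 2 := by
    rw [hς, mul_one_div, div_le_div_iff₀ (by positivity) two_pos]
    linarith
  have hς1 : ς ≤ 1 := by
    rw [hς, div_le_one (by positivity)]
    have : 0 ≤ cγ * E := by positivity
    linarith
  obtain ⟨AG, hAG, G⟩ := G cg1 hg1 cg2 hg2 (ς ^ 2) (by positivity)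
  -- after rescaling, the curvature radius is `δF / γ`, of order `√ε`
  obtain ⟨AF, -, F⟩ := exists_rate hαF hRF0 (F cF1 hF1 cF2 hF2) hCF (pow_pos hς0 2)
    (c₂ := CF * δF ^ 2 * cF2 / (64 * (RF + 1) ^ 2 * cγ ^ 2)) (by positivity) one_pos
  obtain ⟨AG', hAG', G⟩ := G (max AG AF) (le_max_left _ _)
  obtain ⟨AF', -, F⟩ := F (max AG AF) (le_max_right _ _)
  replace G := G (max AG' AF') (le_max_left _ _)
  replace F := F (max AG' AF') (le_max_right _ _)
  set A := max AG AF with hA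
  set A' := max AG' AF' with hA'
  have hA0 : 0 < A := lt_max_of_lt_left hAG
  have hA'0 : 0 < A' := lt_max_of_lt_left hAG'
  set Δ := P.f s₀.x (yg s₀.x) - m with hΔ
  have hΔ0 : 0 ≤ Δ := sub_nonneg.2 (hm _ hx₀ _ (BLOData.v_eq (solG _ hx₀)).1)
  set A'' := 4 * Δ * cγ / c + 1 with hA''
  have hA''0 : 0 < A'' := by positivity
  refine ⟨A, hA0, A', hA'0, A'', hA''0, (A'' + 1) * (2 * (A + 1) * (2 * A' + 2) + 1), by positivity,
    min (Real.exp (-1)) ((cγ / (γ₁ + |γ₀| + 1)) ^ 2), by positivity, ?_⟩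
  intro ε hε γ p K
  have hε0 := hε.1
  have hεe : ε ≤ Real.exp (-1) := hε.2.trans (min_le_left _ _)
  have hε1 : ε ≤ 1 := hεe.trans (Real.exp_le_one_iff.2 (by norm_num))
  have hsε : 0 < √ε := Real.sqrt_pos.2 hε0
  have hγeq : γ = cγ / √ε := by simp only [γ]; rw [rpow_neg_half hε0]; rfl
  have hγbig : γ₁ + |γ₀| + 1 ≤ γ := by
    have h1 : √ε ≤ cγ / (γ₁ + |γ₀| + 1) :=
      (Real.sqrt_le_left (by positivity)).2 (hε.2.trans (min_le_right _ _))
    rw [le_div_iff₀ (by positivity)] at h1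
    rw [hγeq, le_div_iff₀ hsε]
    linarith
  have hγ₁le : γ₁ ≤ γ := by linarith [abs_nonneg γ₀]
  have hγ₀lt : γ₀ < γ := by linarith [le_abs_self γ₀]
  have hγ0 : 0 < γ := hγ₁.trans_le hγ₁le
  have hγ2 : γ ^ 2 * ε = cγ ^ 2 := by
    rw [hγeq, div_pow, Real.sq_sqrt hε0.le, div_mul_cancel₀ _ hε0.ne']
  obtain ⟨H, rsiF⟩ := HS γ hγ₁le hγ₀lt
  have hε2 : ε ^ 2 ∈ Set.Ioc (0 : ℝ) 1 := ⟨by positivity, pow_le_one₀ hε0.le hε1⟩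
  have hball : 32 * (RF + 1) ^ 2 / cF2
      * (CF * δF ^ 2 * cF2 / (64 * (RF + 1) ^ 2 * cγ ^ 2) * ε ^ 2) < CF * (δF / γ) ^ 2 := by
    have hR1 : RF + 1 ≠ 0 := by positivity
    have e1 : CF * (δF / γ) ^ 2 = CF * δF ^ 2 / cγ ^ 2 * ε := by
      rw [← hγ2]; field_simp
    have e2 : 32 * (RF + 1) ^ 2 / cF2
        * (CF * δF ^ 2 * cF2 / (64 * (RF + 1) ^ 2 * cγ ^ 2) * ε ^ 2)
        = CF * δF ^ 2 / cγ ^ 2 * (ε * (ε / 2)) := by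
      field_simp; ring
    rw [e1, e2]
    exact mul_lt_mul_of_pos_left (mul_lt_of_lt_one_right hε0 (by linarith only [hε1]))
      (by positivity)
  have hsol : PenaltySetting.SolverOK P p Rg RF ((ς * ε) ^ 2) ((ς * ε) ^ 2) μg yg
      (fun x => γ⁻¹ • μF γ x) (yF γ) := by
    rw [mul_pow]
    refine ⟨fun x hx y₀ hy₀ μ₀ hμ₀ hst => G _ hε2 x hx y₀ hy₀ μ₀ hμ₀ hst,
      fun x hx y₀ hy₀ μ₀ hμ₀ hst => ?_⟩
    have h := F _ hε2 (H.famF.saddle x hx) (H.solF x hx) (H.bddF x hx) (div_pos hδF hγ0)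
      (rsiF x hx) hball y₀ hy₀ _ (smul_mem_orthant (inv_pos.2 hγ0).le hμ₀) hst
    rwa [← maxMin_LF hγ0] at h
  have he1 : ς * ε ≤ 1 := mul_le_one₀ hς1 hε0.le hε1
  have he0 : 0 ≤ ς * ε := by positivity
  have hsq1 : (ς * ε) ^ 2 ≤ 1 ^ 2 := pow_le_pow_left₀ he0 he1 2
  have hsol1 : PenaltySetting.SolverOK P p Rg RF (1 ^ 2) (1 ^ 2) μg yg
      (fun x => γ⁻¹ • μF γ x) (yF γ) :=
    ⟨fun x hx y₀ hy₀ μ₀ hμ₀ hst => (hsol.outG x hx y₀ hy₀ μ₀ hμ₀ hst).trans hsq1,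
      fun x hx y₀ hy₀ μ₀ hμ₀ hst => (hsol.outF x hx y₀ hy₀ μ₀ hμ₀ hst).trans hsq1⟩
  have I₀ : PenaltySetting.OuterInv P γ Rg RF μg yg (fun x => γ⁻¹ • μF γ x) (yF γ) s₀ := by
    refine ⟨hs₀, ?_, sqErr_le_of_norm_le
      (a := ‖s₀.yF - yg s₀.x‖ + 2 * (lf0 / γ₁ + (BF + Bg) * lgc0) / αF)
      (b := ‖s₀.μF‖ / γ₁ + BF) ?_ ?_ (le_max_left _ _)⟩
    · refine (Real.sq_sqrt (by rw [sqErr]; positivity)).ge.trans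
        (pow_le_pow_left₀ (Real.sqrt_nonneg _) (le_max_left _ _) 2)
    · have h1 := H.norm_yF_sub_yg_le hx₀
      have h2 := norm_sub_le_norm_sub_add_norm_sub s₀.yF (yg s₀.x) (yF γ s₀.x)
      rw [norm_sub_rev (yg s₀.x)] at h2
      exact h2.trans (add_le_add_right h1 _)
    · refine (norm_sub_le _ _).trans (add_le_add ?_ (H.bddF _ hx₀))
      rw [norm_smul, Real.norm_of_nonneg (inv_pos.2 hγ0).le]
      exact H.inv_mul_le (norm_nonneg _)
  have hηpos : 0 < p.η := div_pos hc0 hγ0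
  have hstep : p.η * γ * S ≤ b * S := by
    have : p.η * γ = c := div_mul_cancel₀ _ hγ0.ne'
    rw [this]
    exact mul_le_mul_of_nonneg_right hc.2 hS
  have hcL : c * L ≤ 1 / 4 := by
    have h1 := (le_div_iff₀ (by positivity)).1 hc.2
    have h2 := mul_le_mul_of_nonneg_left (le_abs_self L) hc0.le
    linarith
  have hKpos : 0 < K := Nat.ceil_pos.2 (by positivity)
  have hKR : (0 : ℝ) < K := by exact_mod_cast hKpos
  refine ⟨hγ₀lt, hKpos, ?_, bloccCost_le hA0.le hA'0.le hA''0.le hε0 hεe p rfl rfl rfl rfl⟩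
  have hI := H.outerInv_blocc (p := p) rfl hηpos hstep (le_max_right _ _) (le_max_right _ _) hsol1 I₀
  refine (H.avgProjGrad_le (p := p) rfl hc0 rfl hcL he0 he1 hsol hI hm hKpos).trans ?_
  have hA1 : 2 * γ * Δ / (c * K) ≤ ε / 2 := by
    have h1 : A'' * ε ^ (-(3 / 2) : ℝ) ≤ K := Nat.le_ceil _
    have h2 : ε * ε ^ (-(3 / 2) : ℝ) = ε ^ (-(1 / 2) : ℝ) := by
      rw [show (-(1 / 2) : ℝ) = 1 + -(3 / 2) by norm_num, Real.rpow_add hε0, Real.rpow_one]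
    have h3 : 4 * Δ * cγ ≤ c * A'' := by
      rw [hA'', mul_add, mul_div_cancel₀ _ hc0.ne']; linarith
    have h4 := mul_le_mul_of_nonneg_right h3 (Real.rpow_nonneg hε0.le (-(1 / 2)))
    have h5 := mul_le_mul_of_nonneg_left h1 (mul_pos hc0 hε0).le
    have h6 : c * ε * (A'' * ε ^ (-(3 / 2) : ℝ)) = c * A'' * ε ^ (-(1 / 2) : ℝ) := by
      rw [← h2]; ring
    have h7 : 4 * Δ * cγ * ε ^ (-(1 / 2) : ℝ) = 4 * Δ * γ := by simp only [γ]; ring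
    rw [div_le_div_iff₀ (mul_pos hc0 hKR) two_pos]
    linarith
  have hA2 : 2 * (γ * (E * (ς * ε))) ^ 2 ≤ ε / 2 := by
    have h1 : 2 * (γ * (E * (ς * ε))) ^ 2 = 2 * ε * (cγ * E * ς) ^ 2 := by
      have : (cγ * E * ς) ^ 2 = γ ^ 2 * ε * (E * ς) ^ 2 := by rw [hγ2]; ring
      rw [this]; ring
    have h2 : (cγ * E * ς) ^ 2 ≤ (1 / 2) ^ 2 := pow_le_pow_left₀ (by positivity) hςE 2
    have h3 := mul_le_mul_of_nonneg_left h2 (show 0 ≤ 2 * ε by positivity)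
    linarith only [h1, h3]
  linarith only [hA1, hA2]

end Assembly

theorem theorem3 {dx dy dc : ℕ} (P : BLOData dx dy dc)
    (lf0 lf1 lg1 lgx0 lgc0 lgc1 : ℝ≥0) (αg : ℝ) (hαg : 0 < αg)
    (hLip : P.LipschitzAss lf0 lf1 lg1 lgx0 lgc0 lgc1)
    (hConv : P.ConvexAss αg) (hDom : P.DomainAss) (hLICQ : P.LICQ)
    -- the max-min solutions of the lower-level problem, bounded multipliers, local curvature
    (μg : Vec dx → Vec dc) (yg : Vec dx → Vec dy)
    (hg : ∀ x ∈ P.X, IsMaxMin (P.Lg x) P.Y (μg x) (yg x))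
    (Bg : ℝ) (hBg : ∀ x ∈ P.X, ‖μg x‖ < Bg)
    (δg Cg : ℝ) (hδg : 0 < δg) (hCg : 0 < Cg)
    (hRSIg : ∀ x ∈ P.X, LocalRSI (dualFn (P.Lg x) P.Y) (μg x) Cg δg) :
    -- inner convergence, for a fixed penalty constant
    (∀ γ : ℝ, (lf1 : ℝ) / αg < γ →
      ∀ (μF : Vec dx → Vec dc) (yF : Vec dx → Vec dy),
      (∀ x ∈ P.X, IsMaxMin (P.LF γ x) P.Y (μF x) (yF x)) →
      ∀ BF : ℝ, (∀ x ∈ P.X, ‖μF x‖ < BF) →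
      ∀ δF CF : ℝ, 0 < δF → 0 < CF →
      (∀ x ∈ P.X, LocalRSI (dualFn (P.LF γ x) P.Y) (μF x) CF δF) →
        -- the subroutine on each of the two problems, uniformly in `x`
        AccelMaxMinRate P.Lg P.X P.Y μg yg (Cg / 2 * δg) ∧
        AccelMaxMinRate (P.LF γ) P.X P.Y μF yF (CF / 2 * δF) ∧
        -- the iterates of the whole algorithm
        (∀ s₀ : BLOCCState dx dy dc, P.IsInit s₀ → ∀ η > 0,
          ∃ bg1 > 0, ∃ bg2 > 0, ∃ bF1 > 0, ∃ bF2 > 0,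
          ∀ ηg1 ∈ Set.Ioc 0 bg1, ∀ ηg2 ∈ Set.Ioc 0 bg2,
          ∀ ηF1 ∈ Set.Ioc 0 bF1, ∀ ηF2 ∈ Set.Ioc 0 bF2,
          ∃ A > 0, ∃ A' > 0, ∃ C > 0,
          ∀ εg ∈ Set.Ioc 0 (Cg / 2 * δg), ∀ εF ∈ Set.Ioc 0 (CF / 2 * δF),
            let p : BLOCCParams :=
              { γ := γ, η := η, ηg1 := ηg1, ηg2 := ηg2, ηF1 := ηF1, ηF2 := ηF2
                Tg := outerCount A εg, Tyg := innerCount A' εg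
                TF := outerCount A εF, TyF := innerCount A' εF }
            ∀ t : ℕ,
              let s := P.blocc p s₀ t
              sqErr (P.outG p s) (yg s.x) (μg s.x) ≤ C * εg ∧
              sqErr (P.outF p s) (yF s.x) (μF s.x) ≤ C * εF)) ∧
    -- overall complexity, with penalty constant of order `ε^{-1/2}`
    (∀ γ₀ : ℝ, (lf1 : ℝ) / αg ≤ γ₀ →
      ∀ (μF : ℝ → Vec dx → Vec dc) (yF : ℝ → Vec dx → Vec dy),
      (∀ γ > γ₀, ∀ x ∈ P.X, IsMaxMin (P.LF γ x) P.Y (μF γ x) (yF γ x)) →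
      ∀ BF : ℝ, (∀ γ > γ₀, ∀ x ∈ P.X, ‖μF γ x‖ < BF * γ) →
      ∀ δF CF : ℝ, 0 < δF → 0 < CF →
      (∀ γ > γ₀, ∀ x ∈ P.X, LocalRSI (dualFn (P.LF γ x) P.Y) (μF γ x) (CF / γ) δF) →
      ∀ m : ℝ, (∀ x ∈ P.X, ∀ y ∈ P.feas x, m ≤ P.f x y) →
      ∀ s₀ : BLOCCState dx dy dc, P.IsInit s₀ → ∀ cγ > 0,
        ∃ b > 0, ∃ bg1 > 0, ∃ bg2 > 0, ∃ bF1 > 0, ∃ bF2 > 0,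
        ∀ c ∈ Set.Ioc 0 b, ∀ cg1 ∈ Set.Ioc 0 bg1, ∀ cg2 ∈ Set.Ioc 0 bg2,
        ∀ cF1 ∈ Set.Ioc 0 bF1, ∀ cF2 ∈ Set.Ioc 0 bF2,
        ∃ A > 0, ∃ A' > 0, ∃ A'' > 0, ∃ C > 0, ∃ ε₀ > 0, ∀ ε ∈ Set.Ioc 0 ε₀,
          let γ : ℝ := cγ * ε ^ (-(1 / 2) : ℝ)
          let p : BLOCCParams :=
            { γ := γ, η := c / γ, ηg1 := cg1, ηg2 := cg2, ηF1 := cF1 / γ, ηF2 := cF2 * γ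
              Tg := outerCount A (ε ^ 2), Tyg := innerCount A' (ε ^ 2)
              TF := outerCount A (ε ^ 2), TyF := innerCount A' (ε ^ 2) }
          let K : ℕ := ⌈A'' * ε ^ (-(3 / 2) : ℝ)⌉₊
          γ₀ < γ ∧ 0 < K ∧
          P.avgProjGrad p s₀ K ≤ ε ∧
          (bloccCost p K : ℝ) ≤ C * ε ^ (-(5 / 2) : ℝ) * Real.log ε⁻¹) := by
  have famG := BLOData.family_Lg hαg hLip hConv hDom
  have solG : ∀ x ∈ P.X, SaddleSol (P.g x) (P.gc x) P.Y (μg x) (yg x) := fun x hx =>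
    SaddleSol.of_isMaxMin (famG.saddle x hx) (hg x hx)
  have rsiG : ∀ x ∈ P.X, ArgminRSI (P.g x) (P.gc x) P.Y (μg x) (yg x) Cg δg := fun x hx =>
    ArgminRSI.of_localRSI (famG.saddle x hx) (solG x hx) (hRSIg x hx)
  have hX := hDom.X_nonempty
  refine ⟨fun γ hγ μF yF hF BF hBF δF CF hδF hCF hRSIF => ?_,
    fun γ₀ _ μF yF hF BF hBF δF CF hδF hCF hRSIF m hm s₀ hs₀ cγ hcγ =>
      overall_complexity hαg hLip hConv hDom hg hBg hδg hCg hRSIg hF hBF hδF hCF hRSIF hm hs₀ hcγ⟩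
  have hγ0 : 0 < γ := (div_nonneg lf1.2 hαg.le).trans_lt hγ
  have hα : (lf1 : ℝ) / γ < αg := by
    rw [div_lt_iff₀ hαg] at hγ
    rw [div_lt_iff₀ hγ0]
    linarith
  -- for a fixed penalty constant no uniformity in `γ` is needed, and `γ₁ = γ`
  obtain ⟨H, rsiF⟩ := PenaltySetting.of_isMaxMin hαg hLip hConv hDom hγ0 le_rfl hα hg hBg hF
    (BF := BF / γ) (fun x hx => by rw [div_mul_cancel₀ _ hγ0.ne']; exact hBF x hx)
    (C := γ * CF) (mul_pos hγ0 hCF) hδF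
    (fun x hx => by rw [mul_div_cancel_left₀ _ hγ0.ne']; exact hRSIF x hx)
  have hεg : 0 < Cg / 2 * δg := by positivity
  have hεF : 0 < CF / 2 * δF := by positivity
  exact ⟨famG.accelMaxMinRate hX solG H.bddG hCg hδg rsiG hεg,
    accelMaxMinRate_LF hγ0 H.famF hX H.solF H.bddF (mul_pos hγ0 hCF) (div_pos hδF hγ0) rsiF hεF,
    fun s₀ hs₀ η hη => inner_convergence H hCg hδg (mul_pos hγ0 hCF) (div_pos hδF hγ0) rsiG rsiF
      hεg hεF hs₀ hη⟩
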